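/- **For-programs.** Fix a set $\mathcal D$ of letters. Programs are considered up to renaming of bound variables and variables are never shadowed. The syntax is * constants: $c ::= \mathsf{char}\,a \mid \mathsf{list}(c_1,\dots,c_m)$, with $a\in\mathcal D$; * boolean expressions: $e ::= \mathsf{true}\mid\mathsf{false}\mid\neg e\mid e\ \mathrm{op}\ e\ (\mathrm{op}\in\{\wedge,\vee,\Rightarrow,\Leftrightarrow\})\mid b\mid i\bowtie j\ ({\bowtie}\in\{=,\neq,<,\le,>,\ge\})\mid c=o\mid f(\vec a)\mid\langle s\rangle$; * list expressions: $o ::= x\mid c\mid[o_1,\dots,o_m]\mid f(\vec a)\mid\{s\}$, an argument $a=(o,p_1,\dots,p_\ell)$ being a list expression with position variables; * statements: $s ::= \mathsf{skip}\mid\mathsf{if}\ e\ \mathsf{then}\ s\ \mathsf{else}\ s\mid\mathsf{yield}\ o\mid\mathsf{return}\ o\mid\mathsf{return}\ e\mid\mathsf{let}\ x=o\ \mathsf{in}\ s\mid\mathsf{let\ mut}\ b=\mathsf{false}\ \mathsf{in}\ s\mid b\leftarrow\mathsf{true}\mid\mathsf{for}^{\to}(i,x)\ \mathsf{in}\ o\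 \mathsf{do}\ s\mid\mathsf{for}^{\leftarrow}(i,x)\ \mathsf{in}\ o\ \mathsf{do}\ s\mid s;s$. Here $\{s\}$ and $\langle s\rangle$ are list and boolean generators (run $s$, with all boolean variables hidden, and take its output or its returned boolean). A program is a list of function definitions, each with declared argument types $(\mathsf{Out}[n],\ell)$ (a nested word of depth $n$ with $\ell$ positions in it) and result type $\mathsf{Bool}$ or $\mathsf{Out}[n]$, together with the choice of a main function. Constants, lists and generators carry their depth. Types are $\mathsf{Bool}$, $\mathsf{Out}[n]$ and $\mathsf{Pos}[o]$ for a list expression $o$; typing is the usual one, with: a loop over $o:\mathsf{Out}[n+1]$ binds $i:\mathsf{Pos}[o]$ and $x:\mathsf{Out}[n]$; $i\bowtie j$ requires $i,j:\mathsf{Pos}[o]$ for the same $o$; $c=o$ requires $c,o:\mathsf{Out}[n]$; $\mathsf{yield}\ o:\mathsf{Out}[n+1]$ and $\mathsf{return}\ o:\mathsf{Out}[n]$ if $o:\mathsf{Out}[n]$; the body of a generator is typed without boolean variables; an argument $(o,\vec p)$ requires each $p_k:\mathsf{Pos}[o]$; a function may only call functions defined before it. **The rewriting steps.** * (A) Choose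 a constant $c$ occurring in a literal equality $c=o$ other than a label test $\mathsf{char}\,a=x$ with $x$ bound by a loop; replace all such equalities with $c$ by calls to a new function that tests equality with $c$ by traversing its input ($\mathsf{list}(c_1,\dots,c_m)$: comparing the elements with $c_1,\dots,c_m$, using $m$ booleans; $\mathsf{char}\,a$: traversing the list $[o]$). * (B) Choose a constant list $c=\mathsf{list}(c_1,\dots,c_m)$ occurring as a list expression; replace all such occurrences by calls to a new function with body $\mathsf{yield}\,c_1;\dots;\mathsf{yield}\,c_m$. Or replace all list expressions $[o_1,\dots,o_m]$ by $\{\mathsf{yield}\ o_1;\dots;\mathsf{yield}\ o_m\}$. * (C) Choose a function $f(x_1,\dots,x_n)$ with body $s$, other than main; replace all calls $f(a_1,\dots,a_n)$ by $\{s[a_1/x_1,\dots,a_n/x_n]\}$ (by $\langle\cdots\rangle$ if $f$ is boolean) and drop $f$. * (D) Eliminate boolean generators: $\mathsf{if}\ e\ \mathsf{then}\ s_2\ \mathsf{else}\ s_3$ becomes $\mathsf{let\ mut}\ b=\mathsf{false}\ \mathsf{in}\ (s_e;\mathsf{if}\ b\ \mathsf{then}\ s_2\ \mathsf{else}\ s_3)$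 where $s_e$ evaluates $e$ into $b$; for $e=\langle s_1\rangle$, $s_e$ is $s_1$ with $\mathsf{return}\ e'$ replaced by $\mathsf{if}\ e'\ \mathsf{then}\ b\leftarrow\mathsf{true}$, guarded by a fresh boolean so that only the first return counts. Similarly for $\mathsf{return}\ e$. * (E) Replace $\mathsf{let}\ x=o\ \mathsf{in}\ s$ by $s[x\mapsto o]$. * (F) Eliminate returns of lists: in bodies of type $\mathsf{Out}[n+1]$, guard yields and returns by a fresh boolean "has returned" and replace $\mathsf{return}\ o$ by $\mathsf{for}^{\to}(i,x)\ \mathsf{in}\ o\ \mathsf{do}\ \mathsf{yield}\ x$; a generator $\{s\}:\mathsf{Out}[0]$ is turned into a generator $\{s'\}:\mathsf{Out}[1]$ whose $s'$ yields the character instead of returning it, and $\mathsf{yield}\,\{s\}$ becomes $\mathsf{for}^{\to}(i,x)\ \mathsf{in}\ \{s'\}\ \mathsf{do}\ \mathsf{yield}\ x$ (likewise for $\mathsf{return}\,\{s\}$). * (G) Expand the loops over list generators: $\mathsf{for}^{\to}(i,x)\ \mathsf{in}\ \{s_1\}\ \mathsf{do}\ s_2$ becomes the (expanded) $s_1$ in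 which every $\mathsf{yield}\ e$ is replaced by $s_2[x\mapsto e]$; comparisons involving $i$ become comparisons, in the order of execution of $s_1$, of addresses of yield statements with the position variables visible there. For backward loops, $s_1$ is replaced by its reversal (boolean declarations removed, conditionals turned into sequences, loops and sequences reversed), in which each yield is replaced by a copy of $s_1$ that only keeps the element yielded at the same address. Tests between two characters are evaluated. * (H) Move declarations of booleans upwards through sequences, conditionals and let statements, so that they stand at the beginning of the program, of a generator or of a for loop. In each of (D)–(H) the rewriting is done throughout the program, and it is possible only if there is something to eliminate, that is: a boolean generator; a let-output statement; a list return or a generator of type $\mathsf{Out}[0]$; a loop over a list expression that is not a variable; a boolean declaration directly below a sequence, a conditional or a let statement. Steps A–E and H apply to all well-typed programs; F to programs to which none of A–E is applicable and whose result type is not $\mathsf{Out}[0]$; G to programs of type $\mathsf{Out}[1]\to\mathsf{Out}[1]$ (one word, no positions) to which none of A–F is applicable. A program is *normalized* if none of A–H is applicable to it. **Simple for-programs.** A first-order simple for-program is a statement $t$ preceded by declarations of boolean variables (initially false), where $t::=\mathsf{skip}\mid\mathsf{if}\ e\ \mathsf{then}\ t\ \mathsf{else}\ t\mid\mathsf{print}\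 a\mid\mathsf{print}\ \mathsf{label}(i)\mid b\leftarrow\mathsf{true}\mid\mathsf{for}\ i\ \mathsf{in}\ \mathsf{input}\ \mathsf{do}\ (\mathsf{let}\ b_1,\dots,b_k\ \mathsf{in}\ t)\mid\mathsf{for}\ i\ \mathsf{in}\ \mathsf{reversed}(\mathsf{input})\ \mathsf{do}\ (\mathsf{let}\ b_1,\dots,b_k\ \mathsf{in}\ t)\mid t;t$, the tests $e$ are boolean combinations of $\mathsf{true}$, $\mathsf{false}$, boolean variables, comparisons of positions and tests $\mathsf{label}(i)=a$, and all the variables used are in scope. Its translation into a for-program has the single function $\mathsf{main}$ with argument $w:\mathsf{Out}[1]$; it replaces "$\mathsf{for}\ i\ \mathsf{in}\ \mathsf{input}$" by "$\mathsf{for}\ (i,x_i)\ \mathsf{in}\ w$" (in the same direction), $\mathsf{label}(i)$ by $x_i$ and $\mathsf{print}$ by $\mathsf{yield}$, and keeps the rest. **Theorem.** 1. Each of the steps A–H, on the programs to which it applies as above, preserves typing: if $P:\sigma$ is rewritten into $Q$, then $Q:\sigma$. 2. Each of the steps A–H terminates: from a program to which it applies as above, there is no infinite sequence of applications of this step. 3.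 For every program $P:\mathsf{Out}[1]\to\mathsf{Out}[1]$, the steps A, B, …, H can be applied exhaustively, one after the other, starting from $P$; and every program obtained in this way has type $\mathsf{Out}[1]\to\mathsf{Out}[1]$ and is normalized. 4. The translation of simple for-programs into for-programs is an isomorphism onto normalized programs of type $\mathsf{Out}[1]\to\mathsf{Out}[1]$: it is injective, its image is exactly the set of normalized for-programs of type $\mathsf{Out}[1]\to\mathsf{Out}[1]$, and, for every input word, a simple for-program and its translation produce the same output word. -/

import Mathlib

/-!
High-level for-programs, their typing, the compilation steps A–H, and first-order simple
for-programs.  Bound variables are de Bruijn indices, with three separate name spaces: list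
variables, position variables and boolean variables.  A `for` loop binds one position and one list
variable.  Hence programs are considered up to renaming of bound variables, and no variable is ever
shadowed.  Functions are referred to by their position in the list of definitions.
-/

namespace ForProg

universe u

/-! ### Syntax -/

/-- Boolean connectives. -/
inductive BinOp
  | and | or | imp | iff

/-- Comparison operators on positions. -/
inductive CmpOp
  | eq | ne | lt | le | gt | ge

/-- Direction of a loop. -/
inductive Dir
  | fwd | bwd

/-- The opposite direction. -/
def Dir.flip : Dir → Dir
  | .fwd => .bwd
  | .bwd => .fwd

/-- Constant expressions.  `list n cs` is a constant list whose elements have depth `n`; the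
annotation makes the type of the empty list unique. -/
inductive CExpr (D : Type u) : Type u
  | char (a : D)
  | list (n : ℕ) (cs : List (CExpr D))

mutual

/-- Boolean expressions. `gen s` is the boolean generator of `s`. -/
inductive BExpr (D : Type u) : Type u
  | tt
  | ff
  | not (e : BExpr D)
  | bin (op : BinOp) (e₁ e₂ : BExpr D)
  | bvar (b : ℕ)
  | comp (op : CmpOp) (i j : ℕ)
  | litEq (c : CExpr D) (o : OExpr D)
  | call (f : ℕ) (args : Args D)
  | gen (s : Stmt D)

/-- List expressions. `list n [e₁,…,eₘ]` is a list of expressions of depth `n`, and `gen n s` is the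
list generator, of depth `n`, of `s`. -/
inductive OExpr (D : Type u) : Type u
  | var (x : ℕ)
  | const (c : CExpr D)
  | list (n : ℕ) (es : OExprs D)
  | call (f : ℕ) (args : Args D)
  | gen (n : ℕ) (s : Stmt D)

/-- Finite sequences of list expressions. -/
inductive OExprs (D : Type u) : Type u
  | nil
  | cons (e : OExpr D) (es : OExprs D)

/-- Finite sequences of arguments; an argument is a list expression with position variables. -/
inductive Args (D : Type u) : Type u
  | nil
  | cons (e : OExpr D) (ps : List ℕ) (as : Args D)

/-- Control statements. `ret` and `bret` return a list and a boolean; `letBool` introduces a mutable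
boolean initialised to false. -/
inductive Stmt (D : Type u) : Type u
  | skip
  | ite (e : BExpr D) (s t : Stmt D)
  | yield (o : OExpr D)
  | ret (o : OExpr D)
  | bret (e : BExpr D)
  | letOut (o : OExpr D) (s : Stmt D)
  | letBool (s : Stmt D)
  | setTrue (b : ℕ)
  | loop (d : Dir) (o : OExpr D) (s : Stmt D)
  | seq (s t : Stmt D)

end

/-- Types of results: booleans, or nested words of depth `n`. -/
inductive Ty
  | bool
  | out (n : ℕ)

/-- The type of a function: each argument `(n, ℓ)` is a nested word of depth `n` together with `ℓ`
positions in it. -/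
structure Sig where
  params : List (ℕ × ℕ)
  ret : Ty

/-- A function definition.  In the body, list variable `i` is the `i`-th list argument, and the
position variables are all the position arguments, listed from left to right. -/
structure Fn (D : Type u) where
  params : List (ℕ × ℕ)
  ret : Ty
  body : Stmt D

/-- The declared type of a function. -/
def Fn.sig {D : Type u} (f : Fn D) : Sig := ⟨f.params, f.ret⟩

/-- A for-program: a list of function definitions and the index of the main function. -/
structure Prog (D : Type u) where
  funs : List (Fn D)
  main : ℕ

variable {D : Type u}

/-! ### Renaming and substitution -/

/-- Extend a renaming below one binder. -/
def up (r : ℕ → ℕ) : ℕ → ℕ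
  | 0 => 0
  | x + 1 => r x + 1

mutual

/-- Renaming of list (`l`), position (`p`) and boolean (`b`) variables. -/
def BExpr.ren (l p b : ℕ → ℕ) : BExpr D → BExpr D
  | .tt => .tt
  | .ff => .ff
  | .not e => .not (e.ren l p b)
  | .bin op e₁ e₂ => .bin op (e₁.ren l p b) (e₂.ren l p b)
  | .bvar x => .bvar (b x)
  | .comp op i j => .comp op (p i) (p j)
  | .litEq c o => .litEq c (o.ren l p)
  | .call f as => .call f (as.ren l p)
  | .gen s => .gen (s.ren l p id)

/-- Renaming in list expressions, which have no free boolean variables. -/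
def OExpr.ren (l p : ℕ → ℕ) : OExpr D → OExpr D
  | .var x => .var (l x)
  | .const c => .const c
  | .list n es => .list n (es.ren l p)
  | .call f as => .call f (as.ren l p)
  | .gen n s => .gen n (s.ren l p id)

/-- Renaming in sequences of list expressions. -/
def OExprs.ren (l p : ℕ → ℕ) : OExprs D → OExprs D
  | .nil => .nil
  | .cons e es => .cons (e.ren l p) (es.ren l p)

/-- Renaming in arguments. -/
def Args.ren (l p : ℕ → ℕ) : Args D → Args D
  | .nil => .nil
  | .cons e ps as => .cons (e.ren l p) (ps.map p) (as.ren l p)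

/-- Renaming in statements. -/
def Stmt.ren (l p b : ℕ → ℕ) : Stmt D → Stmt D
  | .skip => .skip
  | .ite e s t => .ite (e.ren l p b) (s.ren l p b) (t.ren l p b)
  | .yield o => .yield (o.ren l p)
  | .ret o => .ret (o.ren l p)
  | .bret e => .bret (e.ren l p b)
  | .letOut o s => .letOut (o.ren l p) (s.ren (up l) p b)
  | .letBool s => .letBool (s.ren l p (up b))
  | .setTrue x => .setTrue (b x)
  | .loop d o s => .loop d (o.ren l p) (s.ren (up l) (up p) b)
  | .seq s t => .seq (s.ren l p b) (t.ren l p b)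

end

/-- Extend a substitution below a binder of one list variable. -/
def upLet (σ : ℕ → OExpr D) : ℕ → OExpr D
  | 0 => .var 0
  | x + 1 => (σ x).ren Nat.succ id

/-- Extend a substitution below a loop, which binds a list and a position variable. -/
def upLoop (σ : ℕ → OExpr D) : ℕ → OExpr D
  | 0 => .var 0
  | x + 1 => (σ x).ren Nat.succ Nat.succ

mutual

/-- Simultaneous substitution of list expressions for list variables and of position variables for
position variables. -/
def BExpr.sub (σ : ℕ → OExpr D) (p : ℕ → ℕ) : BExpr D → BExpr D
  | .tt => .tt
  | .ff => .ff
  | .not e => .not (e.sub σ p)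
  | .bin op e₁ e₂ => .bin op (e₁.sub σ p) (e₂.sub σ p)
  | .bvar x => .bvar x
  | .comp op i j => .comp op (p i) (p j)
  | .litEq c o => .litEq c (o.sub σ p)
  | .call f as => .call f (as.sub σ p)
  | .gen s => .gen (s.sub σ p)

/-- Substitution in list expressions. -/
def OExpr.sub (σ : ℕ → OExpr D) (p : ℕ → ℕ) : OExpr D → OExpr D
  | .var x => σ x
  | .const c => .const c
  | .list n es => .list n (es.sub σ p)
  | .call f as => .call f (as.sub σ p)
  | .gen n s => .gen n (s.sub σ p)

/-- Substitution in sequences of list expressions. -/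
def OExprs.sub (σ : ℕ → OExpr D) (p : ℕ → ℕ) : OExprs D → OExprs D
  | .nil => .nil
  | .cons e es => .cons (e.sub σ p) (es.sub σ p)

/-- Substitution in arguments. -/
def Args.sub (σ : ℕ → OExpr D) (p : ℕ → ℕ) : Args D → Args D
  | .nil => .nil
  | .cons e ps as => .cons (e.sub σ p) (ps.map p) (as.sub σ p)

/-- Substitution in statements. -/
def Stmt.sub (σ : ℕ → OExpr D) (p : ℕ → ℕ) : Stmt D → Stmt D
  | .skip => .skip
  | .ite e s t => .ite (e.sub σ p) (s.sub σ p) (t.sub σ p)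
  | .yield o => .yield (o.sub σ p)
  | .ret o => .ret (o.sub σ p)
  | .bret e => .bret (e.sub σ p)
  | .letOut o s => .letOut (o.sub σ p) (s.sub (upLet σ) p)
  | .letBool s => .letBool (s.sub σ p)
  | .setTrue x => .setTrue x
  | .loop d o s => .loop d (o.sub σ p) (s.sub (upLoop σ) (up p))
  | .seq s t => .seq (s.sub σ p) (t.sub σ p)

end

/-- The list expressions among the arguments. -/
def Args.exprs : Args D → List (OExpr D)
  | .nil => []
  | .cons e _ as => e :: as.exprs

/-- All the positions among the arguments, from left to right. -/
def Args.poss : Args D → List ℕ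
  | .nil => []
  | .cons _ ps as => ps ++ as.poss

/-- `s[a₁/x₁,…,aₙ/xₙ]`, for the body `s` of a function with parameters `x₁,…,xₙ`. -/
def Stmt.instantiate (s : Stmt D) (as : Args D) : Stmt D :=
  s.sub (fun x => as.exprs.getD x (.var x)) (fun i => as.poss.getD i i)

/-- `s[x ↦ o]`, where `x` is the innermost list variable of `s`. -/
def Stmt.subst (s : Stmt D) (o : OExpr D) : Stmt D :=
  s.sub (fun x => match x with | 0 => o | y + 1 => .var y) id

/-! ### Typing -/

mutual

/-- `c.HasDepth n`: the constant `c` is a nested word of depth `n`. -/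
def CExpr.HasDepth : CExpr D → ℕ → Prop
  | .char _, n => n = 0
  | .list m cs, n => n = m + 1 ∧ CExpr.AllDepth cs m

/-- All the constants in the list have depth `n`. -/
def CExpr.AllDepth : List (CExpr D) → ℕ → Prop
  | [], _ => True
  | c :: cs, n => c.HasDepth n ∧ CExpr.AllDepth cs n

end

/-- Typing contexts: the types of the visible functions, the depths of the list variables, for every
position variable `i : Pos[o]` the list expression `o`, and the number of boolean variables. -/
structure Ctx (D : Type u) where
  funs : List Sig
  lists : List ℕ
  poss : List (OExpr D)
  bools : ℕ

/-- The context without its boolean variables. -/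
def Ctx.hideBools (Γ : Ctx D) : Ctx D := { Γ with bools := 0 }

/-- `Γ, x : Out[n]`. -/
def Ctx.addList (Γ : Ctx D) (n : ℕ) : Ctx D :=
  { Γ with lists := n :: Γ.lists, poss := Γ.poss.map (OExpr.ren Nat.succ id) }

/-- `Γ, b : Bool`. -/
def Ctx.addBool (Γ : Ctx D) : Ctx D := { Γ with bools := Γ.bools + 1 }

/-- `Γ, i : Pos[o], x : Out[n]`. -/
def Ctx.addLoop (Γ : Ctx D) (o : OExpr D) (n : ℕ) : Ctx D :=
  { Γ with
    lists := n :: Γ.lists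
    poss := (o :: Γ.poss).map (OExpr.ren Nat.succ Nat.succ) }

mutual

/-- `Γ ⊢ e : Bool`. -/
def BExpr.HasType (Γ : Ctx D) : BExpr D → Prop
  | .tt => True
  | .ff => True
  | .not e => e.HasType Γ
  | .bin _ e₁ e₂ => e₁.HasType Γ ∧ e₂.HasType Γ
  | .bvar b => b < Γ.bools
  | .comp _ i j => ∃ o, Γ.poss[i]? = some o ∧ Γ.poss[j]? = some o
  | .litEq c o => ∃ n, c.HasDepth n ∧ o.HasType Γ n
  | .call f as => ∃ ps, Γ.funs[f]? = some ⟨ps, .bool⟩ ∧ as.HasType Γ ps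
  | .gen s => s.HasType Γ.hideBools .bool

/-- `Γ ⊢ o : Out[n]`. -/
def OExpr.HasType (Γ : Ctx D) : OExpr D → ℕ → Prop
  | .var x, n => Γ.lists[x]? = some n
  | .const c, n => c.HasDepth n
  | .list m es, n => n = m + 1 ∧ es.HasType Γ m
  | .call f as, n => ∃ ps, Γ.funs[f]? = some ⟨ps, .out n⟩ ∧ as.HasType Γ ps
  | .gen m s, n => n = m ∧ s.HasType Γ.hideBools (.out m)

/-- All the list expressions have type `Out[n]`. -/
def OExprs.HasType (Γ : Ctx D) : OExprs D → ℕ → Prop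
  | .nil, _ => True
  | .cons e es, n => e.HasType Γ n ∧ es.HasType Γ n

/-- The arguments have the prescribed types: `(o, p₁,…,pₗ) : (Out[n], ℓ)` if `o : Out[n]` and all the
`pᵢ : Pos[o]`. -/
def Args.HasType (Γ : Ctx D) : Args D → List (ℕ × ℕ) → Prop
  | .nil, ps => ps = []
  | .cons o is as, ps => ∃ n ps', ps = (n, is.length) :: ps' ∧
      o.HasType Γ n ∧ (∀ i ∈ is, Γ.poss[i]? = some o) ∧ as.HasType Γ ps'

/-- `Γ ⊢ s : τ`. -/
def Stmt.HasType (Γ : Ctx D) : Stmt D → Ty → Prop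
  | .skip, _ => True
  | .ite e s t, τ => e.HasType Γ ∧ s.HasType Γ τ ∧ t.HasType Γ τ
  | .yield o, τ => ∃ n, τ = .out (n + 1) ∧ o.HasType Γ n
  | .ret o, τ => ∃ n, τ = .out n ∧ o.HasType Γ n
  | .bret e, τ => τ = .bool ∧ e.HasType Γ
  | .letOut o s, τ => ∃ n, o.HasType Γ n ∧ s.HasType (Γ.addList n) τ
  | .letBool s, τ => s.HasType Γ.addBool τ
  | .setTrue b, _ => b < Γ.bools
  | .loop _ o s, τ => ∃ n, o.HasType Γ (n + 1) ∧ s.HasType (Γ.addLoop o n) τ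
  | .seq s t, τ => s.HasType Γ τ ∧ t.HasType Γ τ

end

/-- The position variables of a function body: positions of the `i`-th argument have type
`Pos[xᵢ]`. -/
def paramPoss : ℕ → List (ℕ × ℕ) → List (OExpr D)
  | _, [] => []
  | i, p :: ps => List.replicate p.2 (.var i) ++ paramPoss (i + 1) ps

/-- A function definition is well typed, given the types of the previously defined functions. -/
def Fn.WellTyped (F : List Sig) (f : Fn D) : Prop :=
  f.body.HasType ⟨F, f.params.map Prod.fst, paramPoss 0 f.params, 0⟩ f.ret

/-- `P : σ`.  Every function is typed using only the functions defined before it, so there is no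
recursion. -/
def Prog.HasType (P : Prog D) (σ : Sig) : Prop :=
  (∀ i f, P.funs[i]? = some f → Fn.WellTyped ((P.funs.take i).map Fn.sig) f) ∧
    ∃ f, P.funs[P.main]? = some f ∧ f.sig = σ

/-- The type `Out[1] → Out[1]`. -/
def wordToWord : Sig := ⟨[(1, 0)], .out 1⟩

/-! ### Subterms and bottom-up rewriting -/

/-- A subterm of a program. -/
inductive Node (D : Type u) : Type u
  | b (e : BExpr D)
  | o (o : OExpr D)
  | s (s : Stmt D)

mutual

/-- All the subterms.  Each comes with flags that tell, for every list variable in scope, whether it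
is bound by a loop. -/
def BExpr.nodes (φ : List Bool) : BExpr D → List (List Bool × Node D)
  | .not e => (φ, .b (.not e)) :: e.nodes φ
  | .bin op e₁ e₂ => (φ, .b (.bin op e₁ e₂)) :: (e₁.nodes φ ++ e₂.nodes φ)
  | .litEq c o => (φ, .b (.litEq c o)) :: o.nodes φ
  | .call f as => (φ, .b (.call f as)) :: as.nodes φ
  | .gen s => (φ, .b (.gen s)) :: s.nodes φ
  | e => [(φ, .b e)]

/-- Subterms of a list expression. -/
def OExpr.nodes (φ : List Bool) : OExpr D → List (List Bool × Node D)
  | .list n es => (φ, .o (.list n es)) :: es.nodes φ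
  | .call f as => (φ, .o (.call f as)) :: as.nodes φ
  | .gen n s => (φ, .o (.gen n s)) :: s.nodes φ
  | o => [(φ, .o o)]

/-- Subterms of a sequence of list expressions. -/
def OExprs.nodes (φ : List Bool) : OExprs D → List (List Bool × Node D)
  | .nil => []
  | .cons e es => e.nodes φ ++ es.nodes φ

/-- Subterms of arguments. -/
def Args.nodes (φ : List Bool) : Args D → List (List Bool × Node D)
  | .nil => []
  | .cons e _ as => e.nodes φ ++ as.nodes φ

/-- Subterms of a statement. -/
def Stmt.nodes (φ : List Bool) : Stmt D → List (List Bool × Node D)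
  | .ite e s t => (φ, .s (.ite e s t)) :: (e.nodes φ ++ s.nodes φ ++ t.nodes φ)
  | .yield o => (φ, .s (.yield o)) :: o.nodes φ
  | .ret o => (φ, .s (.ret o)) :: o.nodes φ
  | .bret e => (φ, .s (.bret e)) :: e.nodes φ
  | .letOut o s => (φ, .s (.letOut o s)) :: (o.nodes φ ++ s.nodes (false :: φ))
  | .letBool s => (φ, .s (.letBool s)) :: s.nodes φ
  | .loop d o s => (φ, .s (.loop d o s)) :: (o.nodes φ ++ s.nodes (true :: φ))
  | .seq s t => (φ, .s (.seq s t)) :: (s.nodes φ ++ t.nodes φ)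
  | s => [(φ, .s s)]

end

/-- All the subterms of a program. -/
def Prog.nodes (P : Prog D) : List (List Bool × Node D) :=
  P.funs.flatMap fun f => f.body.nodes []

/-- A family of rules: what to put in place of a node whose children have been rewritten already.
By default a node is rebuilt unchanged. -/
structure Rules (D : Type u) where
  litEq : List Bool → CExpr D → OExpr D → BExpr D := fun _ => .litEq
  bcall : ℕ → Args D → BExpr D := .call
  const : CExpr D → OExpr D := .const
  list : ℕ → OExprs D → OExpr D := .list
  ocall : ℕ → Args D → OExpr D := .call
  gen : ℕ → Stmt D → OExpr D := .gen
  ite : BExpr D → Stmt D → Stmt D → Stmt D := .ite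
  yield : OExpr D → Stmt D := .yield
  bret : BExpr D → Stmt D := .bret
  letOut : OExpr D → Stmt D → Stmt D := .letOut
  seq : Stmt D → Stmt D → Stmt D := .seq

mutual

/-- Apply the rules everywhere, from the leaves to the root; `φ` tells which list variables are bound
by a loop. -/
def BExpr.rewrite (R : Rules D) (φ : List Bool) : BExpr D → BExpr D
  | .tt => .tt
  | .ff => .ff
  | .not e => .not (e.rewrite R φ)
  | .bin op e₁ e₂ => .bin op (e₁.rewrite R φ) (e₂.rewrite R φ)
  | .bvar b => .bvar b
  | .comp op i j => .comp op i j
  | .litEq c o => R.litEq φ c (o.rewrite R φ)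
  | .call f as => R.bcall f (as.rewrite R φ)
  | .gen s => .gen (s.rewrite R φ)

/-- Rewriting in list expressions. -/
def OExpr.rewrite (R : Rules D) (φ : List Bool) : OExpr D → OExpr D
  | .var x => .var x
  | .const c => R.const c
  | .list n es => R.list n (es.rewrite R φ)
  | .call f as => R.ocall f (as.rewrite R φ)
  | .gen n s => R.gen n (s.rewrite R φ)

/-- Rewriting in sequences of list expressions. -/
def OExprs.rewrite (R : Rules D) (φ : List Bool) : OExprs D → OExprs D
  | .nil => .nil
  | .cons e es => .cons (e.rewrite R φ) (es.rewrite R φ)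

/-- Rewriting in arguments. -/
def Args.rewrite (R : Rules D) (φ : List Bool) : Args D → Args D
  | .nil => .nil
  | .cons e ps as => .cons (e.rewrite R φ) ps (as.rewrite R φ)

/-- Rewriting in statements. -/
def Stmt.rewrite (R : Rules D) (φ : List Bool) : Stmt D → Stmt D
  | .skip => .skip
  | .ite e s t => R.ite (e.rewrite R φ) (s.rewrite R φ) (t.rewrite R φ)
  | .yield o => R.yield (o.rewrite R φ)
  | .ret o => .ret (o.rewrite R φ)
  | .bret e => R.bret (e.rewrite R φ)
  | .letOut o s => R.letOut (o.rewrite R φ) (s.rewrite R (false :: φ))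
  | .letBool s => .letBool (s.rewrite R φ)
  | .setTrue b => .setTrue b
  | .loop d o s => .loop d (o.rewrite R φ) (s.rewrite R (true :: φ))
  | .seq s t => R.seq (s.rewrite R φ) (t.rewrite R φ)

end

/-- Apply a transformation to the body of a function. -/
def Fn.mapBody (g : Stmt D → Stmt D) (f : Fn D) : Fn D := { f with body := g f.body }

/-- Apply a transformation to the bodies of all the functions. -/
def Prog.mapBody (g : Stmt D → Stmt D) (P : Prog D) : Prog D :=
  { P with funs := P.funs.map (Fn.mapBody g) }

/-! ### Step A: elimination of literal equalities -/

/-- The basic label tests, which are kept: a character against a variable bound by a loop. -/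
def IsLabelTest (φ : List Bool) (c : CExpr D) (o : OExpr D) : Prop :=
  ∃ a x, c = .char a ∧ o = .var x ∧ φ.getD x false = true

/-- The constants of the literal equalities that have to be eliminated. -/
def Prog.HasLitEq (P : Prog D) (c : CExpr D) : Prop :=
  ∃ φ o, (φ, Node.b (.litEq c o)) ∈ P.nodes ∧ ¬ IsLabelTest φ c o

/-- Loop body of the equality test with `[c₀,…,cₘ₋₁]`.  The boolean variable `k` is true when the
`k`-th element has been read and found equal to `cₖ`; the current element is compared with `cₖ` for
the first `k` such that this boolean is false. -/
def eqStep : ℕ → List (CExpr D) → Stmt D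
  | _, [] => .bret .ff
  | k, c :: cs => .ite (.bvar k) (eqStep (k + 1) cs)
      (.ite (.litEq c (.var 0)) (.setTrue k) (.bret .ff))

/-- `k` declarations of boolean variables in front of a statement. -/
def letBools : ℕ → Stmt D → Stmt D
  | 0, s => s
  | k + 1, s => .letBool (letBools k s)

/-- The function that tests the equality with a constant, by traversing its input.  For a character
`a`, it tests whether the input list contains `a`; it will be applied to singletons only. -/
def eqFn : CExpr D → Fn D
  | .char a => ⟨[(1, 0)], .bool,
      .seq (.loop .fwd (.var 0) (.ite (.litEq (.char a) (.var 0)) (.bret .tt) .skip)) (.bret .ff)⟩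
  | .list n cs => ⟨[(n + 1, 0)], .bool,
      letBools cs.length (.seq (.loop .fwd (.var 0) (eqStep 0 cs))
        (.bret (if cs.length = 0 then .tt else .bvar (cs.length - 1))))⟩

/-- The arguments with which this function is called to test the equality with `o`. -/
def eqArgs : CExpr D → OExpr D → Args D
  | .char _, o => .cons (.list 0 (.cons o .nil)) [] .nil
  | .list _ _, o => .cons o [] .nil

open Classical in
/-- Replace the literal equalities with `c` by calls to the function number 0; the other functions
are shifted by one. -/
noncomputable def litEqRules (c : CExpr D) : Rules D where
  litEq φ c' o := if c' = c ∧ ¬ IsLabelTest φ c' o then .call 0 (eqArgs c o) else .litEq c' o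
  bcall f as := .call (f + 1) as
  ocall f as := .call (f + 1) as

/-- Eliminate the literal equalities with the constant `c`. -/
noncomputable def elimLitEq (c : CExpr D) (P : Prog D) : Prog D where
  funs := eqFn c :: P.funs.map (Fn.mapBody (Stmt.rewrite (litEqRules c) []))
  main := P.main + 1

/-! ### Step B: elimination of literal productions -/

/-- `yield c₁; …; yield cₘ`. -/
def yieldConsts : List (CExpr D) → Stmt D
  | [] => .skip
  | c :: cs => .seq (.yield (.const c)) (yieldConsts cs)

/-- `yield e₁; …; yield eₘ`. -/
def yieldExprs : OExprs D → Stmt D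
  | .nil => .skip
  | .cons e es => .seq (.yield e) (yieldExprs es)

open Classical in
/-- Replace the constant `c` by a call to the function number 0. -/
noncomputable def litRules (c : CExpr D) : Rules D where
  const c' := if c' = c then .call 0 .nil else .const c'
  bcall f as := .call (f + 1) as
  ocall f as := .call (f + 1) as

/-- Eliminate the constant list `list n cs`, which becomes a function without arguments. -/
noncomputable def elimLit (n : ℕ) (cs : List (CExpr D)) (P : Prog D) : Prog D where
  funs := ⟨[], .out (n + 1), yieldConsts cs⟩ ::
    P.funs.map (Fn.mapBody (Stmt.rewrite (litRules (.list n cs)) []))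
  main := P.main + 1

/-- Replace `[e₁,…,eₘ]` by the generator of `yield e₁; …; yield eₘ`. -/
def listRules : Rules D where
  list n es := .gen (n + 1) (yieldExprs es)

/-! ### Step C: elimination of function calls -/

/-- Replace the calls to the function number `j`, defined by `f`, by generators. -/
def inlineRules (j : ℕ) (f : Fn D) : Rules D where
  bcall i as :=
    if i = j then .gen (f.body.instantiate as) else .call (if j < i then i - 1 else i) as
  ocall i as :=
    if i = j then
      match f.ret with
      | .out n => .gen n (f.body.instantiate as)
      | .bool => .call i as
    else .call (if j < i then i - 1 else i) as

/-- Inline all the calls to the function number `j`, defined by `f`, and drop its definition. -/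
def inlineFn (j : ℕ) (f : Fn D) (P : Prog D) : Prog D where
  funs := (P.funs.eraseIdx j).map (Fn.mapBody (Stmt.rewrite (inlineRules j f) []))
  main := if j < P.main then P.main - 1 else P.main

/-! ### Step D: elimination of boolean generators -/

/-- Does a boolean generator occur in the boolean combination `e`? -/
def BExpr.hasGen : BExpr D → Bool
  | .not e => e.hasGen
  | .bin _ e₁ e₂ => e₁.hasGen || e₂.hasGen
  | .gen _ => true
  | _ => false

/-- Replace `return e` by `if e then b := true`, executed only if the boolean `r` ("has returned") is
false, and set `r`. -/
def Stmt.returnInto (r b : ℕ) : Stmt D → Stmt D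
  | .ite e s t => .ite e (s.returnInto r b) (t.returnInto r b)
  | .bret e => .ite (.bvar r) .skip (.seq (.setTrue r) (.ite e (.setTrue b) .skip))
  | .letOut o s => .letOut o (s.returnInto r b)
  | .letBool s => .letBool (s.returnInto (r + 1) (b + 1))
  | .loop d o s => .loop d o (s.returnInto r b)
  | .seq s t => .seq (s.returnInto r b) (t.returnInto r b)
  | s => s

/-- A statement that sets `b` if `e` is true; the boolean variables of `e` are shifted by `k`. -/
def BExpr.evalInto (b k : ℕ) : BExpr D → Stmt D
  | .not e =>
      if e.hasGen then
        .letBool (.seq (e.evalInto 0 (k + 1)) (.ite (.bvar 0) .skip (.setTrue (b + 1))))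
      else .ite (.not (e.ren id id (· + k))) (.setTrue b) .skip
  | .bin op e₁ e₂ =>
      if e₁.hasGen || e₂.hasGen then
        .letBool (.letBool (.seq (e₁.evalInto 1 (k + 2)) (.seq (e₂.evalInto 0 (k + 2))
          (.ite (.bin op (.bvar 1) (.bvar 0)) (.setTrue (b + 2)) .skip))))
      else .ite (.bin op (e₁.ren id id (· + k)) (e₂.ren id id (· + k))) (.setTrue b) .skip
  | .gen s => .letBool (s.returnInto 0 (b + 1))
  | e => .ite (e.ren id id (· + k)) (.setTrue b) .skip

/-- `if e then s else t` becomes `let mut b = false in (…; if b then s else t)`, where `…` evaluates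
`e` into `b`; similarly for `return e`. -/
def boolGenRules : Rules D where
  ite e s t :=
    if e.hasGen then
      .letBool (.seq (e.evalInto 0 1)
        (.ite (.bvar 0) (s.ren id id Nat.succ) (t.ren id id Nat.succ)))
    else .ite e s t
  bret e := if e.hasGen then .letBool (.seq (e.evalInto 0 1) (.bret (.bvar 0))) else .bret e

/-! ### Step E: elimination of let-output statements -/

/-- `let x = o in s` becomes `s[x ↦ o]`. -/
def letOutRules : Rules D where
  letOut o s := s.subst o

/-! ### Step F: elimination of return statements -/

/-- Yield a character.  If it is given by a generator, then this generator has been turned into one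
that produces a list, and the elements of this list are yielded. -/
def yieldChar : OExpr D → Stmt D
  | .gen 0 s => .loop .fwd (.gen 1 s) (.yield (.var 0))
  | o => .yield o

/-- Statements of type `Out[n+1]`: guard `yield` and `return` by the boolean `r` ("has returned"),
and turn `return o` into `for (i,x) in o do yield x`. -/
def Stmt.guardReturn (r : ℕ) : Stmt D → Stmt D
  | .ite e s t => .ite e (s.guardReturn r) (t.guardReturn r)
  | .yield o => .ite (.bvar r) .skip (.yield o)
  | .ret o => .ite (.bvar r) .skip (.seq (.loop .fwd o (.yield (.var 0))) (.setTrue r))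
  | .letOut o s => .letOut o (s.guardReturn r)
  | .letBool s => .letBool (s.guardReturn (r + 1))
  | .loop d o s => .loop d o (s.guardReturn r)
  | .seq s t => .seq (s.guardReturn r) (t.guardReturn r)
  | s => s

/-- Statements of type `Out[0]`, which become statements of type `Out[1]`: the first `return o`
becomes `yield o`, and the others are ignored. -/
def Stmt.returnToYield (r : ℕ) : Stmt D → Stmt D
  | .ite e s t => .ite e (s.returnToYield r) (t.returnToYield r)
  | .ret o => .ite (.bvar r) .skip (.seq (yieldChar o) (.setTrue r))
  | .letOut o s => .letOut o (s.returnToYield r)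
  | .letBool s => .letBool (s.returnToYield (r + 1))
  | .loop d o s => .loop d o (s.returnToYield r)
  | .seq s t => .seq (s.returnToYield r) (t.returnToYield r)
  | s => s

/-- Eliminate the return statements of a statement of type `Out[n]`. -/
def elimReturn : ℕ → Stmt D → Stmt D
  | 0, s => .letBool (s.returnToYield 0)
  | _ + 1, s => .letBool (s.guardReturn 0)

/-- Elimination of return statements in generators. -/
def returnRules : Rules D where
  gen n s := .gen n (elimReturn n s)
  yield := yieldChar

/-- Elimination of return statements in a function with values in `Out[n+1]`.  Boolean functions have
no list return statement of their own. -/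
def elimReturnFn (f : Fn D) : Fn D :=
  match f.ret with
  | .out (_ + 1) => f.mapBody fun s => (s.rewrite returnRules []).guardReturn 0 |> .letBool
  | _ => f.mapBody (Stmt.rewrite returnRules [])

/-! ### Step G: expansion of for loops -/

/-- A step on the way from the root of a statement to one of its `yield`s: into the left or right
part of a sequence or of a conditional, or into a loop with the given direction, whose current
position is the given position variable. -/
inductive AStep
  | left
  | right
  | loop (d : Dir) (i : ℕ)

/-- The address of a `yield` together with the position variables visible there. -/
abbrev Addr := List AStep

/-- Weakening of an address by `k` position variables. -/
def Addr.shift (k : ℕ) (a : Addr) : Addr :=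
  a.map fun
    | .loop d i => .loop d (i + k)
    | st => st

/-- The test `a = a'`: the same `yield`, at the same positions. -/
def Addr.eqTest : Addr → Addr → BExpr D
  | [], [] => .tt
  | .left :: a, .left :: a' => Addr.eqTest a a'
  | .right :: a, .right :: a' => Addr.eqTest a a'
  | .loop _ i :: a, .loop _ i' :: a' => .bin .and (.comp .eq i i') (Addr.eqTest a a')
  | _, _ => .ff

/-- The test "`a` happens strictly before `a'`". -/
def Addr.before : Addr → Addr → BExpr D
  | .left :: a, .left :: a' => Addr.before a a'
  | .right :: a, .right :: a' => Addr.before a a'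
  | .left :: _, .right :: _ => .tt
  | .loop d i :: a, .loop _ i' :: a' =>
      .bin .or
        (.comp (match d with | .fwd => .lt | .bwd => .gt) i i')
        (.bin .and (.comp .eq i i') (Addr.before a a'))
  | _, _ => .ff

/-- Comparison of two addresses. -/
def Addr.comp : CmpOp → Addr → Addr → BExpr D
  | .eq, a, a' => Addr.eqTest a a'
  | .ne, a, a' => .not (Addr.eqTest a a')
  | .lt, a, a' => Addr.before a a'
  | .le, a, a' => .bin .or (Addr.before a a') (Addr.eqTest a a')
  | .gt, a, a' => Addr.before a' a
  | .ge, a, a' => .bin .or (Addr.before a' a) (Addr.eqTest a a')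

/-- What a position variable stands for during the expansion: a position variable of the target, or
an address in a generator. -/
inductive PVal
  | pos (i : ℕ)
  | addr (a : Addr)

/-- Weakening by `k` position variables. -/
def PVal.shift (k : ℕ) : PVal → PVal
  | .pos i => .pos (i + k)
  | .addr a => .addr (a.shift k)

/-- Comparison of two positions of the same list. -/
def PVal.comp (op : CmpOp) : PVal → PVal → BExpr D
  | .pos i, .pos j => .comp op i j
  | .addr a, .addr a' => Addr.comp op a a'
  | _, _ => .ff

/-- In `s`, replace every `yield e` at address `a` by `κ k m a e`, where `k` and `m` are the numbers of
loops and of boolean declarations of `s` above this `yield`. -/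
def Stmt.replaceYields (κ : ℕ → ℕ → Addr → OExpr D → Stmt D) (k m : ℕ) (a : Addr) : Stmt D → Stmt D
  | .ite e s t => .ite e (s.replaceYields κ k m (a ++ [.left])) (t.replaceYields κ k m (a ++ [.right]))
  | .yield e => κ k m a e
  | .letBool s => .letBool (s.replaceYields κ k (m + 1) a)
  | .setTrue b => .setTrue b
  | .loop d o s => .loop d o (s.replaceYields κ (k + 1) m (a.shift 1 ++ [.loop d 0]))
  | .seq s t => .seq (s.replaceYields κ k m (a ++ [.left])) (t.replaceYields κ k m (a ++ [.right]))
  | _ => .skip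

/-- The reversal of `s` (no boolean declarations, conditionals turned into sequences, loops and
sequences reversed), in which every `yield`, at address `a`, is replaced by a copy of `s₀` that calls
`κ` on the elements yielded at address `a` only. -/
def reverseYields (s₀ : Stmt D) (κ : ℕ → ℕ → Addr → OExpr D → Stmt D) (k : ℕ) (a : Addr) :
    Stmt D → Stmt D
  | .ite _ s t => .seq (reverseYields s₀ κ k (a ++ [.right]) t) (reverseYields s₀ κ k (a ++ [.left]) s)
  | .yield _ => (s₀.ren (· + k) (· + k) id).replaceYields
      (fun k' m a' e => .ite (Addr.eqTest a' (a.shift k')) (κ (k + k') m a' e) .skip) 0 0 []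
  | .letBool s => reverseYields s₀ κ k a s
  | .loop d o s => .loop d.flip o (reverseYields s₀ κ (k + 1) (a.shift 1 ++ [.loop d 0]) s)
  | .seq s t => .seq (reverseYields s₀ κ k (a ++ [.right]) t) (reverseYields s₀ κ k (a ++ [.left]) s)
  | _ => .skip

/-- Environments: what the variables of the source stand for in the target. -/
structure GEnv (D : Type u) where
  lists : ℕ → OExpr D
  poss : ℕ → PVal
  bools : ℕ → ℕ

/-- Weakening by `k` loops and `m` boolean declarations. -/
def GEnv.shift (k m : ℕ) (ρ : GEnv D) : GEnv D where
  lists x := (ρ.lists x).ren (· + k) (· + k)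
  poss i := (ρ.poss i).shift k
  bools b := ρ.bools b + m

/-- Extension by the variables of a loop. -/
def GEnv.bindLoop (ρ : GEnv D) (v : OExpr D) (p : PVal) : GEnv D where
  lists x := match x with | 0 => v | x + 1 => ρ.lists x
  poss i := match i with | 0 => p | i + 1 => ρ.poss i
  bools := ρ.bools

/-- Extension by a boolean variable. -/
def GEnv.bindBool (ρ : GEnv D) : GEnv D := { ρ with bools := up ρ.bools }

open Classical in
/-- A literal equality in which a character may have been substituted for the variable. -/
noncomputable def expandLitEq : CExpr D → OExpr D → BExpr D
  | .char a, .const (.char b) => if a = b then .tt else .ff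
  | c, o => .litEq c o

mutual

/-- Expansion of the for loops in boolean expressions (without generators). -/
noncomputable def BExpr.expand (ρ : GEnv D) : BExpr D → BExpr D
  | .not e => .not (e.expand ρ)
  | .bin op e₁ e₂ => .bin op (e₁.expand ρ) (e₂.expand ρ)
  | .bvar b => .bvar (ρ.bools b)
  | .comp op i j => PVal.comp op (ρ.poss i) (ρ.poss j)
  | .litEq c o => expandLitEq c (o.expand ρ)
  | e => e

/-- Expansion of the for loops in list expressions. -/
noncomputable def OExpr.expand (ρ : GEnv D) : OExpr D → OExpr D
  | .var x => ρ.lists x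
  | .gen n s => .gen n (s.expand { ρ with bools := id })
  | o => o

/-- Expansion of the for loops.  A loop over a generator is replaced by the (expanded) body of the
generator, in which every `yield e` is replaced by the body of the loop, where `x` stands for `e` and
`i` for the address of this `yield`; for backward loops, through the reversal of this body. -/
noncomputable def Stmt.expand (ρ : GEnv D) : Stmt D → Stmt D
  | .skip => .skip
  | .ite e s t => .ite (e.expand ρ) (s.expand ρ) (t.expand ρ)
  | .yield o => .yield (o.expand ρ)
  | .letBool s => .letBool (s.expand ρ.bindBool)
  | .setTrue b => .setTrue (ρ.bools b)
  | .loop d o s =>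
      match o.expand ρ with
      | .gen _ t =>
          let κ := fun k m a e => s.expand ((ρ.shift k m).bindLoop e (.addr a))
          match d with
          | .fwd => t.replaceYields κ 0 0 []
          | .bwd => reverseYields t κ 0 [] t
      | o' => .loop d o' (s.expand ((ρ.shift 1 0).bindLoop (.var 0) (.pos 0)))
  | .seq s t => .seq (s.expand ρ) (t.expand ρ)
  | s => s

end

/-- The identity environment. -/
def GEnv.ident : GEnv D := ⟨.var, .pos, id⟩

/-! ### Step H: booleans at the beginning of for loops -/

/-- Split off the boolean declarations at the beginning of a statement. -/
def Stmt.splitBools : Stmt D → ℕ × Stmt D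
  | .letBool s => (s.splitBools.1 + 1, s.splitBools.2)
  | s => (0, s)

/-- Insert `k` boolean variables after the `n` innermost ones. -/
def insertBools (n k : ℕ) (b : ℕ) : ℕ := if b < n then b else b + k

/-- The boolean declarations in front of `s` and `t` are moved to the front of `c s t`. -/
def hoist₂ (c : ℕ → Stmt D → Stmt D → Stmt D) (s t : Stmt D) : Stmt D :=
  let m := s.splitBools.1
  let n := t.splitBools.1
  letBools (m + n) (c (m + n)
    (s.splitBools.2.ren id id (insertBools m n))
    (t.splitBools.2.ren id id (· + m)))

/-- Moving the declarations of boolean variables to the top of their scope. -/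
def letBoolRules : Rules D where
  seq := hoist₂ fun _ => .seq
  ite e := hoist₂ fun k => .ite (e.ren id id (· + k))
  letOut o s := letBools s.splitBools.1 (.letOut o s.splitBools.2)

/-! ### The rewriting steps -/

/-- The names of the eight steps, in the order in which they are applied. -/
inductive Pass
  | A | B | C | D | E | F | G | H

/-- The number of a step. -/
def Pass.num : Pass → ℕ
  | .A => 0 | .B => 1 | .C => 2 | .D => 3 | .E => 4 | .F => 5 | .G => 6 | .H => 7

/-- Is the statement a boolean declaration? -/
def Stmt.IsLetBool (s : Stmt D) : Prop := ∃ s', s = .letBool s'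

/-- The redexes of the steps D–H. -/
def IsRedex : Pass → Node D → Prop
  | .D, .b (.gen _) => True
  | .E, .s (.letOut _ _) => True
  | .F, .s (.ret _) => True
  | .F, .o (.gen 0 _) => True
  | .G, .s (.loop _ o _) => ∀ x, o ≠ .var x
  | .H, .s (.seq s t) => s.IsLetBool ∨ t.IsLetBool
  | .H, .s (.ite _ s t) => s.IsLetBool ∨ t.IsLetBool
  | .H, .s (.letOut _ s) => s.IsLetBool
  | _, _ => False

/-- The program contains a redex of the given step. -/
def Prog.HasRedex (X : Pass) (P : Prog D) : Prop := ∃ n ∈ P.nodes, IsRedex X n.2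

/-- `Step X P Q`: the program `P` is rewritten into `Q` by the step `X`. -/
inductive Step : Pass → Prog D → Prog D → Prop
  | litEq (P : Prog D) (c : CExpr D) : P.HasLitEq c → Step .A P (elimLitEq c P)
  | lit (P : Prog D) (φ : List Bool) (n : ℕ) (cs : List (CExpr D)) :
      (φ, Node.o (.const (.list n cs))) ∈ P.nodes → Step .B P (elimLit n cs P)
  | list (P : Prog D) (φ : List Bool) (n : ℕ) (es : OExprs D) :
      (φ, Node.o (.list n es)) ∈ P.nodes → Step .B P (P.mapBody (Stmt.rewrite listRules []))
  | call (P : Prog D) (j : ℕ) (f : Fn D) :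
      P.funs[j]? = some f → j ≠ P.main → Step .C P (inlineFn j f P)
  | boolGen (P : Prog D) : P.HasRedex .D → Step .D P (P.mapBody (Stmt.rewrite boolGenRules []))
  | letOut (P : Prog D) : P.HasRedex .E → Step .E P (P.mapBody (Stmt.rewrite letOutRules []))
  | ret (P : Prog D) : P.HasRedex .F → Step .F P { P with funs := P.funs.map elimReturnFn }
  | forLoop (P : Prog D) : P.HasRedex .G → Step .G P (P.mapBody (Stmt.expand GEnv.ident))
  | letBool (P : Prog D) : P.HasRedex .H → Step .H P (P.mapBody (Stmt.rewrite letBoolRules []))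

/-- The step `X` cannot be applied to `P`. -/
def Irreducible (X : Pass) (P : Prog D) : Prop := ∀ Q, ¬ Step X P Q

/-- None of the eight steps can be applied to `P`. -/
def Normalized (P : Prog D) : Prop := ∀ X, Irreducible X P

/-- The programs, of type `σ`, that a step is meant for: all of them, except that F and G are applied
after the previous steps, F to functions that do not produce a single character, and G to programs of
type `Out[1] → Out[1]`. -/
def InScope (X : Pass) (P : Prog D) (σ : Sig) : Prop :=
  P.HasType σ ∧
    match X with
    | .F => (∀ Y : Pass, Y.num < Pass.F.num → Irreducible Y P) ∧ σ.ret ≠ .out 0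
    | .G => (∀ Y : Pass, Y.num < Pass.G.num → Irreducible Y P) ∧ σ = wordToWord
    | _ => True

/-- `Q` is obtained from `P` by applying the step `X` as long as possible. -/
def Exhaust (X : Pass) (P Q : Prog D) : Prop :=
  Relation.ReflTransGen (Step X) P Q ∧ Irreducible X Q

/-- Apply exhaustively the given steps, one after the other. -/
def Run : List Pass → Prog D → Prog D → Prop
  | [], P, Q => P = Q
  | X :: Xs, P, Q => ∃ P', Exhaust X P P' ∧ Run Xs P' Q

/-- The compilation: the steps A–H, in this order. -/
def Compiles (P Q : Prog D) : Prop := Run [.A, .B, .C, .D, .E, .F, .G, .H] P Q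

/-! ### Semantics of for-programs -/

/-- Nested words. -/
inductive NWord (D : Type u) : Type u
  | char (a : D)
  | list (ws : List (NWord D))

/-- The elements of a list. -/
def NWord.elems : NWord D → List (NWord D)
  | .char _ => []
  | .list ws => ws

/-- A word, as a nested word. -/
def NWord.ofWord (w : List D) : NWord D := .list (w.map .char)

/-- The value of a constant. -/
def CExpr.value : CExpr D → NWord D
  | .char a => .char a
  | .list _ cs => .list (values cs)
where
  /-- The values of a list of constants. -/
  values : List (CExpr D) → List (NWord D)
    | [] => []
    | c :: cs => c.value :: values cs

/-- Value of a function: a nested word or a boolean. -/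
abbrev Val (D : Type u) := NWord D ⊕ Bool

/-- The effect of a statement: the new values of the boolean variables, the yielded elements, and the
returned value if a return statement was executed. -/
structure Effect (D : Type u) where
  bools : List Bool
  out : List (NWord D)
  ret : Option (Val D)

/-- Sequential composition; nothing is executed after a return statement. -/
def Effect.andThen (r : Effect D) (k : List Bool → Effect D) : Effect D :=
  match r.ret with
  | some _ => r
  | none => { k r.bools with out := r.out ++ (k r.bools).out }

/-- Execution of a loop body on a list of pairs (position, element). -/
def runLoop (body : ℕ → NWord D → List Bool → Effect D) :
    List (NWord D × ℕ) → List Bool → Effect D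
  | [], β => ⟨β, [], none⟩
  | (x, i) :: l, β => (body i x β).andThen (runLoop body l)

/-- The value produced by a statement, according to its type: what it yielded, followed by the list it
returned, if any; or the returned character or boolean (with an arbitrary default value). -/
def Effect.value (r : Effect D) : Ty → Val D
  | .bool => match r.ret with
      | some (.inr b) => .inr b
      | _ => .inr false
  | .out 0 => match r.ret with
      | some (.inl w) => .inl w
      | _ => .inl (.list [])
  | .out (_ + 1) => match r.ret with
      | some (.inl w) => .inl (.list (r.out ++ w.elems))
      | _ => .inl (.list r.out)

/-- The meaning of connectives. -/
def BinOp.eval : BinOp → Bool → Bool → Bool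
  | .and, x, y => x && y
  | .or, x, y => x || y
  | .imp, x, y => !x || y
  | .iff, x, y => x == y

/-- The meaning of comparisons. -/
def CmpOp.eval : CmpOp → ℕ → ℕ → Bool
  | .eq, i, j => decide (i = j)
  | .ne, i, j => decide (i ≠ j)
  | .lt, i, j => decide (i < j)
  | .le, i, j => decide (i ≤ j)
  | .gt, i, j => decide (i > j)
  | .ge, i, j => decide (i ≥ j)

/-- The meaning of a function, on its list and position arguments. -/
abbrev FnVal (D : Type u) := List (NWord D) → List ℕ → Val D

/-- The meaning of a call. -/
def callFn (F : List (FnVal D)) (f : ℕ) (ls : List (NWord D)) (is : List ℕ) : Val D :=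
  match F[f]? with
  | some g => g ls is
  | none => .inr false

/-- Order in which a loop visits a list of pairs (element, position). -/
def Dir.order {α : Type u} : Dir → List α → List α
  | .fwd, l => l
  | .bwd, l => l.reverse

/-- A value seen as a nested word. -/
def Val.word : Val D → NWord D
  | .inl w => w
  | .inr _ => .list []

/-- A value seen as a boolean. -/
def Val.bool : Val D → Bool
  | .inl _ => false
  | .inr b => b

open Classical in
/-- Equality of two nested words. -/
noncomputable def NWord.eqTest (v w : NWord D) : Bool := decide (v = w)

mutual

/-- Value of a boolean expression (lifted to the universe of the alphabet), given the values of the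
functions, of the list, position and boolean variables. -/
noncomputable def BExpr.eval (F : List (FnVal D)) (L : List (NWord D)) (I : List ℕ) (β : List Bool) :
    BExpr D → ULift.{u} Bool
  | .tt => ⟨true⟩
  | .ff => ⟨false⟩
  | .not e => ⟨!(e.eval F L I β).down⟩
  | .bin op e₁ e₂ => ⟨op.eval (e₁.eval F L I β).down (e₂.eval F L I β).down⟩
  | .bvar b => ⟨β.getD b false⟩
  | .comp op i j => ⟨op.eval (I.getD i 0) (I.getD j 0)⟩
  | .litEq c o => ⟨c.value.eqTest (o.eval F L I)⟩
  | .call f as => ⟨(callFn F f (as.eval F L I) (as.poss.map fun i => I.getD i 0)).bool⟩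
  | .gen s => ⟨((s.eval F L I []).value .bool).bool⟩

/-- Value of a list expression. -/
noncomputable def OExpr.eval (F : List (FnVal D)) (L : List (NWord D)) (I : List ℕ) :
    OExpr D → NWord D
  | .var x => L.getD x (.list [])
  | .const c => c.value
  | .list _ es => .list (es.eval F L I)
  | .call f as => (callFn F f (as.eval F L I) (as.poss.map fun i => I.getD i 0)).word
  | .gen n s => ((s.eval F L I []).value (.out n)).word

/-- Values of a sequence of list expressions. -/
noncomputable def OExprs.eval (F : List (FnVal D)) (L : List (NWord D)) (I : List ℕ) :
    OExprs D → List (NWord D)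
  | .nil => []
  | .cons e es => e.eval F L I :: es.eval F L I

/-- Values of the lists among the arguments. -/
noncomputable def Args.eval (F : List (FnVal D)) (L : List (NWord D)) (I : List ℕ) :
    Args D → List (NWord D)
  | .nil => []
  | .cons e _ as => e.eval F L I :: as.eval F L I

/-- Execution of a statement. -/
noncomputable def Stmt.eval (F : List (FnVal D)) (L : List (NWord D)) (I : List ℕ) (β : List Bool) :
    Stmt D → Effect D
  | .skip => ⟨β, [], none⟩
  | .ite e s t => if (e.eval F L I β).down = true then s.eval F L I β else t.eval F L I β
  | .yield o => ⟨β, [o.eval F L I], none⟩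
  | .ret o => ⟨β, [], some (.inl (o.eval F L I))⟩
  | .bret e => ⟨β, [], some (.inr (e.eval F L I β).down)⟩
  | .letOut o s => s.eval F (o.eval F L I :: L) I β
  | .letBool s =>
      let r := s.eval F L I (false :: β)
      { r with bools := r.bools.tail }
  | .setTrue b => ⟨β.set b true, [], none⟩
  | .loop d o s =>
      runLoop (fun i x β => s.eval F (x :: L) (i :: I) β) (d.order (o.eval F L I).elems.zipIdx) β
  | .seq s t => (s.eval F L I β).andThen fun β => t.eval F L I β

end

/-- The meanings of a list of function definitions, given the meanings of the previous ones. -/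
noncomputable def evalFns : List (FnVal D) → List (Fn D) → List (FnVal D)
  | F, [] => F
  | F, f :: fs => evalFns (F ++ [fun L I => (f.body.eval F L I []).value f.ret]) fs

/-- The meaning of a program. -/
noncomputable def Prog.eval (P : Prog D) : FnVal D := callFn (evalFns [] P.funs) P.main

/-! ### First-order simple for-programs -/

/-- Tests of simple for-programs. -/
inductive SBExpr (D : Type u) : Type u
  | tt
  | ff
  | not (e : SBExpr D)
  | bin (op : BinOp) (e₁ e₂ : SBExpr D)
  | bvar (b : ℕ)
  | comp (op : CmpOp) (i j : ℕ)
  | labelEq (i : ℕ) (a : D)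

/-- Statements of simple for-programs. `loop d k s` iterates over the positions of the input word; its
body starts with the declaration of `k` boolean variables. -/
inductive SStmt (D : Type u) : Type u
  | skip
  | ite (e : SBExpr D) (s t : SStmt D)
  | printChar (a : D)
  | printLabel (i : ℕ)
  | setTrue (b : ℕ)
  | loop (d : Dir) (k : ℕ) (s : SStmt D)
  | seq (s t : SStmt D)

/-- A simple for-program: the number of boolean variables declared at the top, and a statement. -/
structure SProg (D : Type u) where
  bools : ℕ
  body : SStmt D

/-- The test only uses the variables in scope (`p` positions and `b` booleans). -/
def SBExpr.WF (p b : ℕ) : SBExpr D → Prop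
  | .tt => True
  | .ff => True
  | .not e => e.WF p b
  | .bin _ e₁ e₂ => e₁.WF p b ∧ e₂.WF p b
  | .bvar x => x < b
  | .comp _ i j => i < p ∧ j < p
  | .labelEq i _ => i < p

/-- The statement only uses the variables in scope. -/
def SStmt.WF (p b : ℕ) : SStmt D → Prop
  | .skip => True
  | .ite e s t => e.WF p b ∧ s.WF p b ∧ t.WF p b
  | .printChar _ => True
  | .printLabel i => i < p
  | .setTrue x => x < b
  | .loop _ k s => s.WF (p + 1) (b + k)
  | .seq s t => s.WF p b ∧ t.WF p b

/-- The program only uses declared variables. -/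
def SProg.WF (S : SProg D) : Prop := S.body.WF 0 S.bools

open Classical in
/-- Value of a test on the word `w`. -/
noncomputable def SBExpr.eval (w : List D) (I : List ℕ) (β : List Bool) : SBExpr D → Bool
  | .tt => true
  | .ff => false
  | .not e => !(e.eval w I β)
  | .bin op e₁ e₂ => op.eval (e₁.eval w I β) (e₂.eval w I β)
  | .bvar b => β.getD b false
  | .comp op i j => op.eval (I.getD i 0) (I.getD j 0)
  | .labelEq i a => decide (w[I.getD i 0]? = some a)

/-- Execution of a simple loop on a list of positions. -/
def runSLoop (body : ℕ → List Bool → List Bool × List D) :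
    List ℕ → List Bool → List Bool × List D
  | [], β => (β, [])
  | i :: l, β =>
      let r := body i β
      let r' := runSLoop body l r.1
      (r'.1, r.2 ++ r'.2)

/-- Execution on the word `w`: new values of the booleans, and printed word. -/
noncomputable def SStmt.eval (w : List D) (I : List ℕ) (β : List Bool) :
    SStmt D → List Bool × List D
  | .skip => (β, [])
  | .ite e s t => if e.eval w I β = true then s.eval w I β else t.eval w I β
  | .printChar a => (β, [a])
  | .printLabel i => (β, w[I.getD i 0]?.toList)
  | .setTrue b => (β.set b true, [])
  | .loop d k s =>
      runSLoop
        (fun i β =>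
          let r := s.eval w (i :: I) (List.replicate k false ++ β)
          (r.1.drop k, r.2))
        (match d with | .fwd => List.range w.length | .bwd => (List.range w.length).reverse) β
  | .seq s t =>
      let r := s.eval w I β
      let r' := t.eval w I r.1
      (r'.1, r.2 ++ r'.2)

/-- The output of a simple for-program on the word `w`. -/
noncomputable def SProg.eval (S : SProg D) (w : List D) : List D :=
  (S.body.eval w [] (List.replicate S.bools false)).2

/-- A test of a simple for-program, as a test of a for-program.  The label of the position `i` is the
list variable bound together with `i`. -/
def SBExpr.toHigh : SBExpr D → BExpr D
  | .tt => .tt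
  | .ff => .ff
  | .not e => .not e.toHigh
  | .bin op e₁ e₂ => .bin op e₁.toHigh e₂.toHigh
  | .bvar b => .bvar b
  | .comp op i j => .comp op i j
  | .labelEq i a => .litEq (.char a) (.var i)

/-- A simple statement below `p` loops, as a statement of a for-program.  The list variable `p` is the
input word. -/
def SStmt.toHigh (p : ℕ) : SStmt D → Stmt D
  | .skip => .skip
  | .ite e s t => .ite e.toHigh (s.toHigh p) (t.toHigh p)
  | .printChar a => .yield (.const (.char a))
  | .printLabel i => .yield (.var i)
  | .setTrue b => .setTrue b
  | .loop d k s => .loop d (.var p) (letBools k (s.toHigh (p + 1)))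
  | .seq s t => .seq (s.toHigh p) (t.toHigh p)

/-- A simple for-program, written as a for-program with a single function. -/
def SProg.toHigh (S : SProg D) : Prog D where
  funs := [⟨[(1, 0)], .out 1, letBools S.bools (S.body.toHigh 0)⟩]
  main := 0

end ForProg

namespace ForProg

universe u

variable {D : Type u}

/-! ### Algebra of renamings and substitutions -/

@[simp] theorem up_id : up id = id := by
  funext x; cases x <;> rfl

theorem up_comp (r r' : ℕ → ℕ) : up r' ∘ up r = up (r' ∘ r) := by
  funext x; cases x <;> rfl

mutual

theorem BExpr.ren_ren (l p b l' p' b' : ℕ → ℕ) : ∀ e : BExpr D,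
    (e.ren l p b).ren l' p' b' = e.ren (l' ∘ l) (p' ∘ p) (b' ∘ b)
  | .tt | .ff | .bvar _ | .comp _ _ _ => rfl
  | .not e => by simp [BExpr.ren, BExpr.ren_ren _ _ _ _ _ _ e]
  | .bin _ e₁ e₂ => by
      simp [BExpr.ren, BExpr.ren_ren _ _ _ _ _ _ e₁, BExpr.ren_ren _ _ _ _ _ _ e₂]
  | .litEq _ o => by simp [BExpr.ren, OExpr.ren_ren _ _ _ _ o]
  | .call _ as => by simp [BExpr.ren, Args.ren_ren _ _ _ _ as]
  | .gen s => by simp [BExpr.ren, Stmt.ren_ren _ _ _ _ _ _ s]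

theorem OExpr.ren_ren (l p l' p' : ℕ → ℕ) : ∀ o : OExpr D,
    (o.ren l p).ren l' p' = o.ren (l' ∘ l) (p' ∘ p)
  | .var _ | .const _ => rfl
  | .list _ es => by simp [OExpr.ren, OExprs.ren_ren _ _ _ _ es]
  | .call _ as => by simp [OExpr.ren, Args.ren_ren _ _ _ _ as]
  | .gen _ s => by simp [OExpr.ren, Stmt.ren_ren _ _ _ _ _ _ s]

theorem OExprs.ren_ren (l p l' p' : ℕ → ℕ) : ∀ es : OExprs D,
    (es.ren l p).ren l' p' = es.ren (l' ∘ l) (p' ∘ p)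
  | .nil => rfl
  | .cons e es => by simp [OExprs.ren, OExpr.ren_ren _ _ _ _ e, OExprs.ren_ren _ _ _ _ es]

theorem Args.ren_ren (l p l' p' : ℕ → ℕ) : ∀ as : Args D,
    (as.ren l p).ren l' p' = as.ren (l' ∘ l) (p' ∘ p)
  | .nil => rfl
  | .cons e ps as => by simp [Args.ren, OExpr.ren_ren _ _ _ _ e, Args.ren_ren _ _ _ _ as]

theorem Stmt.ren_ren (l p b l' p' b' : ℕ → ℕ) : ∀ s : Stmt D,
    (s.ren l p b).ren l' p' b' = s.ren (l' ∘ l) (p' ∘ p) (b' ∘ b)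
  | .skip | .setTrue _ => rfl
  | .ite e s t => by
      simp [Stmt.ren, BExpr.ren_ren _ _ _ _ _ _ e, Stmt.ren_ren _ _ _ _ _ _ s,
        Stmt.ren_ren _ _ _ _ _ _ t]
  | .yield o | .ret o => by simp [Stmt.ren, OExpr.ren_ren _ _ _ _ o]
  | .bret e => by simp [Stmt.ren, BExpr.ren_ren _ _ _ _ _ _ e]
  | .letOut o s => by
      simp [Stmt.ren, OExpr.ren_ren _ _ _ _ o, Stmt.ren_ren _ _ _ _ _ _ s, up_comp]
  | .letBool s => by simp [Stmt.ren, Stmt.ren_ren _ _ _ _ _ _ s, up_comp]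
  | .loop _ o s => by
      simp [Stmt.ren, OExpr.ren_ren _ _ _ _ o, Stmt.ren_ren _ _ _ _ _ _ s, up_comp]
  | .seq s t => by
      simp [Stmt.ren, Stmt.ren_ren _ _ _ _ _ _ s, Stmt.ren_ren _ _ _ _ _ _ t]

end

mutual

theorem BExpr.ren_id : ∀ e : BExpr D, e.ren id id id = e
  | .tt | .ff | .bvar _ | .comp _ _ _ => rfl
  | .not e => by simp [BExpr.ren, BExpr.ren_id e]
  | .bin _ e₁ e₂ => by simp [BExpr.ren, BExpr.ren_id e₁, BExpr.ren_id e₂]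
  | .litEq _ o => by simp [BExpr.ren, OExpr.ren_id o]
  | .call _ as => by simp [BExpr.ren, Args.ren_id as]
  | .gen s => by simp [BExpr.ren, Stmt.ren_id s]

theorem OExpr.ren_id : ∀ o : OExpr D, o.ren id id = o
  | .var _ | .const _ => rfl
  | .list _ es => by simp [OExpr.ren, OExprs.ren_id es]
  | .call _ as => by simp [OExpr.ren, Args.ren_id as]
  | .gen _ s => by simp [OExpr.ren, Stmt.ren_id s]

theorem OExprs.ren_id : ∀ es : OExprs D, es.ren id id = es
  | .nil => rfl
  | .cons e es => by simp [OExprs.ren, OExpr.ren_id e, OExprs.ren_id es]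

theorem Args.ren_id : ∀ as : Args D, as.ren id id = as
  | .nil => rfl
  | .cons e _ as => by simp [Args.ren, OExpr.ren_id e, Args.ren_id as]

theorem Stmt.ren_id : ∀ s : Stmt D, s.ren id id id = s
  | .skip | .setTrue _ => rfl
  | .ite e s t => by simp [Stmt.ren, BExpr.ren_id e, Stmt.ren_id s, Stmt.ren_id t]
  | .yield o | .ret o => by simp [Stmt.ren, OExpr.ren_id o]
  | .bret e => by simp [Stmt.ren, BExpr.ren_id e]
  | .letOut o s | .loop _ o s => by simp [Stmt.ren, OExpr.ren_id o, Stmt.ren_id s]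
  | .letBool s => by simp [Stmt.ren, Stmt.ren_id s]
  | .seq s t => by simp [Stmt.ren, Stmt.ren_id s, Stmt.ren_id t]

end

theorem upLet_var : upLet (D := D) .var = .var := by
  funext x; cases x <;> rfl

theorem upLoop_var : upLoop (D := D) .var = .var := by
  funext x; cases x <;> rfl

mutual

theorem BExpr.sub_var : ∀ e : BExpr D, e.sub .var id = e
  | .tt | .ff | .bvar _ | .comp _ _ _ => rfl
  | .not e => by simp [BExpr.sub, BExpr.sub_var e]
  | .bin _ e₁ e₂ => by simp [BExpr.sub, BExpr.sub_var e₁, BExpr.sub_var e₂]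
  | .litEq _ o => by simp [BExpr.sub, OExpr.sub_var o]
  | .call _ as => by simp [BExpr.sub, Args.sub_var as]
  | .gen s => by simp [BExpr.sub, Stmt.sub_var s]

theorem OExpr.sub_var : ∀ o : OExpr D, o.sub .var id = o
  | .var _ | .const _ => rfl
  | .list _ es => by simp [OExpr.sub, OExprs.sub_var es]
  | .call _ as => by simp [OExpr.sub, Args.sub_var as]
  | .gen _ s => by simp [OExpr.sub, Stmt.sub_var s]

theorem OExprs.sub_var : ∀ es : OExprs D, es.sub .var id = es
  | .nil => rfl
  | .cons e es => by simp [OExprs.sub, OExpr.sub_var e, OExprs.sub_var es]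

theorem Args.sub_var : ∀ as : Args D, as.sub .var id = as
  | .nil => rfl
  | .cons e _ as => by simp [Args.sub, OExpr.sub_var e, Args.sub_var as]

theorem Stmt.sub_var : ∀ s : Stmt D, s.sub .var id = s
  | .skip | .setTrue _ => rfl
  | .ite e s t => by simp [Stmt.sub, BExpr.sub_var e, Stmt.sub_var s, Stmt.sub_var t]
  | .yield o | .ret o => by simp [Stmt.sub, OExpr.sub_var o]
  | .bret e => by simp [Stmt.sub, BExpr.sub_var e]
  | .letOut o s | .loop _ o s => by
      simp [Stmt.sub, OExpr.sub_var o, Stmt.sub_var s, upLet_var, upLoop_var]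
  | .letBool s => by simp [Stmt.sub, Stmt.sub_var s]
  | .seq s t => by simp [Stmt.sub, Stmt.sub_var s, Stmt.sub_var t]

end

theorem upLet_comp_up (σ : ℕ → OExpr D) (l : ℕ → ℕ) : upLet σ ∘ up l = upLet (σ ∘ l) := by
  funext x; cases x <;> rfl

theorem upLoop_comp_up (σ : ℕ → OExpr D) (l : ℕ → ℕ) : upLoop σ ∘ up l = upLoop (σ ∘ l) := by
  funext x; cases x <;> rfl

mutual

theorem BExpr.sub_ren (l p q : ℕ → ℕ) (σ : ℕ → OExpr D) : ∀ e : BExpr D,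
    (e.ren l p id).sub σ q = e.sub (σ ∘ l) (q ∘ p)
  | .tt | .ff | .bvar _ | .comp _ _ _ => rfl
  | .not e => by simp [BExpr.ren, BExpr.sub, BExpr.sub_ren _ _ _ _ e]
  | .bin _ e₁ e₂ => by
      simp [BExpr.ren, BExpr.sub, BExpr.sub_ren _ _ _ _ e₁, BExpr.sub_ren _ _ _ _ e₂]
  | .litEq _ o => by simp [BExpr.ren, BExpr.sub, OExpr.sub_ren _ _ _ _ o]
  | .call _ as => by simp [BExpr.ren, BExpr.sub, Args.sub_ren _ _ _ _ as]
  | .gen s => by simp [BExpr.ren, BExpr.sub, Stmt.sub_ren _ _ _ _ s]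

theorem OExpr.sub_ren (l p q : ℕ → ℕ) (σ : ℕ → OExpr D) : ∀ o : OExpr D,
    (o.ren l p).sub σ q = o.sub (σ ∘ l) (q ∘ p)
  | .var _ | .const _ => rfl
  | .list _ es => by simp [OExpr.ren, OExpr.sub, OExprs.sub_ren _ _ _ _ es]
  | .call _ as => by simp [OExpr.ren, OExpr.sub, Args.sub_ren _ _ _ _ as]
  | .gen _ s => by simp [OExpr.ren, OExpr.sub, Stmt.sub_ren _ _ _ _ s]

theorem OExprs.sub_ren (l p q : ℕ → ℕ) (σ : ℕ → OExpr D) : ∀ es : OExprs D,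
    (es.ren l p).sub σ q = es.sub (σ ∘ l) (q ∘ p)
  | .nil => rfl
  | .cons e es => by
      simp [OExprs.ren, OExprs.sub, OExpr.sub_ren _ _ _ _ e, OExprs.sub_ren _ _ _ _ es]

theorem Args.sub_ren (l p q : ℕ → ℕ) (σ : ℕ → OExpr D) : ∀ as : Args D,
    (as.ren l p).sub σ q = as.sub (σ ∘ l) (q ∘ p)
  | .nil => rfl
  | .cons e _ as => by
      simp [Args.ren, Args.sub, OExpr.sub_ren _ _ _ _ e, Args.sub_ren _ _ _ _ as]

theorem Stmt.sub_ren (l p q : ℕ → ℕ) (σ : ℕ → OExpr D) : ∀ s : Stmt D,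
    (s.ren l p id).sub σ q = s.sub (σ ∘ l) (q ∘ p)
  | .skip | .setTrue _ => rfl
  | .ite e s t => by
      simp [Stmt.ren, Stmt.sub, BExpr.sub_ren _ _ _ _ e, Stmt.sub_ren _ _ _ _ s,
        Stmt.sub_ren _ _ _ _ t]
  | .yield o | .ret o => by simp [Stmt.ren, Stmt.sub, OExpr.sub_ren _ _ _ _ o]
  | .bret e => by simp [Stmt.ren, Stmt.sub, BExpr.sub_ren _ _ _ _ e]
  | .letOut o s | .loop _ o s => by
      simp [Stmt.ren, Stmt.sub, OExpr.sub_ren _ _ _ _ o, Stmt.sub_ren _ _ _ _ s,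
        upLet_comp_up, upLoop_comp_up, up_comp]
  | .letBool s => by simp [Stmt.ren, Stmt.sub, Stmt.sub_ren _ _ _ _ s]
  | .seq s t => by
      simp [Stmt.ren, Stmt.sub, Stmt.sub_ren _ _ _ _ s, Stmt.sub_ren _ _ _ _ t]

end

theorem ren_upLet (σ : ℕ → OExpr D) (l p : ℕ → ℕ) :
    (fun x => (upLet σ x).ren (up l) p) = upLet fun x => (σ x).ren l p := by
  funext x
  cases x with
  | zero => rfl
  | succ x => simp only [upLet, OExpr.ren_ren]; rfl

theorem ren_upLoop (σ : ℕ → OExpr D) (l p : ℕ → ℕ) :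
    (fun x => (upLoop σ x).ren (up l) (up p)) = upLoop fun x => (σ x).ren l p := by
  funext x
  cases x with
  | zero => rfl
  | succ x => simp only [upLoop, OExpr.ren_ren]; rfl

mutual

theorem BExpr.ren_sub (l p q : ℕ → ℕ) (σ : ℕ → OExpr D) : ∀ e : BExpr D,
    (e.sub σ q).ren l p id = e.sub (fun x => (σ x).ren l p) (p ∘ q)
  | .tt | .ff | .bvar _ | .comp _ _ _ => rfl
  | .not e => by simp [BExpr.ren, BExpr.sub, BExpr.ren_sub _ _ _ _ e]
  | .bin _ e₁ e₂ => by
      simp [BExpr.ren, BExpr.sub, BExpr.ren_sub _ _ _ _ e₁, BExpr.ren_sub _ _ _ _ e₂]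
  | .litEq _ o => by simp [BExpr.ren, BExpr.sub, OExpr.ren_sub _ _ _ _ o]
  | .call _ as => by simp [BExpr.ren, BExpr.sub, Args.ren_sub _ _ _ _ as]
  | .gen s => by simp [BExpr.ren, BExpr.sub, Stmt.ren_sub _ _ _ _ s]

theorem OExpr.ren_sub (l p q : ℕ → ℕ) (σ : ℕ → OExpr D) : ∀ o : OExpr D,
    (o.sub σ q).ren l p = o.sub (fun x => (σ x).ren l p) (p ∘ q)
  | .var _ | .const _ => rfl
  | .list _ es => by simp [OExpr.ren, OExpr.sub, OExprs.ren_sub _ _ _ _ es]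
  | .call _ as => by simp [OExpr.ren, OExpr.sub, Args.ren_sub _ _ _ _ as]
  | .gen _ s => by simp [OExpr.ren, OExpr.sub, Stmt.ren_sub _ _ _ _ s]

theorem OExprs.ren_sub (l p q : ℕ → ℕ) (σ : ℕ → OExpr D) : ∀ es : OExprs D,
    (es.sub σ q).ren l p = es.sub (fun x => (σ x).ren l p) (p ∘ q)
  | .nil => rfl
  | .cons e es => by
      simp [OExprs.ren, OExprs.sub, OExpr.ren_sub _ _ _ _ e, OExprs.ren_sub _ _ _ _ es]

theorem Args.ren_sub (l p q : ℕ → ℕ) (σ : ℕ → OExpr D) : ∀ as : Args D,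
    (as.sub σ q).ren l p = as.sub (fun x => (σ x).ren l p) (p ∘ q)
  | .nil => rfl
  | .cons e _ as => by
      simp [Args.ren, Args.sub, OExpr.ren_sub _ _ _ _ e, Args.ren_sub _ _ _ _ as]

theorem Stmt.ren_sub (l p q : ℕ → ℕ) (σ : ℕ → OExpr D) : ∀ s : Stmt D,
    (s.sub σ q).ren l p id = s.sub (fun x => (σ x).ren l p) (p ∘ q)
  | .skip | .setTrue _ => rfl
  | .ite e s t => by
      simp [Stmt.ren, Stmt.sub, BExpr.ren_sub _ _ _ _ e, Stmt.ren_sub _ _ _ _ s,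
        Stmt.ren_sub _ _ _ _ t]
  | .yield o | .ret o => by simp [Stmt.ren, Stmt.sub, OExpr.ren_sub _ _ _ _ o]
  | .bret e => by simp [Stmt.ren, Stmt.sub, BExpr.ren_sub _ _ _ _ e]
  | .letOut o s | .loop _ o s => by
      simp [Stmt.ren, Stmt.sub, OExpr.ren_sub _ _ _ _ o, Stmt.ren_sub _ _ _ _ s,
        ren_upLet, ren_upLoop, up_comp]
  | .letBool s => by simp [Stmt.ren, Stmt.sub, Stmt.ren_sub _ _ _ _ s]
  | .seq s t => by
      simp [Stmt.ren, Stmt.sub, Stmt.ren_sub _ _ _ _ s, Stmt.ren_sub _ _ _ _ t]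

end

theorem Stmt.ren_subst (s : Stmt D) (o : OExpr D) (l p : ℕ → ℕ) :
    (s.subst o).ren l p id = (s.ren (up l) p id).subst (o.ren l p) := by
  simp only [Stmt.subst, Stmt.ren_sub, Stmt.sub_ren]
  congr 1
  funext x; cases x <;> rfl

/-! ### Typing of renamed and substituted terms -/

@[simp] theorem Args.exprs_ren (l p : ℕ → ℕ) : ∀ as : Args D,
    (as.ren l p).exprs = as.exprs.map (OExpr.ren l p)
  | .nil => rfl
  | .cons e _ as => by simp [Args.ren, Args.exprs, Args.exprs_ren l p as]

@[simp] theorem Args.poss_ren (l p : ℕ → ℕ) : ∀ as : Args D,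
    (as.ren l p).poss = as.poss.map p
  | .nil => rfl
  | .cons e _ as => by simp [Args.ren, Args.poss, Args.poss_ren l p as]

/-- A renaming of list and position variables that is compatible with the types. -/
structure Ctx.Ren (Γ Γ' : Ctx D) (l p : ℕ → ℕ) : Prop where
  funs : ∀ (f : ℕ) (σ : Sig), Γ.funs[f]? = some σ → Γ'.funs[f]? = some σ
  lists : ∀ x n : ℕ, Γ.lists[x]? = some n → Γ'.lists[l x]? = some n
  poss : ∀ (i : ℕ) (o : OExpr D), Γ.poss[i]? = some o → Γ'.poss[p i]? = some (o.ren l p)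

theorem Ctx.Ren.hideBools {Γ Γ' : Ctx D} {l p : ℕ → ℕ} (h : Ctx.Ren Γ Γ' l p) :
    Ctx.Ren Γ.hideBools Γ'.hideBools l p :=
  ⟨h.funs, h.lists, h.poss⟩

theorem Ctx.Ren.addBool {Γ Γ' : Ctx D} {l p : ℕ → ℕ} (h : Ctx.Ren Γ Γ' l p) :
    Ctx.Ren Γ.addBool Γ'.addBool l p :=
  ⟨h.funs, h.lists, h.poss⟩

theorem Ctx.Ren.addList {Γ Γ' : Ctx D} {l p : ℕ → ℕ} (h : Ctx.Ren Γ Γ' l p) (n : ℕ) :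
    Ctx.Ren (Γ.addList n) (Γ'.addList n) (up l) p where
  funs := h.funs
  lists x m hx := by
    cases x with
    | zero => exact hx
    | succ x => exact h.lists x m hx
  poss i o hi := by
    simp only [Ctx.addList, List.getElem?_map, Option.map_eq_some_iff] at hi ⊢
    obtain ⟨o', ho', rfl⟩ := hi
    refine ⟨_, h.poss i o' ho', ?_⟩
    simp only [OExpr.ren_ren]; rfl

theorem Ctx.Ren.addLoop {Γ Γ' : Ctx D} {l p : ℕ → ℕ} (h : Ctx.Ren Γ Γ' l p) (o : OExpr D)
    (n : ℕ) : Ctx.Ren (Γ.addLoop o n) (Γ'.addLoop (o.ren l p) n) (up l) (up p) where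
  funs := h.funs
  lists x m hx := by
    cases x with
    | zero => exact hx
    | succ x => exact h.lists x m hx
  poss i o' hi := by
    simp only [Ctx.addLoop, List.getElem?_map, Option.map_eq_some_iff] at hi ⊢
    obtain ⟨o₁, ho₁, rfl⟩ := hi
    refine ⟨o₁.ren l p, ?_, by simp only [OExpr.ren_ren]; rfl⟩
    cases i with
    | zero => simp at ho₁; subst ho₁; rfl
    | succ i => exact h.poss i o₁ ho₁

theorem up_lt {b : ℕ → ℕ} {m m' : ℕ} (h : ∀ x < m, b x < m') : ∀ x < m + 1, up b x < m' + 1 := by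
  intro x hx
  cases x with
  | zero => simp [up]
  | succ x => simpa [up] using h x (by omega)

mutual

theorem BExpr.HasType.ren {Γ Γ' : Ctx D} {l p b : ℕ → ℕ} (h : Ctx.Ren Γ Γ' l p)
    (hb : ∀ x < Γ.bools, b x < Γ'.bools) :
    ∀ {e : BExpr D}, e.HasType Γ → (e.ren l p b).HasType Γ'
  | .tt, _ | .ff, _ => trivial
  | .not e, he => BExpr.HasType.ren (e := e) h hb he
  | .bin _ _ _, he => ⟨BExpr.HasType.ren h hb he.1, BExpr.HasType.ren h hb he.2⟩
  | .bvar _, he => hb _ he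
  | .comp _ i j, ⟨o, hi, hj⟩ => ⟨o.ren l p, h.poss i o hi, h.poss j o hj⟩
  | .litEq _ _, ⟨n, hc, ho⟩ => ⟨n, hc, OExpr.HasType.ren h ho⟩
  | .call _ _, ⟨ps, hf, has⟩ => ⟨ps, h.funs _ _ hf, Args.HasType.ren h has⟩
  | .gen s, hs => Stmt.HasType.ren (s := s) h.hideBools (fun _ => id) hs

theorem OExpr.HasType.ren {Γ Γ' : Ctx D} {l p : ℕ → ℕ} (h : Ctx.Ren Γ Γ' l p) :
    ∀ {o : OExpr D} {n : ℕ}, o.HasType Γ n → (o.ren l p).HasType Γ' n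
  | .var x, n, ho => h.lists x n ho
  | .const _, _, ho => ho
  | .list _ _, _, ho => ⟨ho.1, OExprs.HasType.ren h ho.2⟩
  | .call _ _, _, ⟨ps, hf, has⟩ => ⟨ps, h.funs _ _ hf, Args.HasType.ren h has⟩
  | .gen _ _, _, ho => ⟨ho.1, Stmt.HasType.ren h.hideBools (fun _ => id) ho.2⟩

theorem OExprs.HasType.ren {Γ Γ' : Ctx D} {l p : ℕ → ℕ} (h : Ctx.Ren Γ Γ' l p) :
    ∀ {es : OExprs D} {n : ℕ}, es.HasType Γ n → (es.ren l p).HasType Γ' n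
  | .nil, _, _ => trivial
  | .cons _ _, _, he => ⟨OExpr.HasType.ren h he.1, OExprs.HasType.ren h he.2⟩

theorem Args.HasType.ren {Γ Γ' : Ctx D} {l p : ℕ → ℕ} (h : Ctx.Ren Γ Γ' l p) :
    ∀ {as : Args D} {ps : List (ℕ × ℕ)}, as.HasType Γ ps → (as.ren l p).HasType Γ' ps
  | .nil, _, ha => ha
  | .cons o is _, _, ⟨n, ps', hps, ho, his, has⟩ =>
      ⟨n, ps', by simpa using hps, OExpr.HasType.ren h ho, by
        intro i hi
        obtain ⟨j, hj, rfl⟩ := List.mem_map.1 hi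
        exact h.poss j o (his j hj), Args.HasType.ren h has⟩

theorem Stmt.HasType.ren {Γ Γ' : Ctx D} {l p b : ℕ → ℕ} (h : Ctx.Ren Γ Γ' l p)
    (hb : ∀ x < Γ.bools, b x < Γ'.bools) :
    ∀ {s : Stmt D} {τ : Ty}, s.HasType Γ τ → (s.ren l p b).HasType Γ' τ
  | .skip, _, _ => trivial
  | .ite _ _ _, _, hs =>
      ⟨BExpr.HasType.ren h hb hs.1, Stmt.HasType.ren h hb hs.2.1, Stmt.HasType.ren h hb hs.2.2⟩
  | .yield _, _, ⟨n, hτ, ho⟩ => ⟨n, hτ, OExpr.HasType.ren h ho⟩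
  | .ret _, _, ⟨n, hτ, ho⟩ => ⟨n, hτ, OExpr.HasType.ren h ho⟩
  | .bret _, _, hs => ⟨hs.1, BExpr.HasType.ren h hb hs.2⟩
  | .letOut _ _, _, ⟨n, ho, hs⟩ =>
      ⟨n, OExpr.HasType.ren h ho, Stmt.HasType.ren (h.addList n) hb hs⟩
  | .letBool s, _, hs => Stmt.HasType.ren (s := s) h.addBool (up_lt hb) hs
  | .setTrue _, _, hs => hb _ hs
  | .loop _ o _, _, ⟨n, ho, hs⟩ =>
      ⟨n, OExpr.HasType.ren h ho, Stmt.HasType.ren (h.addLoop o n) hb hs⟩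
  | .seq _ _, _, hs => ⟨Stmt.HasType.ren h hb hs.1, Stmt.HasType.ren h hb hs.2⟩

end

theorem Ctx.ren_addList (Γ : Ctx D) (n : ℕ) : Ctx.Ren Γ (Γ.addList n) Nat.succ id where
  funs _ _ h := h
  lists _ _ h := h
  poss i o h := by simp [Ctx.addList, h]

theorem Ctx.ren_addLoop (Γ : Ctx D) (o : OExpr D) (n : ℕ) :
    Ctx.Ren Γ (Γ.addLoop o n) Nat.succ Nat.succ where
  funs _ _ h := h
  lists _ _ h := h
  poss i o h := by simp [Ctx.addLoop, h]

theorem Ctx.ren_mono {Γ Γ' : Ctx D}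
    (hf : ∀ (f : ℕ) (σ : Sig), Γ.funs[f]? = some σ → Γ'.funs[f]? = some σ)
    (hl : Γ'.lists = Γ.lists) (hp : Γ'.poss = Γ.poss) : Ctx.Ren Γ Γ' id id where
  funs := hf
  lists x n h := by simpa [hl] using h
  poss i o h := by simpa [hp, OExpr.ren_id] using h

/-- The type of a list expression does not depend on the boolean variables, and is kept if functions
are added. -/
theorem OExpr.HasType.mono {Γ Γ' : Ctx D} {o : OExpr D} {n : ℕ} (ho : o.HasType Γ n)
    (hf : ∀ (f : ℕ) (σ : Sig), Γ.funs[f]? = some σ → Γ'.funs[f]? = some σ)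
    (hl : Γ'.lists = Γ.lists) (hp : Γ'.poss = Γ.poss) : o.HasType Γ' n := by
  simpa only [OExpr.ren_id] using ho.ren (Ctx.ren_mono hf hl hp)

theorem Args.HasType.mono {Γ Γ' : Ctx D} {as : Args D} {ps : List (ℕ × ℕ)}
    (has : as.HasType Γ ps)
    (hf : ∀ (f : ℕ) (σ : Sig), Γ.funs[f]? = some σ → Γ'.funs[f]? = some σ)
    (hl : Γ'.lists = Γ.lists) (hp : Γ'.poss = Γ.poss) : as.HasType Γ' ps := by
  simpa only [Args.ren_id] using has.ren (Ctx.ren_mono hf hl hp)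

theorem BExpr.HasType.mono {Γ Γ' : Ctx D} {e : BExpr D} (he : e.HasType Γ)
    (hf : ∀ (f : ℕ) (σ : Sig), Γ.funs[f]? = some σ → Γ'.funs[f]? = some σ)
    (hl : Γ'.lists = Γ.lists) (hp : Γ'.poss = Γ.poss) (hb : Γ.bools ≤ Γ'.bools) :
    e.HasType Γ' := by
  simpa only [BExpr.ren_id] using
    he.ren (b := id) (Ctx.ren_mono hf hl hp) fun x hx => lt_of_lt_of_le hx hb

/-- Renaming the boolean variables only. -/
theorem Stmt.HasType.ren_bools {Γ Γ' : Ctx D} {s : Stmt D} {τ : Ty} {b : ℕ → ℕ}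
    (hs : s.HasType Γ τ) (hf : Γ'.funs = Γ.funs) (hl : Γ'.lists = Γ.lists)
    (hp : Γ'.poss = Γ.poss) (hb : ∀ x < Γ.bools, b x < Γ'.bools) :
    (s.ren id id b).HasType Γ' τ :=
  hs.ren (Ctx.ren_mono (by simp [hf]) hl hp) hb

theorem BExpr.HasType.ren_bools {Γ Γ' : Ctx D} {e : BExpr D} {b : ℕ → ℕ}
    (he : e.HasType Γ) (hf : Γ'.funs = Γ.funs) (hl : Γ'.lists = Γ.lists)
    (hp : Γ'.poss = Γ.poss) (hb : ∀ x < Γ.bools, b x < Γ'.bools) :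
    (e.ren id id b).HasType Γ' :=
  he.ren (Ctx.ren_mono (by simp [hf]) hl hp) hb

/-- A substitution that is compatible with the types. -/
structure Ctx.Sub (Γ Γ' : Ctx D) (σ : ℕ → OExpr D) (p : ℕ → ℕ) : Prop where
  funs : ∀ (f : ℕ) (τ : Sig), Γ.funs[f]? = some τ → Γ'.funs[f]? = some τ
  lists : ∀ x n : ℕ, Γ.lists[x]? = some n → (σ x).HasType Γ' n
  poss : ∀ (i : ℕ) (o : OExpr D), Γ.poss[i]? = some o → Γ'.poss[p i]? = some (o.sub σ p)

theorem Ctx.Sub.hideBools {Γ Γ' : Ctx D} {σ : ℕ → OExpr D} {p : ℕ → ℕ} (h : Ctx.Sub Γ Γ' σ p) :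
    Ctx.Sub Γ.hideBools Γ'.hideBools σ p :=
  ⟨h.funs, fun x n hx => (h.lists x n hx).mono (fun _ _ => id) rfl rfl, h.poss⟩

theorem Ctx.Sub.addBool {Γ Γ' : Ctx D} {σ : ℕ → OExpr D} {p : ℕ → ℕ} (h : Ctx.Sub Γ Γ' σ p) :
    Ctx.Sub Γ.addBool Γ'.addBool σ p :=
  ⟨h.funs, fun x n hx => (h.lists x n hx).mono (fun _ _ => id) rfl rfl, h.poss⟩

theorem Ctx.Sub.addList {Γ Γ' : Ctx D} {σ : ℕ → OExpr D} {p : ℕ → ℕ} (h : Ctx.Sub Γ Γ' σ p)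
    (n : ℕ) : Ctx.Sub (Γ.addList n) (Γ'.addList n) (upLet σ) p where
  funs := h.funs
  lists x m hx := by
    cases x with
    | zero => exact hx
    | succ x => exact (h.lists x m hx).ren (Γ'.ren_addList n)
  poss i o hi := by
    simp only [Ctx.addList, List.getElem?_map, Option.map_eq_some_iff] at hi ⊢
    obtain ⟨o', ho', rfl⟩ := hi
    refine ⟨_, h.poss i o' ho', ?_⟩
    simp only [OExpr.ren_sub, OExpr.sub_ren]; rfl

theorem Ctx.Sub.addLoop {Γ Γ' : Ctx D} {σ : ℕ → OExpr D} {p : ℕ → ℕ} (h : Ctx.Sub Γ Γ' σ p)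
    (o : OExpr D) (n : ℕ) :
    Ctx.Sub (Γ.addLoop o n) (Γ'.addLoop (o.sub σ p) n) (upLoop σ) (up p) where
  funs := h.funs
  lists x m hx := by
    cases x with
    | zero => exact hx
    | succ x => exact (h.lists x m hx).ren (Γ'.ren_addLoop _ n)
  poss i o' hi := by
    simp only [Ctx.addLoop, List.getElem?_map, Option.map_eq_some_iff] at hi ⊢
    obtain ⟨o₁, ho₁, rfl⟩ := hi
    refine ⟨o₁.sub σ p, ?_, by simp only [OExpr.ren_sub, OExpr.sub_ren]; rfl⟩
    cases i with
    | zero => simp at ho₁; subst ho₁; rfl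
    | succ i => exact h.poss i o₁ ho₁

mutual

theorem BExpr.HasType.sub {Γ Γ' : Ctx D} {σ : ℕ → OExpr D} {p : ℕ → ℕ} (h : Ctx.Sub Γ Γ' σ p)
    (hb : Γ.bools ≤ Γ'.bools) : ∀ {e : BExpr D}, e.HasType Γ → (e.sub σ p).HasType Γ'
  | .tt, _ | .ff, _ => trivial
  | .not e, he => BExpr.HasType.sub (e := e) h hb he
  | .bin _ _ _, he => ⟨BExpr.HasType.sub h hb he.1, BExpr.HasType.sub h hb he.2⟩
  | .bvar _, he => lt_of_lt_of_le he hb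
  | .comp _ i j, ⟨o, hi, hj⟩ => ⟨o.sub σ p, h.poss i o hi, h.poss j o hj⟩
  | .litEq _ _, ⟨n, hc, ho⟩ => ⟨n, hc, OExpr.HasType.sub h ho⟩
  | .call _ _, ⟨ps, hf, has⟩ => ⟨ps, h.funs _ _ hf, Args.HasType.sub h has⟩
  | .gen s, hs => Stmt.HasType.sub (s := s) h.hideBools le_rfl hs

theorem OExpr.HasType.sub {Γ Γ' : Ctx D} {σ : ℕ → OExpr D} {p : ℕ → ℕ} (h : Ctx.Sub Γ Γ' σ p) :
    ∀ {o : OExpr D} {n : ℕ}, o.HasType Γ n → (o.sub σ p).HasType Γ' n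
  | .var x, n, ho => h.lists x n ho
  | .const _, _, ho => ho
  | .list _ _, _, ho => ⟨ho.1, OExprs.HasType.sub h ho.2⟩
  | .call _ _, _, ⟨ps, hf, has⟩ => ⟨ps, h.funs _ _ hf, Args.HasType.sub h has⟩
  | .gen _ _, _, ho => ⟨ho.1, Stmt.HasType.sub h.hideBools le_rfl ho.2⟩

theorem OExprs.HasType.sub {Γ Γ' : Ctx D} {σ : ℕ → OExpr D} {p : ℕ → ℕ}
    (h : Ctx.Sub Γ Γ' σ p) :
    ∀ {es : OExprs D} {n : ℕ}, es.HasType Γ n → (es.sub σ p).HasType Γ' n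
  | .nil, _, _ => trivial
  | .cons _ _, _, he => ⟨OExpr.HasType.sub h he.1, OExprs.HasType.sub h he.2⟩

theorem Args.HasType.sub {Γ Γ' : Ctx D} {σ : ℕ → OExpr D} {p : ℕ → ℕ} (h : Ctx.Sub Γ Γ' σ p) :
    ∀ {as : Args D} {ps : List (ℕ × ℕ)}, as.HasType Γ ps → (as.sub σ p).HasType Γ' ps
  | .nil, _, ha => ha
  | .cons o is _, _, ⟨n, ps', hps, ho, his, has⟩ =>
      ⟨n, ps', by simpa using hps, OExpr.HasType.sub h ho, by
        intro i hi
        obtain ⟨j, hj, rfl⟩ := List.mem_map.1 hi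
        exact h.poss j o (his j hj), Args.HasType.sub h has⟩

theorem Stmt.HasType.sub {Γ Γ' : Ctx D} {σ : ℕ → OExpr D} {p : ℕ → ℕ} (h : Ctx.Sub Γ Γ' σ p)
    (hb : Γ.bools ≤ Γ'.bools) :
    ∀ {s : Stmt D} {τ : Ty}, s.HasType Γ τ → (s.sub σ p).HasType Γ' τ
  | .skip, _, _ => trivial
  | .ite _ _ _, _, hs =>
      ⟨BExpr.HasType.sub h hb hs.1, Stmt.HasType.sub h hb hs.2.1, Stmt.HasType.sub h hb hs.2.2⟩
  | .yield _, _, ⟨n, hτ, ho⟩ => ⟨n, hτ, OExpr.HasType.sub h ho⟩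
  | .ret _, _, ⟨n, hτ, ho⟩ => ⟨n, hτ, OExpr.HasType.sub h ho⟩
  | .bret _, _, hs => ⟨hs.1, BExpr.HasType.sub h hb hs.2⟩
  | .letOut _ _, _, ⟨n, ho, hs⟩ =>
      ⟨n, OExpr.HasType.sub h ho, Stmt.HasType.sub (h.addList n) hb hs⟩
  | .letBool s, _, hs => Stmt.HasType.sub (s := s) h.addBool (Nat.succ_le_succ hb) hs
  | .setTrue _, _, hs => lt_of_lt_of_le hs hb
  | .loop _ o _, _, ⟨n, ho, hs⟩ =>
      ⟨n, OExpr.HasType.sub h ho, Stmt.HasType.sub (h.addLoop o n) hb hs⟩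
  | .seq _ _, _, hs => ⟨Stmt.HasType.sub h hb hs.1, Stmt.HasType.sub h hb hs.2⟩

end

theorem Stmt.HasType.subst {Γ : Ctx D} {s : Stmt D} {o : OExpr D} {n : ℕ} {τ : Ty}
    (hs : s.HasType (Γ.addList n) τ) (ho : o.HasType Γ n) : (s.subst o).HasType Γ τ := by
  refine Stmt.HasType.sub (Γ := Γ.addList n) (Γ' := Γ) ⟨fun _ _ => id, ?_, ?_⟩ le_rfl hs
  · rintro (_ | x) m hx
    · obtain rfl : n = m := by simpa [Ctx.addList] using hx
      exact ho
    · exact hx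
  · intro i o' hi
    simp only [Ctx.addList, List.getElem?_map, Option.map_eq_some_iff] at hi
    obtain ⟨o₁, ho₁, rfl⟩ := hi
    rw [OExpr.sub_ren]
    exact ho₁.trans (congrArg some (OExpr.sub_var o₁).symm)

theorem Args.HasType.length_exprs {Γ : Ctx D} : ∀ {as : Args D} {ps : List (ℕ × ℕ)},
    as.HasType Γ ps → as.exprs.length = ps.length
  | .nil, _, h => by subst h; rfl
  | .cons _ _ _, _, ⟨n, ps', hps, _, _, has⟩ => by
      subst hps; simp [Args.exprs, has.length_exprs]

theorem Args.HasType.length_poss {Γ : Ctx D} : ∀ {as : Args D} {ps : List (ℕ × ℕ)},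
    as.HasType Γ ps → as.poss.length = (ps.map Prod.snd).sum
  | .nil, _, h => by subst h; rfl
  | .cons _ _ _, _, ⟨n, ps', hps, _, _, has⟩ => by
      subst hps; simp [Args.poss, has.length_poss]

theorem length_paramPoss : ∀ (k : ℕ) (ps : List (ℕ × ℕ)),
    (paramPoss (D := D) k ps).length = (ps.map Prod.snd).sum
  | _, [] => rfl
  | k, p :: ps => by simp [paramPoss, length_paramPoss (k + 1) ps]

theorem Args.HasType.getElem?_exprs {Γ : Ctx D} : ∀ {as : Args D} {ps : List (ℕ × ℕ)},
    as.HasType Γ ps → ∀ x n : ℕ, (ps.map Prod.fst)[x]? = some n →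
      ∃ o, as.exprs[x]? = some o ∧ o.HasType Γ n
  | .nil, _, h, x, n, hx => by subst h; simp at hx
  | .cons o _ _, _, ⟨n, ps', hps, ho, _, has⟩, x, m, hx => by
      subst hps
      cases x with
      | zero => simp at hx; subst hx; exact ⟨o, rfl, ho⟩
      | succ x => exact has.getElem?_exprs x m (by simpa using hx)

theorem Args.HasType.getElem?_poss {Γ : Ctx D} : ∀ {as : Args D} {ps : List (ℕ × ℕ)},
    as.HasType Γ ps → ∀ (k i : ℕ) (o : OExpr D), (paramPoss k ps)[i]? = some o →
      ∃ x j o', o = .var (k + x) ∧ as.poss[i]? = some j ∧ as.exprs[x]? = some o' ∧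
        Γ.poss[j]? = some o'
  | .nil, _, h, k, i, o, hi => by subst h; simp [paramPoss] at hi
  | .cons e is as, _, ⟨n, ps', hps, _, his, has⟩, k, i, o, hi => by
      subst hps
      simp only [paramPoss] at hi
      by_cases hlt : i < is.length
      · rw [List.getElem?_append_left (by simpa using hlt)] at hi
        simp [hlt] at hi
        refine ⟨0, is[i], e, hi.symm, ?_, rfl, his _ (List.getElem_mem hlt)⟩
        simp [Args.poss, List.getElem?_append_left hlt]
      · rw [List.getElem?_append_right (by simpa using hlt)] at hi
        simp only [List.length_replicate] at hi
        obtain ⟨x, j, o', h₁, h₂, h₃, h₄⟩ := has.getElem?_poss (k + 1) _ o hi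
        refine ⟨x + 1, j, o', by rw [h₁]; congr 1; omega, ?_, h₃, h₄⟩
        simpa [Args.poss, List.getElem?_append_right (not_lt.1 hlt)] using h₂

/-- The context of a function body. -/
def bodyCtx (F : List Sig) (ps : List (ℕ × ℕ)) : Ctx D := ⟨F, ps.map Prod.fst, paramPoss 0 ps, 0⟩

theorem Stmt.HasType.instantiate {Γ : Ctx D} {s : Stmt D} {as : Args D} {F : List Sig}
    {ps : List (ℕ × ℕ)} {τ : Ty} (hs : s.HasType (bodyCtx F ps) τ) (has : as.HasType Γ ps)
    (hF : ∀ (f : ℕ) (σ : Sig), F[f]? = some σ → Γ.funs[f]? = some σ) :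
    (s.instantiate as).HasType Γ τ := by
  refine hs.sub ⟨hF, ?_, ?_⟩ (Nat.zero_le _)
  · intro x n hx
    obtain ⟨o, ho, hoT⟩ := has.getElem?_exprs x n hx
    simpa [List.getD_eq_getElem?_getD, ho] using hoT
  · intro i o hi
    obtain ⟨x, j, o', rfl, h₂, h₃, h₄⟩ := has.getElem?_poss 0 i o hi
    simp [List.getD_eq_getElem?_getD, h₂, h₃, h₄, OExpr.sub]

/-! ### Substitutions that agree on the variables in scope -/

/-- The two substitutions agree on the variables of the context. -/
structure Ctx.Agree (Γ : Ctx D) (σ σ' : ℕ → OExpr D) (p p' : ℕ → ℕ) : Prop where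
  lists : ∀ x < Γ.lists.length, σ x = σ' x
  poss : ∀ i < Γ.poss.length, p i = p' i

theorem Ctx.Agree.addList {Γ : Ctx D} {σ σ' : ℕ → OExpr D} {p p' : ℕ → ℕ}
    (h : Γ.Agree σ σ' p p') (n : ℕ) : (Γ.addList n).Agree (upLet σ) (upLet σ') p p' where
  lists x hx := by
    cases x with
    | zero => rfl
    | succ x => simp [upLet, h.lists x (by simpa [Ctx.addList] using hx)]
  poss i hi := h.poss i (by simpa [Ctx.addList] using hi)

theorem Ctx.Agree.addLoop {Γ : Ctx D} {σ σ' : ℕ → OExpr D} {p p' : ℕ → ℕ}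
    (h : Γ.Agree σ σ' p p') (o : OExpr D) (n : ℕ) :
    (Γ.addLoop o n).Agree (upLoop σ) (upLoop σ') (up p) (up p') where
  lists x hx := by
    cases x with
    | zero => rfl
    | succ x => simp [upLoop, h.lists x (by simpa [Ctx.addLoop] using hx)]
  poss i hi := by
    cases i with
    | zero => rfl
    | succ i => simp [up, h.poss i (by simpa [Ctx.addLoop] using hi)]

theorem lt_of_getElem?_eq_some {α : Type*} {l : List α} {i : ℕ} {a : α} (h : l[i]? = some a) :
    i < l.length := (List.getElem?_eq_some_iff.1 h).1

mutual

theorem BExpr.HasType.sub_congr {σ σ' : ℕ → OExpr D} {p p' : ℕ → ℕ} :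
    ∀ {Γ : Ctx D} {e : BExpr D}, e.HasType Γ → Γ.Agree σ σ' p p' → e.sub σ p = e.sub σ' p'
  | _, .tt, _, _ | _, .ff, _, _ | _, .bvar _, _, _ => rfl
  | _, .not _, he, h => congrArg BExpr.not (BExpr.HasType.sub_congr he h)
  | _, .bin _ _ _, he, h => by
      simp only [BExpr.sub]; rw [BExpr.HasType.sub_congr he.1 h, BExpr.HasType.sub_congr he.2 h]
  | _, .comp _ i j, ⟨o, hi, hj⟩, h => by
      simp only [BExpr.sub]
      rw [h.poss i (lt_of_getElem?_eq_some hi), h.poss j (lt_of_getElem?_eq_some hj)]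
  | _, .litEq _ _, ⟨n, _, ho⟩, h => congrArg _ (OExpr.HasType.sub_congr ho h)
  | _, .call _ _, ⟨_, _, has⟩, h => congrArg _ (Args.HasType.sub_congr has h)
  | _, .gen _, hs, h => congrArg BExpr.gen (Stmt.HasType.sub_congr hs ⟨h.lists, h.poss⟩)

theorem OExpr.HasType.sub_congr {σ σ' : ℕ → OExpr D} {p p' : ℕ → ℕ} :
    ∀ {Γ : Ctx D} {o : OExpr D} {n : ℕ}, o.HasType Γ n → Γ.Agree σ σ' p p' →
      o.sub σ p = o.sub σ' p'
  | _, .var x, _, ho, h => h.lists x (lt_of_getElem?_eq_some ho)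
  | _, .const _, _, _, _ => rfl
  | _, .list _ _, _, ho, h => congrArg _ (OExprs.HasType.sub_congr ho.2 h)
  | _, .call _ _, _, ⟨_, _, has⟩, h => congrArg _ (Args.HasType.sub_congr has h)
  | _, .gen _ _, _, ho, h => congrArg _ (Stmt.HasType.sub_congr ho.2 ⟨h.lists, h.poss⟩)

theorem OExprs.HasType.sub_congr {σ σ' : ℕ → OExpr D} {p p' : ℕ → ℕ} :
    ∀ {Γ : Ctx D} {es : OExprs D} {n : ℕ}, es.HasType Γ n → Γ.Agree σ σ' p p' →
      es.sub σ p = es.sub σ' p'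
  | _, .nil, _, _, _ => rfl
  | _, .cons _ _, _, he, h => by
      simp only [OExprs.sub]
      rw [OExpr.HasType.sub_congr he.1 h, OExprs.HasType.sub_congr he.2 h]

theorem Args.HasType.sub_congr {σ σ' : ℕ → OExpr D} {p p' : ℕ → ℕ} :
    ∀ {Γ : Ctx D} {as : Args D} {ps : List (ℕ × ℕ)}, as.HasType Γ ps → Γ.Agree σ σ' p p' →
      as.sub σ p = as.sub σ' p'
  | _, .nil, _, _, _ => rfl
  | _, .cons _ is _, _, ⟨_, _, _, ho, his, has⟩, h => by
      have : is.map p = is.map p' :=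
        List.map_congr_left fun i hi => h.poss i (lt_of_getElem?_eq_some (his i hi))
      simp only [Args.sub]
      rw [OExpr.HasType.sub_congr ho h, Args.HasType.sub_congr has h, this]

theorem Stmt.HasType.sub_congr {σ σ' : ℕ → OExpr D} {p p' : ℕ → ℕ} :
    ∀ {Γ : Ctx D} {s : Stmt D} {τ : Ty}, s.HasType Γ τ → Γ.Agree σ σ' p p' →
      s.sub σ p = s.sub σ' p'
  | _, .skip, _, _, _ | _, .setTrue _, _, _, _ => rfl
  | _, .ite _ _ _, _, hs, h => by
      simp only [Stmt.sub]
      rw [BExpr.HasType.sub_congr hs.1 h, Stmt.HasType.sub_congr hs.2.1 h,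
        Stmt.HasType.sub_congr hs.2.2 h]
  | _, .yield _, _, ⟨_, _, ho⟩, h => congrArg _ (OExpr.HasType.sub_congr ho h)
  | _, .ret _, _, ⟨_, _, ho⟩, h => congrArg _ (OExpr.HasType.sub_congr ho h)
  | _, .bret _, _, hs, h => congrArg _ (BExpr.HasType.sub_congr hs.2 h)
  | _, .letOut _ _, _, ⟨n, ho, hs⟩, h => by
      simp only [Stmt.sub]
      rw [OExpr.HasType.sub_congr ho h, Stmt.HasType.sub_congr hs (h.addList n)]
  | _, .letBool _, _, hs, h =>
      congrArg Stmt.letBool (Stmt.HasType.sub_congr hs ⟨h.lists, h.poss⟩)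
  | _, .loop _ o _, _, ⟨n, ho, hs⟩, h => by
      simp only [Stmt.sub]
      rw [OExpr.HasType.sub_congr ho h, Stmt.HasType.sub_congr hs (h.addLoop o n)]
  | _, .seq _ _, _, hs, h => by
      simp only [Stmt.sub]
      rw [Stmt.HasType.sub_congr hs.1 h, Stmt.HasType.sub_congr hs.2 h]

end

theorem Stmt.HasType.ren_instantiate {s : Stmt D} {F : List Sig} {ps : List (ℕ × ℕ)} {τ : Ty}
    (hs : s.HasType (bodyCtx F ps) τ) {as : Args D} (h₁ : as.exprs.length = ps.length)
    (h₂ : as.poss.length = (ps.map Prod.snd).sum) (l p : ℕ → ℕ) :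
    (s.instantiate as).ren l p id = s.instantiate (as.ren l p) := by
  unfold Stmt.instantiate
  rw [Stmt.ren_sub]
  refine hs.sub_congr ⟨fun x hx => ?_, fun i hi => ?_⟩
  · replace hx : x < as.exprs.length := by simpa [bodyCtx, h₁] using hx
    simp [List.getD_eq_getElem?_getD, hx]
  · replace hi : i < as.poss.length := by simpa [bodyCtx, h₂, length_paramPoss] using hi
    simp [List.getD_eq_getElem?_getD, hi]

/-! ### Rewriting commutes with renaming and preserves types -/

/-- The renaming `l` respects the flags of the list variables. -/
def SameFlags (φ φ' : List Bool) (l : ℕ → ℕ) : Prop :=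
  ∀ x, φ'.getD (l x) false = φ.getD x false

theorem SameFlags.up {φ φ' : List Bool} {l : ℕ → ℕ} (h : SameFlags φ φ' l) (a : Bool) :
    SameFlags (a :: φ) (a :: φ') (up l) := by
  rintro (_ | x)
  · rfl
  · simpa [ForProg.up] using h x

theorem SameFlags.succ (φ : List Bool) (a : Bool) : SameFlags φ (a :: φ) Nat.succ := fun _ => rfl

theorem IsLabelTest.ren_iff {φ φ' : List Bool} {l : ℕ → ℕ} (h : SameFlags φ φ' l) (p : ℕ → ℕ)
    (c : CExpr D) (o : OExpr D) : IsLabelTest φ' c (o.ren l p) ↔ IsLabelTest φ c o := by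
  cases o with
  | var x =>
      have hx := h x
      simp only [List.getD_eq_getElem?_getD] at hx
      simp [IsLabelTest, OExpr.ren, hx]
  | _ => simp [IsLabelTest, OExpr.ren]

@[simp] theorem Args.poss_rewrite (R : Rules D) (φ : List Bool) : ∀ as : Args D,
    (as.rewrite R φ).poss = as.poss
  | .nil => rfl
  | .cons _ _ as => by simp [Args.rewrite, Args.poss, Args.poss_rewrite R φ as]

@[simp] theorem Args.exprs_rewrite (R : Rules D) (φ : List Bool) : ∀ as : Args D,
    (as.rewrite R φ).exprs = as.exprs.map (OExpr.rewrite R φ)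
  | .nil => rfl
  | .cons _ _ as => by simp [Args.rewrite, Args.exprs, Args.exprs_rewrite R φ as]

/-- The rules commute with the renamings of list and position variables, in programs where the
functions have the types `F`. -/
structure Rules.Natural (R : Rules D) (F : List Sig) : Prop where
  litEq : ∀ (φ φ' : List Bool) (l p : ℕ → ℕ) (c : CExpr D) (o : OExpr D), SameFlags φ φ' l →
    R.litEq φ' c (o.ren l p) = (R.litEq φ c o).ren l p id := by intros; rfl
  bcall : ∀ (l p : ℕ → ℕ) (f : ℕ) (as : Args D) (ps : List (ℕ × ℕ)), F[f]? = some ⟨ps, .bool⟩ →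
    as.exprs.length = ps.length → as.poss.length = (ps.map Prod.snd).sum →
    R.bcall f (as.ren l p) = (R.bcall f as).ren l p id := by intros; rfl
  const : ∀ (l p : ℕ → ℕ) (c : CExpr D), R.const c = (R.const c).ren l p := by intros; rfl
  list : ∀ (l p : ℕ → ℕ) (n : ℕ) (es : OExprs D),
    R.list n (es.ren l p) = (R.list n es).ren l p := by intros; rfl
  ocall : ∀ (l p : ℕ → ℕ) (f : ℕ) (as : Args D) (ps : List (ℕ × ℕ)) (n : ℕ),
    F[f]? = some ⟨ps, .out n⟩ →
    as.exprs.length = ps.length → as.poss.length = (ps.map Prod.snd).sum →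
    R.ocall f (as.ren l p) = (R.ocall f as).ren l p := by intros; rfl
  gen : ∀ (l p : ℕ → ℕ) (n : ℕ) (s : Stmt D),
    R.gen n (s.ren l p id) = (R.gen n s).ren l p := by intros; rfl
  ite : ∀ (l p : ℕ → ℕ) (e : BExpr D) (s t : Stmt D),
    R.ite (e.ren l p id) (s.ren l p id) (t.ren l p id) = (R.ite e s t).ren l p id := by intros; rfl
  yield : ∀ (l p : ℕ → ℕ) (o : OExpr D),
    R.yield (o.ren l p) = (R.yield o).ren l p id := by intros; rfl
  bret : ∀ (l p : ℕ → ℕ) (e : BExpr D),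
    R.bret (e.ren l p id) = (R.bret e).ren l p id := by intros; rfl
  letOut : ∀ (l p : ℕ → ℕ) (o : OExpr D) (s : Stmt D),
    R.letOut (o.ren l p) (s.ren (up l) p id) = (R.letOut o s).ren l p id := by intros; rfl
  seq : ∀ (l p : ℕ → ℕ) (s t : Stmt D),
    R.seq (s.ren l p id) (t.ren l p id) = (R.seq s t).ren l p id := by intros; rfl

mutual

theorem BExpr.HasType.rewrite_ren {R : Rules D} {F : List Sig} (hR : R.Natural F) {Γ : Ctx D}
    (hΓ : Γ.funs = F) {φ φ' : List Bool} {l : ℕ → ℕ} (h : SameFlags φ φ' l) (p : ℕ → ℕ) :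
    ∀ {e : BExpr D}, e.HasType Γ → (e.ren l p id).rewrite R φ' = (e.rewrite R φ).ren l p id
  | .tt, _ | .ff, _ | .bvar _, _ | .comp _ _ _, _ => rfl
  | .not e, he => congrArg BExpr.not (BExpr.HasType.rewrite_ren (e := e) hR hΓ h p he)
  | .bin _ _ _, he => by
      simp only [BExpr.rewrite, BExpr.ren]
      rw [BExpr.HasType.rewrite_ren hR hΓ h p he.1, BExpr.HasType.rewrite_ren hR hΓ h p he.2]
  | .litEq _ _, ⟨_, _, ho⟩ => by
      simp only [BExpr.rewrite, BExpr.ren]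
      rw [OExpr.HasType.rewrite_ren hR hΓ h p ho, hR.litEq _ _ _ _ _ _ h]
  | .call _ _, ⟨ps, hf, has⟩ => by
      simp only [BExpr.rewrite, BExpr.ren]
      rw [Args.HasType.rewrite_ren hR hΓ h p has]
      exact hR.bcall _ _ _ _ ps (hΓ ▸ hf) (by simp [has.length_exprs]) (by simp [has.length_poss])
  | .gen s, hs =>
      congrArg BExpr.gen (Stmt.HasType.rewrite_ren (Γ := Γ.hideBools) (s := s) hR hΓ h p hs)

theorem OExpr.HasType.rewrite_ren {R : Rules D} {F : List Sig} (hR : R.Natural F) {Γ : Ctx D}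
    (hΓ : Γ.funs = F) {φ φ' : List Bool} {l : ℕ → ℕ} (h : SameFlags φ φ' l) (p : ℕ → ℕ) :
    ∀ {o : OExpr D} {n : ℕ}, o.HasType Γ n → (o.ren l p).rewrite R φ' = (o.rewrite R φ).ren l p
  | .var _, _, _ => rfl
  | .const _, _, _ => hR.const _ _ _
  | .list _ _, _, ho => by
      simp only [OExpr.rewrite, OExpr.ren]
      rw [OExprs.HasType.rewrite_ren hR hΓ h p ho.2, hR.list]
  | .call _ _, _, ⟨ps, hf, has⟩ => by
      simp only [OExpr.rewrite, OExpr.ren]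
      rw [Args.HasType.rewrite_ren hR hΓ h p has]
      exact hR.ocall _ _ _ _ ps _ (hΓ ▸ hf) (by simp [has.length_exprs])
        (by simp [has.length_poss])
  | .gen _ _, _, ho => by
      simp only [OExpr.rewrite, OExpr.ren]
      rw [Stmt.HasType.rewrite_ren (Γ := Γ.hideBools) hR hΓ h p ho.2, hR.gen]

theorem OExprs.HasType.rewrite_ren {R : Rules D} {F : List Sig} (hR : R.Natural F) {Γ : Ctx D}
    (hΓ : Γ.funs = F) {φ φ' : List Bool} {l : ℕ → ℕ} (h : SameFlags φ φ' l) (p : ℕ → ℕ) :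
    ∀ {es : OExprs D} {n : ℕ}, es.HasType Γ n →
      (es.ren l p).rewrite R φ' = (es.rewrite R φ).ren l p
  | .nil, _, _ => rfl
  | .cons _ _, _, he => by
      simp only [OExprs.rewrite, OExprs.ren]
      rw [OExpr.HasType.rewrite_ren hR hΓ h p he.1, OExprs.HasType.rewrite_ren hR hΓ h p he.2]

theorem Args.HasType.rewrite_ren {R : Rules D} {F : List Sig} (hR : R.Natural F) {Γ : Ctx D}
    (hΓ : Γ.funs = F) {φ φ' : List Bool} {l : ℕ → ℕ} (h : SameFlags φ φ' l) (p : ℕ → ℕ) :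
    ∀ {as : Args D} {ps : List (ℕ × ℕ)}, as.HasType Γ ps →
      (as.ren l p).rewrite R φ' = (as.rewrite R φ).ren l p
  | .nil, _, _ => rfl
  | .cons _ _ _, _, ⟨_, _, _, ho, _, has⟩ => by
      simp only [Args.rewrite, Args.ren]
      rw [OExpr.HasType.rewrite_ren hR hΓ h p ho, Args.HasType.rewrite_ren hR hΓ h p has]

theorem Stmt.HasType.rewrite_ren {R : Rules D} {F : List Sig} (hR : R.Natural F) {Γ : Ctx D}
    (hΓ : Γ.funs = F) {φ φ' : List Bool} {l : ℕ → ℕ} (h : SameFlags φ φ' l) (p : ℕ → ℕ) :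
    ∀ {s : Stmt D} {τ : Ty}, s.HasType Γ τ →
      (s.ren l p id).rewrite R φ' = (s.rewrite R φ).ren l p id
  | .skip, _, _ | .setTrue _, _, _ => rfl
  | .ite _ _ _, _, hs => by
      simp only [Stmt.rewrite, Stmt.ren]
      rw [BExpr.HasType.rewrite_ren hR hΓ h p hs.1, Stmt.HasType.rewrite_ren hR hΓ h p hs.2.1,
        Stmt.HasType.rewrite_ren hR hΓ h p hs.2.2, hR.ite]
  | .yield _, _, ⟨_, _, ho⟩ => by
      simp only [Stmt.rewrite, Stmt.ren]
      rw [OExpr.HasType.rewrite_ren hR hΓ h p ho, hR.yield]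
  | .ret _, _, ⟨_, _, ho⟩ => congrArg Stmt.ret (OExpr.HasType.rewrite_ren hR hΓ h p ho)
  | .bret _, _, hs => by
      simp only [Stmt.rewrite, Stmt.ren]
      rw [BExpr.HasType.rewrite_ren hR hΓ h p hs.2, hR.bret]
  | .letOut _ _, _, ⟨n, ho, hs⟩ => by
      simp only [Stmt.rewrite, Stmt.ren]
      rw [OExpr.HasType.rewrite_ren hR hΓ h p ho,
        Stmt.HasType.rewrite_ren (Γ := Γ.addList n) hR hΓ (h.up false) p hs, hR.letOut]
  | .letBool s, _, hs => by
      simp only [Stmt.rewrite, Stmt.ren, up_id]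
      rw [Stmt.HasType.rewrite_ren (Γ := Γ.addBool) (s := s) hR hΓ h p hs]
  | .loop _ o _, _, ⟨n, ho, hs⟩ => by
      simp only [Stmt.rewrite, Stmt.ren]
      rw [OExpr.HasType.rewrite_ren hR hΓ h p ho,
        Stmt.HasType.rewrite_ren (Γ := Γ.addLoop o n) hR hΓ (h.up true) (up p) hs]
  | .seq _ _, _, hs => by
      simp only [Stmt.rewrite, Stmt.ren]
      rw [Stmt.HasType.rewrite_ren hR hΓ h p hs.1, Stmt.HasType.rewrite_ren hR hΓ h p hs.2,
        hR.seq]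

end

/-- The list expressions of the position types are well typed. -/
def Ctx.WT (Γ : Ctx D) : Prop := ∀ o ∈ Γ.poss, ∃ n, o.HasType Γ n

theorem Ctx.WT.hideBools {Γ : Ctx D} (h : Γ.WT) : Γ.hideBools.WT := fun o ho =>
  (h o ho).imp fun _ hn => hn.mono (fun _ _ => id) rfl rfl

theorem Ctx.WT.addBool {Γ : Ctx D} (h : Γ.WT) : Γ.addBool.WT := fun o ho =>
  (h o ho).imp fun _ hn => hn.mono (fun _ _ => id) rfl rfl

theorem Ctx.WT.addList {Γ : Ctx D} (h : Γ.WT) (n : ℕ) : (Γ.addList n).WT := by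
  intro o ho
  obtain ⟨o', ho', rfl⟩ := List.mem_map.1 ho
  exact (h o' ho').imp fun _ hn => hn.ren (Γ.ren_addList n)

theorem Ctx.WT.addLoop {Γ : Ctx D} (h : Γ.WT) {o : OExpr D} {n : ℕ} (ho : o.HasType Γ (n + 1)) :
    (Γ.addLoop o n).WT := by
  intro o₁ ho₁
  obtain ⟨o', ho', rfl⟩ := List.mem_map.1 ho₁
  have : ∃ n, o'.HasType Γ n := by
    rcases List.mem_cons.1 ho' with rfl | ho'
    · exact ⟨_, ho⟩
    · exact h o' ho'
  exact this.imp fun _ hn => hn.ren (Γ.ren_addLoop o n)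

/-- The context in which the rewritten terms are typed. -/
def Ctx.rw (R : Rules D) (φ : List Bool) (F : List Sig) (Γ : Ctx D) : Ctx D :=
  ⟨F, Γ.lists, Γ.poss.map (OExpr.rewrite R φ), Γ.bools⟩

theorem Ctx.rw_addList {R : Rules D} {Γ : Ctx D} (hR : R.Natural Γ.funs) (hΓ : Γ.WT)
    (φ : List Bool) (F : List Sig) (n : ℕ) (a : Bool) :
    (Γ.addList n).rw R (a :: φ) F = (Γ.rw R φ F).addList n := by
  simp only [Ctx.rw, Ctx.addList, List.map_map, Ctx.mk.injEq, true_and, and_true]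
  refine List.map_congr_left fun o ho => ?_
  obtain ⟨m, hm⟩ := hΓ o ho
  exact hm.rewrite_ren hR rfl (.succ φ a) id

theorem Ctx.rw_addLoop {R : Rules D} {Γ : Ctx D} (hR : R.Natural Γ.funs) (hΓ : Γ.WT)
    (φ : List Bool) (F : List Sig) {o : OExpr D} {n : ℕ} (ho : o.HasType Γ (n + 1)) (a : Bool) :
    (Γ.addLoop o n).rw R (a :: φ) F = (Γ.rw R φ F).addLoop (o.rewrite R φ) n := by
  simp only [Ctx.rw, Ctx.addLoop, List.map_cons, List.map_map, Ctx.mk.injEq, true_and, and_true,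
    List.cons.injEq]
  refine ⟨ho.rewrite_ren hR rfl (.succ φ a) Nat.succ, List.map_congr_left fun o ho => ?_⟩
  obtain ⟨m, hm⟩ := hΓ o ho
  exact hm.rewrite_ren hR rfl (.succ φ a) Nat.succ

/-- The rules preserve types, if the types of the functions change from `F` to `F'`. -/
structure Rules.Sound (R : Rules D) (F F' : List Sig) : Prop where
  litEq : ∀ (Γ : Ctx D) (φ : List Bool) (c : CExpr D) (o : OExpr D) (n : ℕ), Γ.funs = F' →
    c.HasDepth n → o.HasType Γ n → (R.litEq φ c o).HasType Γ := by
      intro _ _ _ _ n _ hc ho; exact ⟨n, hc, ho⟩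
  bcall : ∀ (Γ : Ctx D) (f : ℕ) (as : Args D) (ps : List (ℕ × ℕ)), Γ.funs = F' →
    F[f]? = some ⟨ps, .bool⟩ → as.HasType Γ ps → (R.bcall f as).HasType Γ := by
      rintro _ _ _ ps rfl hf has; exact ⟨ps, hf, has⟩
  const : ∀ (Γ : Ctx D) (c : CExpr D) (n : ℕ), Γ.funs = F' → c.HasDepth n →
    (R.const c).HasType Γ n := by intro _ _ _ _ hc; exact hc
  list : ∀ (Γ : Ctx D) (n : ℕ) (es : OExprs D), Γ.funs = F' → es.HasType Γ n →
    (R.list n es).HasType Γ (n + 1) := by intro _ _ _ _ hc; exact ⟨rfl, hc⟩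
  ocall : ∀ (Γ : Ctx D) (f : ℕ) (as : Args D) (ps : List (ℕ × ℕ)) (n : ℕ), Γ.funs = F' →
    F[f]? = some ⟨ps, .out n⟩ → as.HasType Γ ps → (R.ocall f as).HasType Γ n := by
      rintro _ _ _ ps _ rfl hf has; exact ⟨ps, hf, has⟩
  gen : ∀ (Γ : Ctx D) (n : ℕ) (s : Stmt D), Γ.funs = F' → s.HasType Γ.hideBools (.out n) →
    (R.gen n s).HasType Γ n := by intro _ _ _ _ hc; exact ⟨rfl, hc⟩
  ite : ∀ (Γ : Ctx D) (e : BExpr D) (s t : Stmt D) (τ : Ty), Γ.funs = F' → e.HasType Γ →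
    s.HasType Γ τ → t.HasType Γ τ → (R.ite e s t).HasType Γ τ := by
      intro _ _ _ _ _ _ he hs ht; exact ⟨he, hs, ht⟩
  yield : ∀ (Γ : Ctx D) (o : OExpr D) (n : ℕ), Γ.funs = F' → o.HasType Γ n →
    (R.yield o).HasType Γ (.out (n + 1)) := by intro _ _ n _ ho; exact ⟨n, rfl, ho⟩
  bret : ∀ (Γ : Ctx D) (e : BExpr D), Γ.funs = F' → e.HasType Γ →
    (R.bret e).HasType Γ .bool := by intro _ _ _ he; exact ⟨rfl, he⟩
  letOut : ∀ (Γ : Ctx D) (o : OExpr D) (n : ℕ) (s : Stmt D) (τ : Ty), Γ.funs = F' →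
    o.HasType Γ n → s.HasType (Γ.addList n) τ → (R.letOut o s).HasType Γ τ := by
      intro _ _ n _ _ _ ho hs; exact ⟨n, ho, hs⟩
  seq : ∀ (Γ : Ctx D) (s t : Stmt D) (τ : Ty), Γ.funs = F' →
    s.HasType Γ τ → t.HasType Γ τ → (R.seq s t).HasType Γ τ := by
      intro _ _ _ _ _ hs ht; exact ⟨hs, ht⟩

theorem Ctx.getElem?_rw_poss {R : Rules D} {φ : List Bool} {F : List Sig} {Γ : Ctx D} {i : ℕ}
    {o : OExpr D} (h : Γ.poss[i]? = some o) :
    (Γ.rw R φ F).poss[i]? = some (o.rewrite R φ) := by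
  simp [Ctx.rw, h]

mutual

theorem BExpr.HasType.rewrite {R : Rules D} {F F' : List Sig} (hR : R.Natural F)
    (hS : R.Sound F F') {Γ : Ctx D} (hF : Γ.funs = F) (hΓ : Γ.WT) {φ : List Bool} :
    ∀ {e : BExpr D}, e.HasType Γ → (e.rewrite R φ).HasType (Γ.rw R φ F')
  | .tt, _ | .ff, _ => trivial
  | .bvar _, he => he
  | .comp _ _ _, ⟨_, hi, hj⟩ => ⟨_, Ctx.getElem?_rw_poss hi, Ctx.getElem?_rw_poss hj⟩
  | .not e, he => BExpr.HasType.rewrite (e := e) hR hS hF hΓ he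
  | .bin _ _ _, he =>
      ⟨BExpr.HasType.rewrite hR hS hF hΓ he.1, BExpr.HasType.rewrite hR hS hF hΓ he.2⟩
  | .litEq _ _, ⟨n, hc, ho⟩ =>
      hS.litEq _ _ _ _ n rfl hc (OExpr.HasType.rewrite hR hS hF hΓ ho)
  | .call _ _, ⟨ps, hf, has⟩ =>
      hS.bcall _ _ _ ps rfl (hF ▸ hf) (Args.HasType.rewrite hR hS hF hΓ has)
  | .gen s, hs =>
      Stmt.HasType.rewrite (Γ := Γ.hideBools) (s := s) hR hS hF hΓ.hideBools hs

theorem OExpr.HasType.rewrite {R : Rules D} {F F' : List Sig} (hR : R.Natural F)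
    (hS : R.Sound F F') {Γ : Ctx D} (hF : Γ.funs = F) (hΓ : Γ.WT) {φ : List Bool} :
    ∀ {o : OExpr D} {n : ℕ}, o.HasType Γ n → (o.rewrite R φ).HasType (Γ.rw R φ F') n
  | .var _, _, ho => ho
  | .const _, _, ho => hS.const _ _ _ rfl ho
  | .list _ _, _, ⟨hn, ho⟩ => hn ▸ hS.list _ _ _ rfl (OExprs.HasType.rewrite hR hS hF hΓ ho)
  | .call _ _, _, ⟨ps, hf, has⟩ =>
      hS.ocall _ _ _ ps _ rfl (hF ▸ hf) (Args.HasType.rewrite hR hS hF hΓ has)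
  | .gen _ _, _, ⟨hn, hs⟩ => by
      subst hn
      exact hS.gen _ _ _ rfl
        (Stmt.HasType.rewrite (Γ := Γ.hideBools) hR hS hF hΓ.hideBools hs)

theorem OExprs.HasType.rewrite {R : Rules D} {F F' : List Sig} (hR : R.Natural F)
    (hS : R.Sound F F') {Γ : Ctx D} (hF : Γ.funs = F) (hΓ : Γ.WT) {φ : List Bool} :
    ∀ {es : OExprs D} {n : ℕ}, es.HasType Γ n → (es.rewrite R φ).HasType (Γ.rw R φ F') n
  | .nil, _, _ => trivial
  | .cons _ _, _, he =>
      ⟨OExpr.HasType.rewrite hR hS hF hΓ he.1, OExprs.HasType.rewrite hR hS hF hΓ he.2⟩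

theorem Args.HasType.rewrite {R : Rules D} {F F' : List Sig} (hR : R.Natural F)
    (hS : R.Sound F F') {Γ : Ctx D} (hF : Γ.funs = F) (hΓ : Γ.WT) {φ : List Bool} :
    ∀ {as : Args D} {ps : List (ℕ × ℕ)}, as.HasType Γ ps →
      (as.rewrite R φ).HasType (Γ.rw R φ F') ps
  | .nil, _, has => has
  | .cons _ _ _, _, ⟨n, ps', hps, ho, his, has⟩ =>
      ⟨n, ps', hps, OExpr.HasType.rewrite hR hS hF hΓ ho,
        fun i hi => Ctx.getElem?_rw_poss (his i hi), Args.HasType.rewrite hR hS hF hΓ has⟩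

theorem Stmt.HasType.rewrite {R : Rules D} {F F' : List Sig} (hR : R.Natural F)
    (hS : R.Sound F F') {Γ : Ctx D} (hF : Γ.funs = F) (hΓ : Γ.WT) {φ : List Bool} :
    ∀ {s : Stmt D} {τ : Ty}, s.HasType Γ τ → (s.rewrite R φ).HasType (Γ.rw R φ F') τ
  | .skip, _, _ => trivial
  | .setTrue _, _, hs => hs
  | .ite _ _ _, _, hs => hS.ite _ _ _ _ _ rfl (BExpr.HasType.rewrite hR hS hF hΓ hs.1)
      (Stmt.HasType.rewrite hR hS hF hΓ hs.2.1) (Stmt.HasType.rewrite hR hS hF hΓ hs.2.2)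
  | .yield _, _, ⟨_, hτ, ho⟩ =>
      hτ ▸ hS.yield _ _ _ rfl (OExpr.HasType.rewrite hR hS hF hΓ ho)
  | .ret _, _, ⟨n, hτ, ho⟩ => ⟨n, hτ, OExpr.HasType.rewrite hR hS hF hΓ ho⟩
  | .bret _, _, ⟨hτ, he⟩ => hτ ▸ hS.bret _ _ rfl (BExpr.HasType.rewrite hR hS hF hΓ he)
  | .letOut _ _, _, ⟨n, ho, hs⟩ => by
      refine hS.letOut _ _ n _ _ rfl (OExpr.HasType.rewrite hR hS hF hΓ ho) ?_
      have := Stmt.HasType.rewrite (Γ := Γ.addList n) (φ := false :: φ) hR hS hF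
        (hΓ.addList n) hs
      rwa [Ctx.rw_addList (hF ▸ hR) hΓ] at this
  | .letBool s, _, hs =>
      Stmt.HasType.rewrite (Γ := Γ.addBool) (s := s) hR hS hF hΓ.addBool hs
  | .loop _ o _, _, ⟨n, ho, hs⟩ => by
      refine ⟨n, OExpr.HasType.rewrite hR hS hF hΓ ho, ?_⟩
      have := Stmt.HasType.rewrite (Γ := Γ.addLoop o n) (φ := true :: φ) hR hS hF
        (hΓ.addLoop ho) hs
      rwa [Ctx.rw_addLoop (hF ▸ hR) hΓ φ F' ho] at this
  | .seq _ _, _, hs => hS.seq _ _ _ _ rfl (Stmt.HasType.rewrite hR hS hF hΓ hs.1)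
      (Stmt.HasType.rewrite hR hS hF hΓ hs.2)

end

theorem paramPoss_mem : ∀ {k : ℕ} {ps : List (ℕ × ℕ)} {o : OExpr D}, o ∈ paramPoss k ps →
    ∃ x < ps.length, o = .var (k + x)
  | _, [], _, h => by simp [paramPoss] at h
  | k, p :: ps, o, h => by
      rcases List.mem_append.1 h with h | h
      · exact ⟨0, by simp, (List.mem_replicate.1 h).2⟩
      · obtain ⟨x, hx, rfl⟩ := paramPoss_mem h
        exact ⟨x + 1, by simpa using hx, by congr 1; omega⟩

theorem bodyCtx_wt (F : List Sig) (ps : List (ℕ × ℕ)) : (bodyCtx (D := D) F ps).WT := by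
  intro o ho
  obtain ⟨x, hx, rfl⟩ := paramPoss_mem ho
  exact ⟨_, by simp [OExpr.HasType, bodyCtx, hx]; rfl⟩

theorem bodyCtx_rw (R : Rules D) (φ : List Bool) (F F' : List Sig) (ps : List (ℕ × ℕ)) :
    (bodyCtx F ps).rw R φ F' = bodyCtx F' ps := by
  simp only [bodyCtx, Ctx.rw, Ctx.mk.injEq, true_and, and_true]
  refine (List.map_congr_left fun o ho => ?_).trans (List.map_id _)
  obtain ⟨x, -, rfl⟩ := paramPoss_mem ho
  rfl

theorem Fn.WellTyped.mapBody_rewrite {R : Rules D} {F F' : List Sig} (hR : R.Natural F)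
    (hS : R.Sound F F') {f : Fn D} (hf : f.WellTyped F) :
    (f.mapBody (Stmt.rewrite R [])).WellTyped F' := by
  have := Stmt.HasType.rewrite (φ := []) hR hS rfl (bodyCtx_wt F f.params) hf
  rwa [bodyCtx_rw] at this

@[simp] theorem Fn.sig_mapBody (g : Stmt D → Stmt D) (f : Fn D) : (f.mapBody g).sig = f.sig := rfl

@[simp] theorem Fn.sig_comp_mapBody (g : Stmt D → Stmt D) : Fn.sig ∘ Fn.mapBody g = Fn.sig := rfl

theorem Prog.HasType.mapBody {P : Prog D} {σ : Sig} (hP : P.HasType σ) {g : Stmt D → Stmt D}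
    (hg : ∀ (F : List Sig) (f : Fn D), f ∈ P.funs → f.WellTyped F → (f.mapBody g).WellTyped F) :
    (P.mapBody g).HasType σ := by
  refine ⟨fun i f hf => ?_, ?_⟩
  · simp only [Prog.mapBody, List.getElem?_map, Option.map_eq_some_iff] at hf
    obtain ⟨f₀, hf₀, rfl⟩ := hf
    simpa [Prog.mapBody, ← List.map_take] using
      hg _ f₀ (List.mem_of_getElem? hf₀) (hP.1 i f₀ hf₀)
  · obtain ⟨f, hf, hσ⟩ := hP.2
    exact ⟨f.mapBody g, by simp [Prog.mapBody, hf], hσ⟩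

theorem Prog.HasType.mapBody_rewrite {P : Prog D} {σ : Sig} (hP : P.HasType σ) {R : Rules D}
    (hR : ∀ F, R.Natural F) (hS : ∀ F, R.Sound F F) :
    (P.mapBody (Stmt.rewrite R [])).HasType σ :=
  hP.mapBody fun F _ _ hf => hf.mapBody_rewrite (hR F) (hS F)

/-! ### Steps A and B preserve types -/

theorem eqArgs_ren (c : CExpr D) (o : OExpr D) (l p : ℕ → ℕ) :
    eqArgs c (o.ren l p) = (eqArgs c o).ren l p := by
  cases c <;> rfl

theorem litEqRules_natural (c : CExpr D) (F : List Sig) : (litEqRules c).Natural F where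
  litEq φ φ' l p c' o h := by
    have := IsLabelTest.ren_iff h p c' o
    simp only [litEqRules]
    split_ifs
    · simp [eqArgs_ren, BExpr.ren]
    · tauto
    · tauto
    · rfl

theorem litEqRules_sound (c : CExpr D) (F : List Sig) :
    (litEqRules c).Sound F ((eqFn c).sig :: F) where
  litEq Γ φ c' o n hΓ hc ho := by
    simp only [litEqRules]
    split_ifs with h
    · obtain ⟨rfl, -⟩ := h
      cases c' with
      | char a =>
        obtain rfl : n = 0 := hc
        exact ⟨[(1, 0)], by rw [hΓ]; rfl,
          1, [], rfl, ⟨rfl, ho, trivial⟩, by simp, rfl⟩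
      | list m cs =>
        obtain rfl : n = m + 1 := hc.1
        exact ⟨[(m + 1, 0)], by rw [hΓ]; rfl, m + 1, [], rfl, ho, by simp, rfl⟩
    · exact ⟨n, hc, ho⟩
  bcall := by rintro Γ f as ps hΓ hf has; exact ⟨ps, by rw [hΓ]; exact hf, has⟩
  ocall := by rintro Γ f as ps n hΓ hf has; exact ⟨ps, by rw [hΓ]; exact hf, has⟩

theorem eqStep_hasType {Γ : Ctx D} {n : ℕ} (hx : Γ.lists[0]? = some n) : ∀ (k : ℕ)
    (cs : List (CExpr D)), CExpr.AllDepth cs n → k + cs.length ≤ Γ.bools →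
    (eqStep k cs).HasType Γ .bool
  | _, [], _, _ => ⟨rfl, trivial⟩
  | k, c :: cs, hcs, hk => by
      simp only [CExpr.AllDepth, List.length_cons] at hcs hk
      have hk' : k < Γ.bools := by omega
      exact ⟨hk', eqStep_hasType hx (k + 1) cs hcs.2 (by omega), ⟨n, hcs.1, hx⟩, hk', rfl, trivial⟩

/-- The same context, with `k` boolean variables. -/
def Ctx.withBools (Γ : Ctx D) (k : ℕ) : Ctx D := { Γ with bools := k }

theorem letBools_hasType {s : Stmt D} {τ : Ty} : ∀ {k : ℕ} {Γ : Ctx D},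
    (letBools k s).HasType Γ τ ↔ s.HasType (Γ.withBools (Γ.bools + k)) τ
  | 0, _ => Iff.rfl
  | k + 1, Γ => by
      have : Γ.addBool.withBools (Γ.addBool.bools + k) = Γ.withBools (Γ.bools + (k + 1)) := by
        simp only [Ctx.addBool, Ctx.withBools]; congr 1; omega
      rw [← this]
      exact letBools_hasType (k := k) (Γ := Γ.addBool)

theorem eqFn_wellTyped {c : CExpr D} {n : ℕ} (hc : c.HasDepth n) (F : List Sig) :
    (eqFn c).WellTyped F := by
  cases c with
  | char a => exact ⟨⟨0, rfl, ⟨0, rfl, rfl⟩, ⟨rfl, trivial⟩, trivial⟩, rfl, trivial⟩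
  | list m cs =>
    refine letBools_hasType.2 ⟨⟨m, rfl, ?_⟩, rfl, ?_⟩
    · exact eqStep_hasType rfl 0 cs hc.2 (by simp [Ctx.addLoop, Ctx.withBools])
    · split_ifs with h
      · trivial
      · simp only [BExpr.HasType, Ctx.withBools]
        omega

theorem Prog.HasType.cons_fn {P : Prog D} {σ : Sig} (hP : P.HasType σ) {R : Rules D} {g : Fn D}
    (hg : g.WellTyped []) (hR : ∀ F, R.Natural F) (hS : ∀ F, R.Sound F (g.sig :: F)) :
    Prog.HasType ⟨g :: P.funs.map (Fn.mapBody (Stmt.rewrite R [])), P.main + 1⟩ σ := by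
  refine ⟨fun i f hf => ?_, ?_⟩
  · cases i with
    | zero => simp at hf; subst hf; simpa using hg
    | succ i =>
      simp only [List.getElem?_cons_succ, List.getElem?_map, Option.map_eq_some_iff] at hf
      obtain ⟨f₀, hf₀, rfl⟩ := hf
      simpa [← List.map_take] using (hP.1 i f₀ hf₀).mapBody_rewrite (hR _) (hS _)
  · obtain ⟨f, hf, hσ⟩ := hP.2
    exact ⟨f.mapBody _, by simpa using ⟨f, hf, rfl⟩, hσ⟩

theorem litRules_natural (c : CExpr D) (F : List Sig) : (litRules c).Natural F where
  const l p c' := by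
    simp only [litRules]
    split_ifs <;> rfl

theorem litRules_sound (n : ℕ) (cs : List (CExpr D)) (F : List Sig) :
    (litRules (.list n cs)).Sound F (⟨[], .out (n + 1)⟩ :: F) where
  const Γ c' m hΓ hc := by
    simp only [litRules]
    split_ifs with h
    · subst h
      obtain rfl : m = n + 1 := hc.1
      exact ⟨[], by rw [hΓ]; rfl, rfl⟩
    · exact hc
  bcall := by rintro Γ f as ps hΓ hf has; exact ⟨ps, by rw [hΓ]; exact hf, has⟩
  ocall := by rintro Γ f as ps n hΓ hf has; exact ⟨ps, by rw [hΓ]; exact hf, has⟩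

theorem yieldConsts_hasType {Γ : Ctx D} {n : ℕ} : ∀ {cs : List (CExpr D)},
    CExpr.AllDepth cs n → (yieldConsts cs).HasType Γ (.out (n + 1))
  | [], _ => trivial
  | _ :: _, h => ⟨⟨n, rfl, h.1⟩, yieldConsts_hasType h.2⟩

theorem yieldExprs_hasType {Γ : Ctx D} {n : ℕ} : ∀ {es : OExprs D},
    es.HasType Γ n → (yieldExprs es).HasType Γ (.out (n + 1))
  | .nil, _ => trivial
  | .cons _ _, h => ⟨⟨n, rfl, h.1⟩, yieldExprs_hasType h.2⟩

theorem yieldExprs_ren (l p : ℕ → ℕ) : ∀ es : OExprs D,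
    yieldExprs (es.ren l p) = (yieldExprs es).ren l p id
  | .nil => rfl
  | .cons e es => by
      simp only [OExprs.ren, yieldExprs, Stmt.ren]
      rw [yieldExprs_ren l p es]

theorem OExprs.HasType.hideBools {Γ : Ctx D} {n : ℕ} : ∀ {es : OExprs D},
    es.HasType Γ n → es.HasType Γ.hideBools n
  | .nil, _ => trivial
  | .cons _ _, h => ⟨h.1.mono (fun _ _ => id) rfl rfl, OExprs.HasType.hideBools h.2⟩

theorem listRules_natural (F : List Sig) : (listRules (D := D)).Natural F where
  list l p n es := by simp only [listRules, OExpr.ren, yieldExprs_ren]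

theorem listRules_sound (F : List Sig) : (listRules (D := D)).Sound F F where
  list _ _ _ _ h := ⟨rfl, yieldExprs_hasType h.hideBools⟩

/-! ### Step C preserves types -/

theorem inlineRules_natural (j : ℕ) {f : Fn D} {F₀ F : List Sig} (hf : f.WellTyped F₀)
    (hF : ∀ σ, F[j]? = some σ → σ = f.sig) : (inlineRules j f).Natural F where
  bcall l p i as ps hi h₁ h₂ := by
    simp only [inlineRules]
    split_ifs with h
    · subst h
      obtain rfl : ps = f.params := congrArg Sig.params (hF _ hi)
      exact congrArg BExpr.gen (Stmt.HasType.ren_instantiate hf h₁ h₂ l p).symm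
    · rfl
    · rfl
  ocall l p i as ps n hi h₁ h₂ := by
    simp only [inlineRules]
    split_ifs with h
    · subst h
      obtain rfl : ps = f.params := congrArg Sig.params (hF _ hi)
      obtain h' : Ty.out n = f.ret := congrArg Sig.ret (hF _ hi)
      rw [← h']
      exact congrArg (OExpr.gen n) (Stmt.HasType.ren_instantiate hf h₁ h₂ l p).symm
    · rfl
    · rfl

theorem getElem?_eraseIdx_shift {α : Type*} (F : List α) {i j : ℕ} (h : i ≠ j) :
    (F.eraseIdx j)[if j < i then i - 1 else i]? = F[i]? := by
  rw [List.getElem?_eraseIdx]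
  split_ifs with h₁ h₂ h₂
  · omega
  · congr 1; omega
  · rfl
  · omega

theorem Stmt.HasType.inline {j : ℕ} {f : Fn D} {F : List Sig} {τ : Ty}
    (hf : f.WellTyped (F.take j)) (hτ : f.ret = τ) {Γ : Ctx D} (hΓ : Γ.funs = F.eraseIdx j)
    {as : Args D} (has : as.HasType Γ f.params) :
    (f.body.instantiate as).HasType Γ.hideBools τ := by
  subst hτ
  have has' : as.HasType Γ.hideBools f.params := has.mono (fun _ _ => id) rfl rfl
  refine Stmt.HasType.instantiate hf has' fun k σ hk => ?_
  rw [List.getElem?_take] at hk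
  split_ifs at hk with hkj
  simpa [Ctx.hideBools, hΓ, List.getElem?_eraseIdx, hkj] using hk

theorem inlineRules_sound (j : ℕ) {f : Fn D} {F₀ F : List Sig} (hf : f.WellTyped F₀)
    (hF : ∀ σ, F[j]? = some σ → σ = f.sig ∧ F₀ = F.take j) :
    (inlineRules j f).Sound F (F.eraseIdx j) where
  bcall Γ i as ps hΓ hi has := by
    simp only [inlineRules]
    by_cases h : i = j
    · subst h
      obtain ⟨hσ, rfl⟩ := hF _ hi
      obtain rfl : ps = f.params := congrArg Sig.params hσ
      rw [if_pos rfl]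
      exact Stmt.HasType.inline hf (congrArg Sig.ret hσ).symm hΓ has
    · rw [if_neg h]
      exact ⟨ps, by rw [hΓ, getElem?_eraseIdx_shift _ h]; exact hi, has⟩
  ocall Γ i as ps n hΓ hi has := by
    simp only [inlineRules]
    by_cases h : i = j
    · subst h
      obtain ⟨hσ, rfl⟩ := hF _ hi
      obtain rfl : ps = f.params := congrArg Sig.params hσ
      have hτ : f.ret = .out n := (congrArg Sig.ret hσ).symm
      rw [if_pos rfl, hτ]
      exact ⟨rfl, Stmt.HasType.inline hf hτ hΓ has⟩
    · rw [if_neg h]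
      exact ⟨ps, by rw [hΓ, getElem?_eraseIdx_shift _ h]; exact hi, has⟩

theorem eraseIdx_take {α : Type*} (l : List α) (i j : ℕ) :
    (l.eraseIdx j).take i = (l.take (if i < j then i else i + 1)).eraseIdx j := by
  refine List.ext_getElem? fun k => ?_
  simp only [List.getElem?_take, List.getElem?_eraseIdx]
  split_ifs <;> first | rfl | omega

theorem inlineFn_hasType {P : Prog D} {σ : Sig} (hP : P.HasType σ) {j : ℕ} {f : Fn D}
    (hf : P.funs[j]? = some f) (hj : j ≠ P.main) : (inlineFn j f P).HasType σ := by
  refine ⟨fun i g hg => ?_, ?_⟩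
  · simp only [inlineFn, List.getElem?_map, Option.map_eq_some_iff] at hg
    obtain ⟨g₀, hg₀, rfl⟩ := hg
    set i' := if i < j then i else i + 1 with hi'
    have hg₁ : P.funs[i']? = some g₀ := by
      rw [List.getElem?_eraseIdx] at hg₀
      rw [hi']; split_ifs at hg₀ ⊢ <;> exact hg₀
    have hsig : ((inlineFn j f P).funs.take i).map Fn.sig =
        ((P.funs.take i').map Fn.sig).eraseIdx j := by
      simp only [inlineFn, ← List.map_take, List.map_map, Fn.sig_comp_mapBody, eraseIdx_take,
        List.eraseIdx_map, ← hi']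
    rw [hsig]
    have key : ∀ τ, ((P.funs.take i').map Fn.sig)[j]? = some τ → τ = f.sig ∧
        (P.funs.take j).map Fn.sig = ((P.funs.take i').map Fn.sig).take j := by
      intro τ hτ
      have hlt := lt_of_getElem?_eq_some hτ
      simp only [List.length_map, List.length_take, lt_min_iff] at hlt
      refine ⟨?_, ?_⟩
      · simp [hlt.1, hf] at hτ
        exact hτ.symm
      · rw [← List.map_take, List.take_take, min_eq_left hlt.1.le]
    exact (hP.1 i' g₀ hg₁).mapBody_rewrite
      (inlineRules_natural j (hP.1 j f hf) fun τ hτ => (key τ hτ).1)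
      (inlineRules_sound j (hP.1 j f hf) key)
  · obtain ⟨g, hg, hσ⟩ := hP.2
    refine ⟨g.mapBody (Stmt.rewrite (inlineRules j f) []), ?_, hσ⟩
    simp only [inlineFn, List.getElem?_map, getElem?_eraseIdx_shift _ hj.symm, hg, Option.map_some]

/-! ### Step D preserves types -/

theorem BExpr.hasGen_ren (l p b : ℕ → ℕ) : ∀ e : BExpr D, (e.ren l p b).hasGen = e.hasGen
  | .tt | .ff | .bvar _ | .comp _ _ _ | .litEq _ _ | .call _ _ | .gen _ => rfl
  | .not e => BExpr.hasGen_ren l p b e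
  | .bin _ e₁ e₂ => by simp [BExpr.ren, BExpr.hasGen, hasGen_ren l p b e₁, hasGen_ren l p b e₂]

theorem Stmt.returnInto_ren : ∀ (s : Stmt D) (l p : ℕ → ℕ) (r b : ℕ),
    (s.ren l p id).returnInto r b = (s.returnInto r b).ren l p id
  | .skip, _, _, _, _ | .yield _, _, _, _, _ | .ret _, _, _, _, _ | .bret _, _, _, _, _
  | .setTrue _, _, _, _, _ => rfl
  | .ite _ s t, l, p, r, b => by
      simp [Stmt.ren, Stmt.returnInto, returnInto_ren s, returnInto_ren t]
  | .letOut _ s, l, p, r, b => by simp [Stmt.ren, Stmt.returnInto, returnInto_ren s]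
  | .letBool s, l, p, r, b => by simp [Stmt.ren, Stmt.returnInto, returnInto_ren s]
  | .loop _ _ s, l, p, r, b => by simp [Stmt.ren, Stmt.returnInto, returnInto_ren s]
  | .seq s t, l, p, r, b => by
      simp [Stmt.ren, Stmt.returnInto, returnInto_ren s, returnInto_ren t]

theorem BExpr.evalInto_ren (l p : ℕ → ℕ) : ∀ (e : BExpr D) (b k : ℕ),
    (e.ren l p id).evalInto b k = (e.evalInto b k).ren l p id
  | .tt, _, _ | .ff, _, _ | .bvar _, _, _ | .comp _ _ _, _, _ => by
      simp [BExpr.evalInto, BExpr.ren, Stmt.ren]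
  | .litEq _ _, _, _ => by simp [BExpr.evalInto, BExpr.ren, Stmt.ren, OExpr.ren_ren]
  | .call _ _, _, _ => by simp [BExpr.evalInto, BExpr.ren, Stmt.ren, Args.ren_ren]
  | .gen s, b, k => by simp [BExpr.evalInto, BExpr.ren, Stmt.ren, Stmt.returnInto_ren]
  | .not e, b, k => by
      simp only [BExpr.evalInto, BExpr.ren, BExpr.hasGen_ren]
      split_ifs <;> simp [Stmt.ren, evalInto_ren l p e, BExpr.ren, BExpr.ren_ren]
  | .bin _ e₁ e₂, b, k => by
      simp only [BExpr.evalInto, BExpr.ren, BExpr.hasGen_ren]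
      split_ifs <;>
        simp [Stmt.ren, evalInto_ren l p e₁, evalInto_ren l p e₂, BExpr.ren, BExpr.ren_ren]

theorem boolGenRules_natural (F : List Sig) : (boolGenRules (D := D)).Natural F where
  ite l p e s t := by
    simp only [boolGenRules, BExpr.hasGen_ren]
    split_ifs
    · simp [Stmt.ren, BExpr.ren, BExpr.evalInto_ren, Stmt.ren_ren]
    · rfl
  bret l p e := by
    simp only [boolGenRules, BExpr.hasGen_ren]
    split_ifs
    · simp [Stmt.ren, BExpr.ren, BExpr.evalInto_ren]
    · rfl

theorem BExpr.HasType.withBools {Γ : Ctx D} {e : BExpr D} (he : e.HasType Γ) {K : ℕ}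
    (h : Γ.bools ≤ K) : e.HasType (Γ.withBools K) :=
  he.mono (fun _ _ => id) rfl rfl h

theorem OExpr.HasType.withBools {Γ : Ctx D} {o : OExpr D} {n : ℕ} (ho : o.HasType Γ n) (K : ℕ) :
    o.HasType (Γ.withBools K) n :=
  ho.mono (fun _ _ => id) rfl rfl

theorem BExpr.HasType.ren_add {Γ : Ctx D} {e : BExpr D} (he : e.HasType Γ) {k K : ℕ}
    (h : Γ.bools + k ≤ K) : (e.ren id id (· + k)).HasType (Γ.withBools K) :=
  he.ren_bools rfl rfl rfl fun x hx => by simp only [Ctx.withBools]; omega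

theorem Stmt.HasType.returnInto : ∀ {s : Stmt D} {Γ : Ctx D} {K r b : ℕ} {τ : Ty},
    s.HasType Γ .bool → Γ.bools ≤ K → r < K → b < K →
      (s.returnInto r b).HasType (Γ.withBools K) τ
  | .skip, _, _, _, _, _, _, _, _, _ => trivial
  | .yield _, _, _, _, _, _, ⟨_, h, _⟩, _, _, _ | .ret _, _, _, _, _, _, ⟨_, h, _⟩, _, _, _ =>
      nomatch h
  | .bret _, _, _, _, _, _, h, hK, hr, hb =>
      ⟨hr, trivial, hr, h.2.withBools hK, hb, trivial⟩
  | .setTrue _, _, _, _, _, _, h, hK, _, _ => lt_of_lt_of_le h hK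
  | .ite _ _ _, _, _, _, _, _, h, hK, hr, hb =>
      ⟨h.1.withBools hK, h.2.1.returnInto hK hr hb, h.2.2.returnInto hK hr hb⟩
  | .letOut _ _, Γ, K, _, _, _, ⟨n, ho, hs⟩, hK, hr, hb =>
      ⟨n, ho.withBools K, hs.returnInto (Γ := Γ.addList n) hK hr hb⟩
  | .letBool s, Γ, K, _, _, _, hs, hK, hr, hb =>
      Stmt.HasType.returnInto (s := s) (Γ := Γ.addBool) (K := K + 1) hs (Nat.succ_le_succ hK)
        (Nat.succ_lt_succ hr) (Nat.succ_lt_succ hb)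
  | .loop _ o _, Γ, K, _, _, _, ⟨n, ho, hs⟩, hK, hr, hb =>
      ⟨n, ho.withBools K, hs.returnInto (Γ := Γ.addLoop o n) hK hr hb⟩
  | .seq _ _, _, _, _, _, _, h, hK, hr, hb =>
      ⟨h.1.returnInto hK hr hb, h.2.returnInto hK hr hb⟩

theorem BExpr.HasType.evalInto {Γ : Ctx D} {τ : Ty} : ∀ {e : BExpr D} {b k K : ℕ},
    e.HasType Γ → Γ.bools + k ≤ K → b < K → (e.evalInto b k).HasType (Γ.withBools K) τ
  | .tt, _, _, _, he, hK, hb | .ff, _, _, _, he, hK, hb | .bvar _, _, _, _, he, hK, hb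
  | .comp _ _ _, _, _, _, he, hK, hb | .litEq _ _, _, _, _, he, hK, hb
  | .call _ _, _, _, _, he, hK, hb => ⟨he.ren_add hK, hb, trivial⟩
  | .gen s, b, k, K, he, hK, hb =>
      Stmt.HasType.returnInto (s := s) (Γ := Γ.hideBools) (K := K + 1) he (Nat.zero_le _)
        (Nat.succ_pos _) (Nat.succ_lt_succ hb)
  | .not e, b, k, K, he, hK, hb => by
      simp only [BExpr.evalInto]
      split_ifs
      · exact ⟨BExpr.HasType.evalInto (Γ := Γ) (e := e) (K := K + 1) he (by omega) (by omega),
          Nat.succ_pos _, trivial, Nat.succ_lt_succ hb⟩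
      · exact ⟨BExpr.HasType.ren_add (e := .not e) he hK, hb, trivial⟩
  | .bin op e₁ e₂, b, k, K, he, hK, hb => by
      simp only [BExpr.evalInto]
      split_ifs
      · exact ⟨he.1.evalInto (K := K + 2) (by omega) (by omega),
          he.2.evalInto (K := K + 2) (by omega) (by omega),
          ⟨Nat.succ_lt_succ (Nat.succ_pos _), Nat.succ_pos _⟩,
          Nat.succ_lt_succ (Nat.succ_lt_succ hb), trivial⟩
      · exact ⟨BExpr.HasType.ren_add (e := .bin op e₁ e₂) he hK, hb, trivial⟩

theorem boolGenRules_sound (F : List Sig) : (boolGenRules (D := D)).Sound F F where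
  ite Γ e s t τ _ he hs ht := by
    simp only [boolGenRules]
    split_ifs
    · exact ⟨he.evalInto (K := Γ.bools + 1) le_rfl (Nat.succ_pos _), Nat.succ_pos _,
        hs.ren_bools rfl rfl rfl fun x hx => Nat.succ_lt_succ hx,
        ht.ren_bools rfl rfl rfl fun x hx => Nat.succ_lt_succ hx⟩
    · exact ⟨he, hs, ht⟩
  bret Γ e _ he := by
    simp only [boolGenRules]
    split_ifs
    · exact ⟨he.evalInto (K := Γ.bools + 1) le_rfl (Nat.succ_pos _), rfl, Nat.succ_pos _⟩
    · exact ⟨rfl, he⟩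

/-! ### Step E preserves types -/

theorem letOutRules_natural (F : List Sig) : (letOutRules (D := D)).Natural F where
  letOut l p o s := (s.ren_subst o l p).symm

theorem letOutRules_sound (F : List Sig) : (letOutRules (D := D)).Sound F F where
  letOut _ _ _ _ _ _ ho hs := hs.subst ho

/-! ### Step H preserves types -/

theorem letBools_ren (l p : ℕ → ℕ) (s : Stmt D) : ∀ k : ℕ,
    (letBools k s).ren l p id = letBools k (s.ren l p id)
  | 0 => rfl
  | k + 1 => by simp [letBools, Stmt.ren, letBools_ren l p s k]

theorem Stmt.splitBools_ren (l p : ℕ → ℕ) : ∀ (s : Stmt D) (b : ℕ → ℕ),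
    (s.ren l p b).splitBools = (s.splitBools.1, s.splitBools.2.ren l p (up^[s.splitBools.1] b))
  | .skip, _ | .yield _, _ | .ret _, _ | .bret _, _ | .setTrue _, _ | .ite _ _ _, _
  | .letOut _ _, _ | .loop _ _ _, _ | .seq _ _, _ => rfl
  | .letBool s, b => by simp [Stmt.ren, Stmt.splitBools, splitBools_ren l p s]

theorem up_iterate_id (k : ℕ) : up^[k] id = id := Function.iterate_fixed up_id k

theorem hoist₂_ren {c c' : ℕ → Stmt D → Stmt D → Stmt D} {l p : ℕ → ℕ}
    (hc : ∀ k s t, c' k (s.ren l p id) (t.ren l p id) = (c k s t).ren l p id) (s t : Stmt D) :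
    hoist₂ c' (s.ren l p id) (t.ren l p id) = (hoist₂ c s t).ren l p id := by
  simp only [hoist₂, Stmt.splitBools_ren, up_iterate_id, letBools_ren, ← hc, Stmt.ren_ren]
  rfl

theorem letBoolRules_natural (F : List Sig) : (letBoolRules (D := D)).Natural F where
  seq l p s t := by
    simp only [letBoolRules]
    exact hoist₂_ren (fun _ _ _ => rfl) s t
  ite l p e s t := by
    simp only [letBoolRules]
    exact hoist₂_ren (fun _ _ _ => by simp [Stmt.ren, BExpr.ren_ren]) s t
  letOut l p o s := by
    simp [letBoolRules, Stmt.splitBools_ren, up_iterate_id, letBools_ren, Stmt.ren]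

theorem Stmt.HasType.splitBools {τ : Ty} : ∀ {s : Stmt D} {Γ : Ctx D}, s.HasType Γ τ →
    s.splitBools.2.HasType (Γ.withBools (Γ.bools + s.splitBools.1)) τ
  | .skip, _, h | .yield _, _, h | .ret _, _, h | .bret _, _, h | .setTrue _, _, h
  | .ite _ _ _, _, h | .letOut _ _, _, h | .loop _ _ _, _, h | .seq _ _, _, h => h
  | .letBool s, Γ, h => by
      have := Stmt.HasType.splitBools (s := s) (Γ := Γ.addBool) h
      have h' : Γ.addBool.withBools (Γ.addBool.bools + s.splitBools.1) =
          Γ.withBools (Γ.bools + (s.splitBools.1 + 1)) := by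
        simp only [Ctx.addBool, Ctx.withBools]; congr 1; omega
      rwa [h'] at this

theorem hoist₂_hasType {c : ℕ → Stmt D → Stmt D → Stmt D} {Γ : Ctx D} {τ : Ty} {s t : Stmt D}
    (hc : ∀ k s t, s.HasType (Γ.withBools (Γ.bools + k)) τ →
      t.HasType (Γ.withBools (Γ.bools + k)) τ → (c k s t).HasType (Γ.withBools (Γ.bools + k)) τ)
    (hs : s.HasType Γ τ) (ht : t.HasType Γ τ) : (hoist₂ c s t).HasType Γ τ := by
  refine letBools_hasType.2 (hc _ _ _ ?_ ?_)
  · refine hs.splitBools.ren_bools rfl rfl rfl fun x hx => ?_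
    simp only [Ctx.withBools, insertBools] at hx ⊢
    split_ifs <;> omega
  · refine ht.splitBools.ren_bools rfl rfl rfl fun x hx => ?_
    simp only [Ctx.withBools] at hx ⊢
    omega

theorem letBoolRules_sound (F : List Sig) : (letBoolRules (D := D)).Sound F F where
  seq _ _ _ _ _ hs ht := by
    simp only [letBoolRules]
    exact hoist₂_hasType (fun _ _ _ hs ht => ⟨hs, ht⟩) hs ht
  ite _ _ _ _ _ _ he hs ht := by
    simp only [letBoolRules]
    exact hoist₂_hasType (fun _ _ _ hs ht => ⟨he.ren_add le_rfl, hs, ht⟩) hs ht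
  letOut Γ o n s τ _ ho hs :=
    letBools_hasType.2 ⟨n, ho.withBools _, Stmt.HasType.splitBools (Γ := Γ.addList n) hs⟩

/-! ### Terms without redexes -/

mutual

/-- The term has no redex of the step `X`; for `X = C`, it contains no function calls. -/
def BExpr.No (X : Pass) (φ : List Bool) : BExpr D → Prop
  | .not e => e.No X φ
  | .bin _ e₁ e₂ => e₁.No X φ ∧ e₂.No X φ
  | .litEq c o => (X = .A → IsLabelTest φ c o) ∧ o.No X φ
  | .call _ as => X ≠ .C ∧ as.No X φ
  | .gen s => X ≠ .D ∧ s.No X φ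
  | _ => True

/-- List expressions without redexes. -/
def OExpr.No (X : Pass) (φ : List Bool) : OExpr D → Prop
  | .var _ => True
  | .const c => X = .B → ∃ a, c = .char a
  | .list _ es => X ≠ .B ∧ es.No X φ
  | .call _ as => X ≠ .C ∧ as.No X φ
  | .gen n s => (X = .F → n ≠ 0) ∧ s.No X φ

/-- Sequences of list expressions without redexes. -/
def OExprs.No (X : Pass) (φ : List Bool) : OExprs D → Prop
  | .nil => True
  | .cons e es => e.No X φ ∧ es.No X φ

/-- Arguments without redexes. -/
def Args.No (X : Pass) (φ : List Bool) : Args D → Prop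
  | .nil => True
  | .cons e _ as => e.No X φ ∧ as.No X φ

/-- Statements without redexes. -/
def Stmt.No (X : Pass) (φ : List Bool) : Stmt D → Prop
  | .skip => True
  | .ite e s t => (X = .H → ¬ s.IsLetBool ∧ ¬ t.IsLetBool) ∧ e.No X φ ∧ s.No X φ ∧ t.No X φ
  | .yield o => o.No X φ
  | .ret o => X ≠ .F ∧ o.No X φ
  | .bret e => e.No X φ
  | .letOut o s => (X ≠ .E ∧ (X = .H → ¬ s.IsLetBool)) ∧ o.No X φ ∧ s.No X (false :: φ)
  | .letBool s => s.No X φ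
  | .setTrue _ => True
  | .loop _ o s => (X = .G → ∃ x, o = .var x) ∧ o.No X φ ∧ s.No X (true :: φ)
  | .seq s t => (X = .H → ¬ s.IsLetBool ∧ ¬ t.IsLetBool) ∧ s.No X φ ∧ t.No X φ

end

/-- The redexes of the step `X`; for `X = C`, the function calls. -/
def Bad (X : Pass) (φ : List Bool) : Node D → Prop
  | .b (.litEq c o) => X = .A ∧ ¬ IsLabelTest φ c o
  | .b (.call _ _) => X = .C
  | .b (.gen _) => X = .D
  | .o (.const (.list _ _)) => X = .B
  | .o (.list _ _) => X = .B
  | .o (.call _ _) => X = .C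
  | .o (.gen n _) => X = .F ∧ n = 0
  | .s (.ite _ s t) => X = .H ∧ (s.IsLetBool ∨ t.IsLetBool)
  | .s (.ret _) => X = .F
  | .s (.letOut _ s) => X = .E ∨ X = .H ∧ s.IsLetBool
  | .s (.loop _ o _) => X = .G ∧ ∀ x, o ≠ .var x
  | .s (.seq s t) => X = .H ∧ (s.IsLetBool ∨ t.IsLetBool)
  | _ => False

theorem bad_iff_isRedex {X : Pass} (hX : 3 ≤ X.num) (φ : List Bool) (n : Node D) :
    Bad X φ n ↔ IsRedex X n := by
  rcases n with e | o | s
  · cases e <;> cases X <;> simp [Pass.num] at hX <;> simp [Bad.eq_def, IsRedex.eq_def]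
  · rcases o with _ | c | _ | _ | n
    case const => cases c <;> cases X <;> simp [Pass.num] at hX <;>
      simp [Bad.eq_def, IsRedex.eq_def]
    case gen => cases n <;> cases X <;> simp [Pass.num] at hX <;>
      simp [Bad.eq_def, IsRedex.eq_def]
    all_goals cases X <;> simp [Pass.num] at hX <;> simp [Bad.eq_def, IsRedex.eq_def]
  · cases s <;> cases X <;> simp [Pass.num] at hX <;> simp [Bad.eq_def, IsRedex.eq_def]

mutual

theorem BExpr.no_iff {X : Pass} : ∀ {φ : List Bool} {e : BExpr D},
    e.No X φ ↔ ∀ n ∈ e.nodes φ, ¬ Bad X n.1 n.2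
  | φ, .tt | φ, .ff | φ, .bvar _ | φ, .comp _ _ _ => by
      simp [BExpr.No, BExpr.nodes, Bad]
  | φ, .not e => by
      simp only [BExpr.No, BExpr.no_iff (e := e), BExpr.nodes, List.forall_mem_cons]
      simp [Bad, imp_iff_not_or]
  | φ, .bin _ e₁ e₂ => by
      simp only [BExpr.No, BExpr.no_iff (e := e₁), BExpr.no_iff (e := e₂), BExpr.nodes,
        List.forall_mem_cons, List.forall_mem_append]
      simp [Bad, imp_iff_not_or]
  | φ, .litEq c o => by
      simp only [BExpr.No, OExpr.no_iff (o := o), BExpr.nodes, List.forall_mem_cons]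
      simp [Bad, imp_iff_not_or]
  | φ, .call _ as => by
      simp only [BExpr.No, Args.no_iff (as := as), BExpr.nodes, List.forall_mem_cons]
      simp [Bad, imp_iff_not_or]
  | φ, .gen s => by
      simp only [BExpr.No, Stmt.no_iff (s := s), BExpr.nodes, List.forall_mem_cons]
      simp [Bad, imp_iff_not_or]

theorem OExpr.no_iff {X : Pass} : ∀ {φ : List Bool} {o : OExpr D},
    o.No X φ ↔ ∀ n ∈ o.nodes φ, ¬ Bad X n.1 n.2
  | φ, .var _ => by simp [OExpr.No, OExpr.nodes, Bad]
  | φ, .const c => by cases c <;> simp [OExpr.No, OExpr.nodes, Bad]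
  | φ, .list _ es => by
      simp only [OExpr.No, OExprs.no_iff (es := es), OExpr.nodes, List.forall_mem_cons]
      simp [Bad, imp_iff_not_or]
  | φ, .call _ as => by
      simp only [OExpr.No, Args.no_iff (as := as), OExpr.nodes, List.forall_mem_cons]
      simp [Bad, imp_iff_not_or]
  | φ, .gen n s => by
      simp only [OExpr.No, Stmt.no_iff (s := s), OExpr.nodes, List.forall_mem_cons]
      simp [Bad, imp_iff_not_or]

theorem OExprs.no_iff {X : Pass} : ∀ {φ : List Bool} {es : OExprs D},
    es.No X φ ↔ ∀ n ∈ es.nodes φ, ¬ Bad X n.1 n.2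
  | φ, .nil => by simp [OExprs.No, OExprs.nodes]
  | φ, .cons e es => by
      simp only [OExprs.No, OExpr.no_iff (o := e), OExprs.no_iff (es := es), OExprs.nodes,
        List.forall_mem_append]

theorem Args.no_iff {X : Pass} : ∀ {φ : List Bool} {as : Args D},
    as.No X φ ↔ ∀ n ∈ as.nodes φ, ¬ Bad X n.1 n.2
  | φ, .nil => by simp [Args.No, Args.nodes]
  | φ, .cons e _ as => by
      simp only [Args.No, OExpr.no_iff (o := e), Args.no_iff (as := as), Args.nodes,
        List.forall_mem_append]

theorem Stmt.no_iff {X : Pass} : ∀ {φ : List Bool} {s : Stmt D},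
    s.No X φ ↔ ∀ n ∈ s.nodes φ, ¬ Bad X n.1 n.2
  | φ, .skip | φ, .setTrue _ => by simp [Stmt.No, Stmt.nodes, Bad]
  | φ, .ite e s t => by
      simp only [Stmt.No, BExpr.no_iff (e := e), Stmt.no_iff (s := s), Stmt.no_iff (s := t),
        Stmt.nodes, List.forall_mem_cons, List.forall_mem_append]
      simp [Bad, imp_iff_not_or, and_assoc]
  | φ, .yield o | φ, .ret o => by
      simp only [Stmt.No, OExpr.no_iff (o := o), Stmt.nodes, List.forall_mem_cons]
      simp [Bad, imp_iff_not_or]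
  | φ, .bret e => by
      simp only [Stmt.No, BExpr.no_iff (e := e), Stmt.nodes, List.forall_mem_cons]
      simp [Bad, imp_iff_not_or]
  | φ, .letOut o s => by
      simp only [Stmt.No, OExpr.no_iff (o := o), Stmt.no_iff (s := s), Stmt.nodes,
        List.forall_mem_cons, List.forall_mem_append]
      simp [Bad, imp_iff_not_or]
  | φ, .letBool s => by
      simp only [Stmt.No, Stmt.no_iff (s := s), Stmt.nodes, List.forall_mem_cons]
      simp [Bad, imp_iff_not_or]
  | φ, .loop _ o s => by
      simp only [Stmt.No, OExpr.no_iff (o := o), Stmt.no_iff (s := s), Stmt.nodes,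
        List.forall_mem_cons, List.forall_mem_append]
      simp [Bad, imp_iff_not_or]
  | φ, .seq s t => by
      simp only [Stmt.No, Stmt.no_iff (s := s), Stmt.no_iff (s := t), Stmt.nodes,
        List.forall_mem_cons, List.forall_mem_append]
      simp [Bad, imp_iff_not_or]

end

/-- No function body contains a redex of the step `X`. -/
def Prog.No (X : Pass) (P : Prog D) : Prop := ∀ f ∈ P.funs, f.body.No X []

theorem Prog.no_iff {X : Pass} {P : Prog D} : P.No X ↔ ∀ n ∈ P.nodes, ¬ Bad X n.1 n.2 := by
  simp only [Prog.No, Stmt.no_iff, Prog.nodes, List.mem_flatMap]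
  exact ⟨fun h n ⟨f, hf, hn⟩ => h f hf n hn, fun h f hf n hn => h n ⟨f, hf, hn⟩⟩

theorem not_hasRedex_iff {X : Pass} {P : Prog D} (hX : 3 ≤ X.num) : ¬ P.HasRedex X ↔ P.No X := by
  simp [Prog.no_iff, Prog.HasRedex, bad_iff_isRedex hX]

theorem irreducible_A_iff {P : Prog D} : Irreducible .A P ↔ P.No .A := by
  have : Irreducible .A P ↔ ∀ c, ¬ P.HasLitEq c :=
    ⟨fun h c hc => h _ (.litEq P c hc), by rintro h Q ⟨⟩; exact h _ ‹_›⟩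
  rw [this, Prog.no_iff]
  constructor
  · rintro h ⟨φ, n⟩ hn hb
    rcases n with (_ | _ | _ | _ | _ | _ | ⟨c, o⟩ | _ | _) | (_ | ⟨_ | _⟩ | _ | _ | _) | s
    case b.litEq => exact h c ⟨φ, o, hn, hb.2⟩
    case s => cases s <;> simp [Bad] at hb
    all_goals simp [Bad] at hb
  · rintro h c ⟨φ, o, hn, hb⟩
    exact h _ hn ⟨rfl, hb⟩

theorem irreducible_B_iff {P : Prog D} : Irreducible .B P ↔ P.No .B := by
  rw [Prog.no_iff]
  constructor
  · rintro h ⟨φ, n⟩ hn hb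
    rcases n with e | (_ | ⟨_ | _⟩ | _ | _ | _) | s
    case b => cases e <;> simp [Bad] at hb
    case s => cases s <;> simp [Bad] at hb
    case o.const.list => exact h _ (.lit P _ _ _ hn)
    case o.list => exact h _ (.list P _ _ _ hn)
    all_goals simp [Bad] at hb
  · intro h Q hQ
    cases hQ with
    | lit _ φ n cs hn => exact h _ hn rfl
    | list _ φ n es hn => exact h _ hn rfl

theorem irreducible_C_iff {P : Prog D} :
    Irreducible .C P ↔ ∀ j, j < P.funs.length → j = P.main := by
  constructor
  · intro h j hj
    by_contra hne
    exact h _ (.call P j _ (List.getElem?_eq_getElem hj) hne)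
  · rintro h Q ⟨⟩
    rename_i j f hf hne
    exact hne (h j (lt_of_getElem?_eq_some hf))

theorem irreducible_iff {X : Pass} {P : Prog D} (hX : X ≠ .C) : Irreducible X P ↔ P.No X := by
  cases X with
  | A => exact irreducible_A_iff
  | B => exact irreducible_B_iff
  | C => exact absurd rfl hX
  | D => exact ⟨fun h => (not_hasRedex_iff (by decide)).1 fun hr => h _ (.boolGen P hr),
      by rintro h Q ⟨⟩; exact (not_hasRedex_iff (by decide)).2 h ‹_›⟩
  | E => exact ⟨fun h => (not_hasRedex_iff (by decide)).1 fun hr => h _ (.letOut P hr),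
      by rintro h Q ⟨⟩; exact (not_hasRedex_iff (by decide)).2 h ‹_›⟩
  | F => exact ⟨fun h => (not_hasRedex_iff (by decide)).1 fun hr => h _ (.ret P hr),
      by rintro h Q ⟨⟩; exact (not_hasRedex_iff (by decide)).2 h ‹_›⟩
  | G => exact ⟨fun h => (not_hasRedex_iff (by decide)).1 fun hr => h _ (.forLoop P hr),
      by rintro h Q ⟨⟩; exact (not_hasRedex_iff (by decide)).2 h ‹_›⟩
  | H => exact ⟨fun h => (not_hasRedex_iff (by decide)).1 fun hr => h _ (.letBool P hr),
      by rintro h Q ⟨⟩; exact (not_hasRedex_iff (by decide)).2 h ‹_›⟩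

/-! ### Renaming and substitution create no redexes -/

theorem Stmt.isLetBool_ren {s : Stmt D} {l p b : ℕ → ℕ} :
    (s.ren l p b).IsLetBool ↔ s.IsLetBool := by
  cases s <;> simp [Stmt.ren, Stmt.IsLetBool]

theorem Stmt.isLetBool_sub {s : Stmt D} {σ : ℕ → OExpr D} {p : ℕ → ℕ} :
    (s.sub σ p).IsLetBool ↔ s.IsLetBool := by
  cases s <;> simp [Stmt.sub, Stmt.IsLetBool]

/-- The renaming `l` maps loop variables to loop variables. -/
def KeepsLoops (φ φ' : List Bool) (l : ℕ → ℕ) : Prop :=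
  ∀ x, φ.getD x false = true → φ'.getD (l x) false = true

theorem KeepsLoops.up {φ φ' : List Bool} {l : ℕ → ℕ} (h : KeepsLoops φ φ' l) (a : Bool) :
    KeepsLoops (a :: φ) (a :: φ') (up l) := by
  rintro (_ | x) hx
  · exact hx
  · exact h x hx

theorem KeepsLoops.id (φ : List Bool) : KeepsLoops φ φ id := fun _ h => h

theorem KeepsLoops.succ (φ : List Bool) (a : Bool) : KeepsLoops φ (a :: φ) Nat.succ :=
  fun _ h => h

mutual

theorem BExpr.No.ren {X : Pass} : ∀ {φ φ' : List Bool} {l p b : ℕ → ℕ} {e : BExpr D},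
    e.No X φ → KeepsLoops φ φ' l → (e.ren l p b).No X φ'
  | _, _, _, _, _, .tt, _, _ | _, _, _, _, _, .ff, _, _ | _, _, _, _, _, .bvar _, _, _
  | _, _, _, _, _, .comp _ _ _, _, _ => trivial
  | _, _, _, _, _, .not e, h, hl => BExpr.No.ren (e := e) h hl
  | _, _, _, _, _, .bin _ _ _, h, hl => ⟨h.1.ren hl, h.2.ren hl⟩
  | _, _, _, _, _, .litEq _ _, h, hl => ⟨fun hX => by
      obtain ⟨a, x, hc, ho, hx⟩ := h.1 hX
      exact ⟨a, _, hc, by rw [ho]; rfl, hl x hx⟩, h.2.ren hl⟩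
  | _, _, _, _, _, .call _ _, h, hl => ⟨h.1, h.2.ren hl⟩
  | _, _, _, _, _, .gen _, h, hl => ⟨h.1, h.2.ren hl⟩

theorem OExpr.No.ren {X : Pass} : ∀ {φ φ' : List Bool} {l p : ℕ → ℕ} {o : OExpr D},
    o.No X φ → KeepsLoops φ φ' l → (o.ren l p).No X φ'
  | _, _, _, _, .var _, _, _ => trivial
  | _, _, _, _, .const _, h, _ => h
  | _, _, _, _, .list _ _, h, hl => ⟨h.1, h.2.ren hl⟩
  | _, _, _, _, .call _ _, h, hl => ⟨h.1, h.2.ren hl⟩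
  | _, _, _, _, .gen _ _, h, hl => ⟨h.1, h.2.ren hl⟩

theorem OExprs.No.ren {X : Pass} : ∀ {φ φ' : List Bool} {l p : ℕ → ℕ} {es : OExprs D},
    es.No X φ → KeepsLoops φ φ' l → (es.ren l p).No X φ'
  | _, _, _, _, .nil, _, _ => trivial
  | _, _, _, _, .cons _ _, h, hl => ⟨h.1.ren hl, h.2.ren hl⟩

theorem Args.No.ren {X : Pass} : ∀ {φ φ' : List Bool} {l p : ℕ → ℕ} {as : Args D},
    as.No X φ → KeepsLoops φ φ' l → (as.ren l p).No X φ'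
  | _, _, _, _, .nil, _, _ => trivial
  | _, _, _, _, .cons _ _ _, h, hl => ⟨h.1.ren hl, h.2.ren hl⟩

theorem Stmt.No.ren {X : Pass} : ∀ {φ φ' : List Bool} {l p b : ℕ → ℕ} {s : Stmt D},
    s.No X φ → KeepsLoops φ φ' l → (s.ren l p b).No X φ'
  | _, _, _, _, _, .skip, _, _ | _, _, _, _, _, .setTrue _, _, _ => trivial
  | _, _, _, _, _, .ite _ _ _, h, hl =>
      ⟨fun hX => by simpa [Stmt.isLetBool_ren] using h.1 hX, h.2.1.ren hl, h.2.2.1.ren hl,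
        h.2.2.2.ren hl⟩
  | _, _, _, _, _, .yield o, h, hl => OExpr.No.ren (o := o) h hl
  | _, _, _, _, _, .ret _, h, hl => ⟨h.1, h.2.ren hl⟩
  | _, _, _, _, _, .bret e, h, hl => BExpr.No.ren (e := e) h hl
  | _, _, _, _, _, .letOut _ _, h, hl =>
      ⟨⟨h.1.1, fun hX => by simpa [Stmt.isLetBool_ren] using h.1.2 hX⟩, h.2.1.ren hl,
        h.2.2.ren (hl.up false)⟩
  | _, _, _, _, _, .letBool s, h, hl => Stmt.No.ren (s := s) h hl
  | _, _, _, _, _, .loop _ _ _, h, hl =>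
      ⟨fun hX => by obtain ⟨x, hx⟩ := h.1 hX; exact ⟨_, by rw [hx]; rfl⟩, h.2.1.ren hl,
        h.2.2.ren (hl.up true)⟩
  | _, _, _, _, _, .seq _ _, h, hl =>
      ⟨fun hX => by simpa [Stmt.isLetBool_ren] using h.1 hX, h.2.1.ren hl, h.2.2.ren hl⟩

end

/-- The substitution `σ` has no redexes and maps loop variables to loop variables. -/
structure NoSub (X : Pass) (φ φ' : List Bool) (σ : ℕ → OExpr D) : Prop where
  no : ∀ x, (σ x).No X φ'
  loops : ∀ x, φ.getD x false = true → ∃ y, σ x = .var y ∧ φ'.getD y false = true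

theorem NoSub.upLet {X : Pass} {φ φ' : List Bool} {σ : ℕ → OExpr D} (h : NoSub X φ φ' σ) :
    NoSub X (false :: φ) (false :: φ') (upLet σ) where
  no := by
    rintro (_ | x)
    · trivial
    · exact (h.no x).ren (.succ _ _)
  loops := by
    rintro (_ | x) hx
    · exact ⟨0, rfl, hx⟩
    · obtain ⟨y, hy, hy'⟩ := h.loops x hx
      exact ⟨y + 1, by simp [ForProg.upLet, hy, OExpr.ren], hy'⟩

theorem NoSub.upLoop {X : Pass} {φ φ' : List Bool} {σ : ℕ → OExpr D} (h : NoSub X φ φ' σ) :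
    NoSub X (true :: φ) (true :: φ') (upLoop σ) where
  no := by
    rintro (_ | x)
    · trivial
    · exact (h.no x).ren (.succ _ _)
  loops := by
    rintro (_ | x) hx
    · exact ⟨0, rfl, hx⟩
    · obtain ⟨y, hy, hy'⟩ := h.loops x hx
      exact ⟨y + 1, by simp [ForProg.upLoop, hy, OExpr.ren], hy'⟩

mutual

theorem BExpr.No.sub {X : Pass} (hG : X ≠ .G) :
    ∀ {φ φ' : List Bool} {σ : ℕ → OExpr D} {p : ℕ → ℕ} {e : BExpr D},
    e.No X φ → NoSub X φ φ' σ → (e.sub σ p).No X φ'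
  | _, _, _, _, .tt, _, _ | _, _, _, _, .ff, _, _ | _, _, _, _, .bvar _, _, _
  | _, _, _, _, .comp _ _ _, _, _ => trivial
  | _, _, _, _, .not e, h, hl => BExpr.No.sub (e := e) hG h hl
  | _, _, _, _, .bin _ _ _, h, hl => ⟨h.1.sub hG hl, h.2.sub hG hl⟩
  | _, _, _, _, .litEq _ _, h, hl => ⟨fun hX => by
      obtain ⟨a, x, hc, ho, hx⟩ := h.1 hX
      obtain ⟨y, hy, hy'⟩ := hl.loops x hx
      exact ⟨a, y, hc, by rw [ho]; exact hy, hy'⟩, h.2.sub hG hl⟩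
  | _, _, _, _, .call _ _, h, hl => ⟨h.1, h.2.sub hG hl⟩
  | _, _, _, _, .gen _, h, hl => ⟨h.1, h.2.sub hG hl⟩

theorem OExpr.No.sub {X : Pass} (hG : X ≠ .G) :
    ∀ {φ φ' : List Bool} {σ : ℕ → OExpr D} {p : ℕ → ℕ} {o : OExpr D},
    o.No X φ → NoSub X φ φ' σ → (o.sub σ p).No X φ'
  | _, _, _, _, .var x, _, hl => hl.no x
  | _, _, _, _, .const _, h, _ => h
  | _, _, _, _, .list _ _, h, hl => ⟨h.1, h.2.sub hG hl⟩
  | _, _, _, _, .call _ _, h, hl => ⟨h.1, h.2.sub hG hl⟩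
  | _, _, _, _, .gen _ _, h, hl => ⟨h.1, h.2.sub hG hl⟩

theorem OExprs.No.sub {X : Pass} (hG : X ≠ .G) :
    ∀ {φ φ' : List Bool} {σ : ℕ → OExpr D} {p : ℕ → ℕ} {es : OExprs D},
    es.No X φ → NoSub X φ φ' σ → (es.sub σ p).No X φ'
  | _, _, _, _, .nil, _, _ => trivial
  | _, _, _, _, .cons _ _, h, hl => ⟨h.1.sub hG hl, h.2.sub hG hl⟩

theorem Args.No.sub {X : Pass} (hG : X ≠ .G) :
    ∀ {φ φ' : List Bool} {σ : ℕ → OExpr D} {p : ℕ → ℕ} {as : Args D},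
    as.No X φ → NoSub X φ φ' σ → (as.sub σ p).No X φ'
  | _, _, _, _, .nil, _, _ => trivial
  | _, _, _, _, .cons _ _ _, h, hl => ⟨h.1.sub hG hl, h.2.sub hG hl⟩

theorem Stmt.No.sub {X : Pass} (hG : X ≠ .G) :
    ∀ {φ φ' : List Bool} {σ : ℕ → OExpr D} {p : ℕ → ℕ} {s : Stmt D},
    s.No X φ → NoSub X φ φ' σ → (s.sub σ p).No X φ'
  | _, _, _, _, .skip, _, _ | _, _, _, _, .setTrue _, _, _ => trivial
  | _, _, _, _, .ite _ _ _, h, hl =>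
      ⟨fun hX => by simpa [Stmt.isLetBool_sub] using h.1 hX, h.2.1.sub hG hl,
        h.2.2.1.sub hG hl, h.2.2.2.sub hG hl⟩
  | _, _, _, _, .yield o, h, hl => OExpr.No.sub (o := o) hG h hl
  | _, _, _, _, .ret _, h, hl => ⟨h.1, h.2.sub hG hl⟩
  | _, _, _, _, .bret e, h, hl => BExpr.No.sub (e := e) hG h hl
  | _, _, _, _, .letOut _ _, h, hl =>
      ⟨⟨h.1.1, fun hX => by simpa [Stmt.isLetBool_sub] using h.1.2 hX⟩, h.2.1.sub hG hl,
        h.2.2.sub hG hl.upLet⟩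
  | _, _, _, _, .letBool s, h, hl => Stmt.No.sub (s := s) hG h hl
  | _, _, _, _, .loop _ _ _, h, hl =>
      ⟨fun hX => absurd hX hG, h.2.1.sub hG hl, h.2.2.sub hG hl.upLoop⟩
  | _, _, _, _, .seq _ _, h, hl =>
      ⟨fun hX => by simpa [Stmt.isLetBool_sub] using h.1 hX, h.2.1.sub hG hl, h.2.2.sub hG hl⟩

end

theorem Stmt.No.subst {X : Pass} (hG : X ≠ .G) {φ : List Bool} {s : Stmt D} {o : OExpr D}
    (hs : s.No X (false :: φ)) (ho : o.No X φ) : (s.subst o).No X φ := by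
  refine hs.sub hG ⟨?_, ?_⟩
  · rintro (_ | x)
    · exact ho
    · trivial
  · rintro (_ | x) hx
    · cases hx
    · exact ⟨x, rfl, hx⟩

theorem Args.No.exprs {X : Pass} {φ : List Bool} : ∀ {as : Args D}, as.No X φ →
    ∀ o ∈ as.exprs, o.No X φ
  | .nil, _ => by simp [Args.exprs]
  | .cons _ _ _, h => by
      rintro o (_ | ⟨_, ho⟩)
      · exact h.1
      · exact h.2.exprs o ho

theorem Stmt.No.instantiate {X : Pass} (hG : X ≠ .G) {φ : List Bool} {s : Stmt D} {as : Args D}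
    (hs : s.No X []) (has : as.No X φ) : (s.instantiate as).No X φ := by
  refine hs.sub hG ⟨fun x => ?_, fun x hx => by simp at hx⟩
  rw [List.getD_eq_getElem?_getD]
  cases h : as.exprs[x]? with
  | none => trivial
  | some o => exact has.exprs o (List.mem_of_getElem? h)

/-! ### Rewriting creates no redexes -/

/-- The rules do not create redexes of the step `X`.  If `own` holds, they even remove them. -/
structure Rules.Keeps (R : Rules D) (X : Pass) (own : Prop) : Prop where
  litEq : ∀ (φ : List Bool) (c : CExpr D) (o : OExpr D),
    (¬ own → X = .A → IsLabelTest φ c o) → o.No X φ → (R.litEq φ c o).No X φ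
  bcall : ∀ (φ : List Bool) (f : ℕ) (as : Args D), (¬ own → X ≠ .C) → as.No X φ →
    (R.bcall f as).No X φ
  const : ∀ (φ : List Bool) (c : CExpr D), (¬ own → X = .B → ∃ a, c = .char a) →
    (R.const c).No X φ
  list : ∀ (φ : List Bool) (n : ℕ) (es : OExprs D), (¬ own → X ≠ .B) → es.No X φ →
    (R.list n es).No X φ
  ocall : ∀ (φ : List Bool) (f : ℕ) (as : Args D), (¬ own → X ≠ .C) → as.No X φ →
    (R.ocall f as).No X φ
  gen : ∀ (φ : List Bool) (n : ℕ) (s : Stmt D), (¬ own → X = .F → n ≠ 0) → s.No X φ →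
    (R.gen n s).No X φ
  ite : ∀ (φ : List Bool) (e : BExpr D) (s t : Stmt D), e.No X φ → s.No X φ → t.No X φ →
    (R.ite e s t).No X φ
  yield : ∀ (φ : List Bool) (o : OExpr D), o.No X φ → (R.yield o).No X φ
  bret : ∀ (φ : List Bool) (e : BExpr D), e.No X φ → (R.bret e).No X φ
  letOut : ∀ (φ : List Bool) (o : OExpr D) (s : Stmt D), (¬ own → X ≠ .E) → o.No X φ →
    s.No X (false :: φ) → (R.letOut o s).No X φ
  seq : ∀ (φ : List Bool) (s t : Stmt D), s.No X φ → t.No X φ → (R.seq s t).No X φ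

mutual

theorem BExpr.No.rewrite {R : Rules D} {X : Pass} {own : Prop} (hR : R.Keeps X own)
    (hX : own → X = .E ∨ X = .H) : ∀ {φ : List Bool} {e : BExpr D}, (¬ own → e.No X φ) →
      (e.rewrite R φ).No X φ
  | _, .tt, _ | _, .ff, _ | _, .bvar _, _ | _, .comp _ _ _, _ => trivial
  | _, .not e, h => BExpr.No.rewrite (e := e) hR hX h
  | _, .bin _ _ _, h => ⟨BExpr.No.rewrite hR hX fun hn => (h hn).1,
      BExpr.No.rewrite hR hX fun hn => (h hn).2⟩
  | φ, .litEq c o, h => by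
      refine hR.litEq φ c _ (fun hn hA => ?_) (OExpr.No.rewrite hR hX fun hn => (h hn).2)
      obtain ⟨a, x, hc, ho, hx⟩ := (h hn).1 hA
      exact ⟨a, x, hc, by rw [ho]; rfl, hx⟩
  | φ, .call _ _, h => hR.bcall φ _ _ (fun hn => (h hn).1)
      (Args.No.rewrite hR hX fun hn => (h hn).2)
  | φ, .gen _, h => by
      refine ⟨fun hD => ?_, Stmt.No.rewrite hR hX fun hn => (h hn).2⟩
      by_cases hn : own
      · rcases hX hn with h | h <;> simp [h] at hD
      · exact (h hn).1 hD

theorem OExpr.No.rewrite {R : Rules D} {X : Pass} {own : Prop} (hR : R.Keeps X own)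
    (hX : own → X = .E ∨ X = .H) : ∀ {φ : List Bool} {o : OExpr D}, (¬ own → o.No X φ) →
      (o.rewrite R φ).No X φ
  | _, .var _, _ => trivial
  | φ, .const _, h => hR.const φ _ h
  | φ, .list _ _, h => hR.list φ _ _ (fun hn => (h hn).1)
      (OExprs.No.rewrite hR hX fun hn => (h hn).2)
  | φ, .call _ _, h => hR.ocall φ _ _ (fun hn => (h hn).1)
      (Args.No.rewrite hR hX fun hn => (h hn).2)
  | φ, .gen _ _, h => hR.gen φ _ _ (fun hn => (h hn).1)
      (Stmt.No.rewrite hR hX fun hn => (h hn).2)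

theorem OExprs.No.rewrite {R : Rules D} {X : Pass} {own : Prop} (hR : R.Keeps X own)
    (hX : own → X = .E ∨ X = .H) : ∀ {φ : List Bool} {es : OExprs D}, (¬ own → es.No X φ) →
      (es.rewrite R φ).No X φ
  | _, .nil, _ => trivial
  | _, .cons _ _, h => ⟨OExpr.No.rewrite hR hX fun hn => (h hn).1,
      OExprs.No.rewrite hR hX fun hn => (h hn).2⟩

theorem Args.No.rewrite {R : Rules D} {X : Pass} {own : Prop} (hR : R.Keeps X own)
    (hX : own → X = .E ∨ X = .H) : ∀ {φ : List Bool} {as : Args D}, (¬ own → as.No X φ) →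
      (as.rewrite R φ).No X φ
  | _, .nil, _ => trivial
  | _, .cons _ _ _, h => ⟨OExpr.No.rewrite hR hX fun hn => (h hn).1,
      Args.No.rewrite hR hX fun hn => (h hn).2⟩

theorem Stmt.No.rewrite {R : Rules D} {X : Pass} {own : Prop} (hR : R.Keeps X own)
    (hX : own → X = .E ∨ X = .H) : ∀ {φ : List Bool} {s : Stmt D}, (¬ own → s.No X φ) →
      (s.rewrite R φ).No X φ
  | _, .skip, _ | _, .setTrue _, _ => trivial
  | φ, .ite _ _ _, h => hR.ite φ _ _ _ (BExpr.No.rewrite hR hX fun hn => (h hn).2.1)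
      (Stmt.No.rewrite hR hX fun hn => (h hn).2.2.1) (Stmt.No.rewrite hR hX fun hn => (h hn).2.2.2)
  | φ, .yield o, h => hR.yield φ _ (OExpr.No.rewrite (o := o) hR hX h)
  | _, .ret _, h => by
      refine ⟨fun hF => ?_, OExpr.No.rewrite hR hX fun hn => (h hn).2⟩
      by_cases hn : own
      · rcases hX hn with h | h <;> simp [h] at hF
      · exact (h hn).1 hF
  | φ, .bret e, h => hR.bret φ _ (BExpr.No.rewrite (e := e) hR hX h)
  | φ, .letOut _ _, h => hR.letOut φ _ _ (fun hn => (h hn).1.1)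
      (OExpr.No.rewrite hR hX fun hn => (h hn).2.1) (Stmt.No.rewrite hR hX fun hn => (h hn).2.2)
  | _, .letBool s, h => Stmt.No.rewrite (s := s) hR hX h
  | _, .loop _ o _, h => by
      refine ⟨fun hG => ?_, OExpr.No.rewrite hR hX fun hn => (h hn).2.1,
        Stmt.No.rewrite hR hX fun hn => (h hn).2.2⟩
      by_cases hn : own
      · rcases hX hn with h | h <;> simp [h] at hG
      · obtain ⟨x, hx⟩ := (h hn).1 hG
        exact ⟨x, by rw [hx]; rfl⟩
  | φ, .seq _ _, h => hR.seq φ _ _ (Stmt.No.rewrite hR hX fun hn => (h hn).2.1)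
      (Stmt.No.rewrite hR hX fun hn => (h hn).2.2)

end

/-! ### The steps B, C, E and H keep the programs free of the previous redexes -/

theorem Rules.Keeps.default {X : Pass} (hX : X ≠ .H) : Rules.Keeps ({} : Rules D) X False where
  litEq _ _ _ h ho := ⟨h id, ho⟩
  bcall _ _ _ h has := ⟨h id, has⟩
  const _ _ h := h id
  list _ _ _ h hes := ⟨h id, hes⟩
  ocall _ _ _ h has := ⟨h id, has⟩
  gen _ _ _ h hs := ⟨h id, hs⟩
  ite _ _ _ _ he hs ht := ⟨fun h => absurd h hX, he, hs, ht⟩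
  yield _ _ ho := ho
  bret _ _ he := he
  letOut _ _ _ h ho hs := ⟨⟨h id, fun h => absurd h hX⟩, ho, hs⟩
  seq _ _ _ hs ht := ⟨fun h => absurd h hX, hs, ht⟩

theorem litRules_keeps (c : CExpr D) : (litRules c).Keeps .A False :=
  { Rules.Keeps.default (X := .A) nofun with
    const := fun φ c' h => by
      simp only [litRules]
      split_ifs
      · exact ⟨nofun, trivial⟩
      · exact h id
    bcall := fun _ _ _ h has => ⟨h id, has⟩
    ocall := fun _ _ _ h has => ⟨h id, has⟩ }

theorem yieldExprs_no {X : Pass} (hX : X ≠ .H) {φ : List Bool} : ∀ {es : OExprs D}, es.No X φ →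
    (yieldExprs es).No X φ
  | .nil, _ => trivial
  | .cons _ _, h => ⟨fun h => absurd h hX, h.1, yieldExprs_no hX h.2⟩

theorem listRules_keeps : (listRules (D := D)).Keeps .A False :=
  { Rules.Keeps.default (X := .A) nofun with
    list := fun _ _ _ _ hes => ⟨nofun, yieldExprs_no (X := .A) nofun hes⟩ }

theorem inlineRules_keeps {X : Pass} (hX : X.num < 2) (j : ℕ) {f : Fn D}
    (hf : f.body.No X []) : (inlineRules j f).Keeps X False :=
  { Rules.Keeps.default (by rintro rfl; simp [Pass.num] at hX) with
    bcall := fun φ i as h has => by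
      simp only [inlineRules]
      split_ifs
      · exact ⟨by rintro rfl; simp [Pass.num] at hX,
          hf.instantiate (by rintro rfl; simp [Pass.num] at hX) has⟩
      · exact ⟨h id, has⟩
      · exact ⟨h id, has⟩
    ocall := fun φ i as h has => by
      simp only [inlineRules]
      split_ifs
      · split
        · exact ⟨by rintro rfl; simp [Pass.num] at hX,
            hf.instantiate (by rintro rfl; simp [Pass.num] at hX) has⟩
        · exact ⟨h id, has⟩
      · exact ⟨h id, has⟩
      · exact ⟨h id, has⟩ }

theorem letOutRules_keeps {X : Pass} (hX : X.num < 6) : (letOutRules (D := D)).Keeps X (X = .E) where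
  litEq _ _ _ h ho := ⟨fun hA => h (by simp [hA]) hA, ho⟩
  bcall _ _ _ h has := ⟨fun hC => h (by simp [hC]) hC, has⟩
  const _ _ h := fun hB => h (by simp [hB]) hB
  list _ _ _ h hes := ⟨fun hB => h (by simp [hB]) hB, hes⟩
  ocall _ _ _ h has := ⟨fun hC => h (by simp [hC]) hC, has⟩
  gen _ _ _ h hs := ⟨fun hF => h (by simp [hF]) hF, hs⟩
  ite _ _ _ _ he hs ht := ⟨by rintro rfl; simp [Pass.num] at hX, he, hs, ht⟩
  yield _ _ ho := ho
  bret _ _ he := he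
  letOut _ _ _ _ ho hs := hs.subst (by rintro rfl; simp [Pass.num] at hX) ho
  seq _ _ _ hs ht := ⟨by rintro rfl; simp [Pass.num] at hX, hs, ht⟩

theorem letBools_no {X : Pass} {φ : List Bool} {s : Stmt D} : ∀ {k : ℕ},
    (letBools k s).No X φ ↔ s.No X φ
  | 0 => Iff.rfl
  | k + 1 => letBools_no (k := k)

theorem Stmt.No.splitBools {X : Pass} {φ : List Bool} : ∀ {s : Stmt D}, s.No X φ →
    s.splitBools.2.No X φ
  | .skip, h | .yield _, h | .ret _, h | .bret _, h | .setTrue _, h | .ite _ _ _, h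
  | .letOut _ _, h | .loop _ _ _, h | .seq _ _, h => h
  | .letBool s, h => Stmt.No.splitBools (s := s) h

theorem Stmt.not_isLetBool_splitBools : ∀ s : Stmt D, ¬ s.splitBools.2.IsLetBool
  | .skip | .yield _ | .ret _ | .bret _ | .setTrue _ | .ite _ _ _
  | .letOut _ _ | .loop _ _ _ | .seq _ _ => nofun
  | .letBool s => Stmt.not_isLetBool_splitBools s

theorem hoist₂_no {X : Pass} {φ : List Bool} {c : ℕ → Stmt D → Stmt D → Stmt D}
    (hc : ∀ k s t, ¬ s.IsLetBool → ¬ t.IsLetBool → s.No X φ → t.No X φ → (c k s t).No X φ)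
    {s t : Stmt D} (hs : s.No X φ) (ht : t.No X φ) : (hoist₂ c s t).No X φ := by
  refine letBools_no.2 (hc _ _ _ ?_ ?_ (hs.splitBools.ren (.id φ)) (ht.splitBools.ren (.id φ)))
  · rw [Stmt.isLetBool_ren]; exact s.not_isLetBool_splitBools
  · rw [Stmt.isLetBool_ren]; exact t.not_isLetBool_splitBools

theorem letBoolRules_keeps (X : Pass) : (letBoolRules (D := D)).Keeps X (X = .H) where
  litEq _ _ _ h ho := ⟨fun hA => h (by simp [hA]) hA, ho⟩
  bcall _ _ _ h has := ⟨fun hC => h (by simp [hC]) hC, has⟩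
  const _ _ h := fun hB => h (by simp [hB]) hB
  list _ _ _ h hes := ⟨fun hB => h (by simp [hB]) hB, hes⟩
  ocall _ _ _ h has := ⟨fun hC => h (by simp [hC]) hC, has⟩
  gen _ _ _ h hs := ⟨fun hF => h (by simp [hF]) hF, hs⟩
  ite φ _ _ _ he hs ht := by
    simp only [letBoolRules]
    refine hoist₂_no (fun _ _ _ h₁ h₂ hs ht => ?_) hs ht
    exact ⟨fun _ => ⟨h₁, h₂⟩, he.ren (.id φ), hs, ht⟩
  yield _ _ ho := ho
  bret _ _ he := he
  letOut _ _ _ h ho hs := letBools_no.2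
    ⟨⟨fun hE => h (by simp [hE]) hE, fun _ => Stmt.not_isLetBool_splitBools _⟩, ho, hs.splitBools⟩
  seq _ _ _ hs ht := by
    simp only [letBoolRules]
    refine hoist₂_no (fun _ _ _ h₁ h₂ hs ht => ?_) hs ht
    exact ⟨fun _ => ⟨h₁, h₂⟩, hs, ht⟩

theorem Prog.no_mapBody {X : Pass} {P : Prog D} {g : Stmt D → Stmt D}
    (hg : ∀ f ∈ P.funs, (g f.body).No X []) : (P.mapBody g).No X := by
  intro f hf
  obtain ⟨f₀, hf₀, rfl⟩ := List.mem_map.1 hf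
  exact hg f₀ hf₀

theorem Prog.No.letOut {X : Pass} {P : Prog D} (hX : X.num < 6) (h : X ≠ .E → P.No X) :
    (P.mapBody (Stmt.rewrite letOutRules [])).No X :=
  Prog.no_mapBody fun f hf =>
    Stmt.No.rewrite (letOutRules_keeps hX) Or.inl fun hE => h hE f hf

theorem Prog.No.letBool {X : Pass} {P : Prog D} (h : X ≠ .H → P.No X) :
    (P.mapBody (Stmt.rewrite letBoolRules [])).No X :=
  Prog.no_mapBody fun f hf =>
    Stmt.No.rewrite (letBoolRules_keeps X) Or.inr fun hE => h hE f hf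

theorem Prog.No.inlineFn {X : Pass} {P : Prog D} (hX : X.num < 2) (h : P.No X) {j : ℕ} {f : Fn D}
    (hf : P.funs[j]? = some f) : (inlineFn j f P).No X := by
  intro g hg
  obtain ⟨g₀, hg₀, rfl⟩ := List.mem_map.1 hg
  exact Stmt.No.rewrite (inlineRules_keeps hX j (h f (List.mem_of_getElem? hf))) False.elim
    fun _ => h g₀ (List.mem_of_mem_eraseIdx hg₀)

theorem Prog.No.list {P : Prog D} (h : P.No .A) :
    (P.mapBody (Stmt.rewrite listRules [])).No .A :=
  Prog.no_mapBody fun f hf => Stmt.No.rewrite listRules_keeps False.elim fun _ => h f hf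

theorem yieldConsts_no {φ : List Bool} : ∀ cs : List (CExpr D), (yieldConsts cs).No .A φ
  | [] => trivial
  | _ :: cs => ⟨nofun, nofun, yieldConsts_no cs⟩

theorem Prog.No.elimLit {P : Prog D} (h : P.No .A) (n : ℕ) (cs : List (CExpr D)) :
    (elimLit n cs P).No .A := by
  rintro f (_ | ⟨_, hf⟩)
  · exact yieldConsts_no cs
  · obtain ⟨f₀, hf₀, rfl⟩ := List.mem_map.1 hf
    exact Stmt.No.rewrite (litRules_keeps _) False.elim fun _ => h f₀ hf₀

/-! ### Step D removes the boolean generators and keeps the programs free of the previous redexes -/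

/-- A boolean combination without redexes, except for boolean generators in the combination. -/
def BExpr.PreNo (X : Pass) (φ : List Bool) : BExpr D → Prop
  | .not e => e.PreNo X φ
  | .bin _ e₁ e₂ => e₁.PreNo X φ ∧ e₂.PreNo X φ
  | .gen s => s.No X φ
  | e => e.No X φ

theorem BExpr.PreNo.no {X : Pass} {φ : List Bool} : ∀ {e : BExpr D}, e.PreNo X φ →
    (X ≠ .D ∨ e.hasGen = false) → e.No X φ
  | .tt, _, _ | .ff, _, _ | .bvar _, _, _ | .comp _ _ _, _, _ => trivial
  | .not e, h, hg => BExpr.PreNo.no (e := e) h hg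
  | .bin _ e₁ e₂, h, hg => by
      simp only [BExpr.hasGen, Bool.or_eq_false_iff] at hg
      exact ⟨h.1.no (hg.imp_right And.left), h.2.no (hg.imp_right And.right)⟩
  | .litEq _ _, h, _ => h
  | .call _ _, h, _ => h
  | .gen _, h, hg => ⟨by simpa [BExpr.hasGen] using hg, h⟩

theorem Stmt.No.returnInto {X : Pass} (hX : X ≠ .H) : ∀ {s : Stmt D} {φ : List Bool} {r b : ℕ},
    s.No X φ → (s.returnInto r b).No X φ
  | .skip, _, _, _, h | .yield _, _, _, _, h | .ret _, _, _, _, h | .setTrue _, _, _, _, h => h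
  | .bret _, _, _, _, h => ⟨fun h => absurd h hX, trivial, trivial, fun h => absurd h hX, trivial,
      fun h => absurd h hX, h, trivial, trivial⟩
  | .ite _ _ _, _, _, _, h => ⟨fun h => absurd h hX, h.2.1, h.2.2.1.returnInto hX,
      h.2.2.2.returnInto hX⟩
  | .letOut _ _, _, _, _, h => ⟨⟨h.1.1, fun h => absurd h hX⟩, h.2.1, h.2.2.returnInto hX⟩
  | .letBool s, _, _, _, h => Stmt.No.returnInto (s := s) hX h
  | .loop _ _ _, _, _, _, h => ⟨h.1, h.2.1, h.2.2.returnInto hX⟩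
  | .seq _ _, _, _, _, h => ⟨fun h => absurd h hX, h.2.1.returnInto hX, h.2.2.returnInto hX⟩

theorem BExpr.PreNo.evalInto {X : Pass} (hX : X ≠ .H) {φ : List Bool} : ∀ {e : BExpr D} {b k : ℕ},
    e.PreNo X φ → (e.evalInto b k).No X φ
  | .tt, _, _, h | .ff, _, _, h | .bvar _, _, _, h
  | .comp _ _ _, _, _, h | .litEq _ _, _, _, h
  | .call _ _, _, _, h =>
      ⟨fun h => absurd h hX, (BExpr.PreNo.no h (.inr rfl)).ren (.id φ), trivial, trivial⟩
  | .gen s, _, _, h => Stmt.No.returnInto (s := s) hX h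
  | .not e, b, k, h => by
      simp only [BExpr.evalInto]
      split_ifs with hg
      · exact ⟨fun h => absurd h hX, BExpr.PreNo.evalInto (e := e) hX h, fun h => absurd h hX,
          trivial, trivial, trivial⟩
      · exact ⟨fun h => absurd h hX,
          (BExpr.PreNo.no (e := .not e) h (.inr (by simpa [BExpr.hasGen] using hg))).ren
            (b := (· + k)) (.id φ), trivial, trivial⟩
  | .bin op e₁ e₂, b, k, h => by
      simp only [BExpr.evalInto]
      split_ifs with hg
      · exact ⟨fun h => absurd h hX, h.1.evalInto hX, fun h => absurd h hX, h.2.evalInto hX,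
          fun h => absurd h hX, ⟨trivial, trivial⟩, trivial, trivial⟩
      · exact ⟨fun h => absurd h hX,
          (BExpr.PreNo.no (e := .bin op e₁ e₂) h (.inr (by simpa [BExpr.hasGen] using hg))).ren
            (b := (· + k)) (.id φ), trivial, trivial⟩

mutual

theorem BExpr.preNo_boolGen {X : Pass} (hX : X.num < 4) : ∀ {φ : List Bool} {e : BExpr D},
    (X ≠ .D → e.No X φ) → (e.rewrite boolGenRules φ).PreNo X φ
  | _, .tt, _ | _, .ff, _ | _, .bvar _, _ | _, .comp _ _ _, _ => trivial
  | _, .not e, h => BExpr.preNo_boolGen (e := e) hX h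
  | _, .bin _ _ _, h => ⟨BExpr.preNo_boolGen hX fun hn => (h hn).1,
      BExpr.preNo_boolGen hX fun hn => (h hn).2⟩
  | φ, .litEq c o, h => by
      refine ⟨fun hA => ?_, OExpr.no_boolGen hX fun hn => (h hn).2⟩
      obtain ⟨a, x, hc, ho, hx⟩ := (h (by simp [hA])).1 hA
      exact ⟨a, x, hc, by rw [ho]; rfl, hx⟩
  | φ, .call _ _, h => ⟨fun hC => (h (by simp [hC])).1 hC, Args.no_boolGen hX fun hn => (h hn).2⟩
  | φ, .gen s, h => Stmt.no_boolGen (s := s) hX fun hn => (h hn).2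

theorem OExpr.no_boolGen {X : Pass} (hX : X.num < 4) : ∀ {φ : List Bool} {o : OExpr D},
    (X ≠ .D → o.No X φ) → (o.rewrite boolGenRules φ).No X φ
  | _, .var _, _ => trivial
  | φ, .const _, h => fun hB => h (by simp [hB]) hB
  | φ, .list _ _, h => ⟨fun hB => (h (by simp [hB])).1 hB, OExprs.no_boolGen hX fun hn => (h hn).2⟩
  | φ, .call _ _, h => ⟨fun hC => (h (by simp [hC])).1 hC, Args.no_boolGen hX fun hn => (h hn).2⟩
  | φ, .gen _ _, h => ⟨fun hF => (h (by simp [hF])).1 hF, Stmt.no_boolGen hX fun hn => (h hn).2⟩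

theorem OExprs.no_boolGen {X : Pass} (hX : X.num < 4) : ∀ {φ : List Bool} {es : OExprs D},
    (X ≠ .D → es.No X φ) → (es.rewrite boolGenRules φ).No X φ
  | _, .nil, _ => trivial
  | _, .cons _ _, h => ⟨OExpr.no_boolGen hX fun hn => (h hn).1,
      OExprs.no_boolGen hX fun hn => (h hn).2⟩

theorem Args.no_boolGen {X : Pass} (hX : X.num < 4) : ∀ {φ : List Bool} {as : Args D},
    (X ≠ .D → as.No X φ) → (as.rewrite boolGenRules φ).No X φ
  | _, .nil, _ => trivial
  | _, .cons _ _ _, h => ⟨OExpr.no_boolGen hX fun hn => (h hn).1,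
      Args.no_boolGen hX fun hn => (h hn).2⟩

theorem Stmt.no_boolGen {X : Pass} (hX : X.num < 4) : ∀ {φ : List Bool} {s : Stmt D},
    (X ≠ .D → s.No X φ) → (s.rewrite boolGenRules φ).No X φ
  | _, .skip, _ | _, .setTrue _, _ => trivial
  | φ, .ite e s t, h => by
      have hH : X ≠ .H := by rintro rfl; simp [Pass.num] at hX
      have he := BExpr.preNo_boolGen (e := e) hX fun hn => (h hn).2.1
      have hs := Stmt.no_boolGen (s := s) hX fun hn => (h hn).2.2.1
      have ht := Stmt.no_boolGen (s := t) hX fun hn => (h hn).2.2.2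
      simp only [Stmt.rewrite, boolGenRules]
      split_ifs with hg
      · exact ⟨fun h => absurd h hH, he.evalInto hH, fun h => absurd h hH, trivial,
          hs.ren (.id φ), ht.ren (.id φ)⟩
      · exact ⟨fun h => absurd h hH, he.no (.inr (eq_false_of_ne_true hg)), hs, ht⟩
  | φ, .yield o, h => OExpr.no_boolGen (o := o) hX h
  | _, .ret _, h => ⟨fun hF => (h (by simp [hF])).1 hF, OExpr.no_boolGen hX fun hn => (h hn).2⟩
  | φ, .bret e, h => by
      have hH : X ≠ .H := by rintro rfl; simp [Pass.num] at hX
      have he := BExpr.preNo_boolGen (e := e) hX h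
      simp only [Stmt.rewrite, boolGenRules]
      split_ifs with hg
      · exact ⟨fun h => absurd h hH, he.evalInto hH, trivial⟩
      · exact he.no (.inr (eq_false_of_ne_true hg))
  | φ, .letOut _ _, h => ⟨⟨fun hE => (h (by simp [hE])).1.1 hE, by rintro rfl; simp [Pass.num] at hX⟩,
      OExpr.no_boolGen hX fun hn => (h hn).2.1, Stmt.no_boolGen hX fun hn => (h hn).2.2⟩
  | _, .letBool s, h => Stmt.no_boolGen (s := s) hX h
  | _, .loop _ o _, h => ⟨by rintro rfl; simp [Pass.num] at hX,
      OExpr.no_boolGen hX fun hn => (h hn).2.1, Stmt.no_boolGen hX fun hn => (h hn).2.2⟩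
  | φ, .seq _ _, h => ⟨by rintro rfl; simp [Pass.num] at hX,
      Stmt.no_boolGen hX fun hn => (h hn).2.1, Stmt.no_boolGen hX fun hn => (h hn).2.2⟩

end

theorem Prog.No.boolGen {X : Pass} {P : Prog D} (hX : X.num < 4) (h : X ≠ .D → P.No X) :
    (P.mapBody (Stmt.rewrite boolGenRules [])).No X :=
  Prog.no_mapBody fun f hf => Stmt.no_boolGen hX fun hE => h hE f hf

/-! ### Termination of the steps A and B -/

/-- Nothing is collected at nodes other than literal equalities, constants and lists. -/
structure IsLitItem {α : Type*} (g : List Bool × Node D → List α) : Prop where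
  b : ∀ φ e, (∀ c o, e ≠ .litEq c o) → g (φ, .b e) = []
  o : ∀ φ o, (∀ c, o ≠ .const c) → (∀ n es, o ≠ .list n es) → g (φ, .o o) = []
  s : ∀ φ s, g (φ, .s s) = []

/-- The effect of the rules on the items `g n` collected at the nodes `n` is to keep those that
satisfy `p`. -/
structure Rules.Filters {α : Type*} (R : Rules D) (g : List Bool × Node D → List α)
    (p : α → Bool) : Prop where
  other : IsLitItem g
  litEq : ∀ φ c o, ((R.litEq φ c (o.rewrite R φ)).nodes φ).flatMap g =
    (g (φ, .b (.litEq c o))).filter p ++ ((o.rewrite R φ).nodes φ).flatMap g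
  const : ∀ φ c, ((R.const c).nodes φ).flatMap g = (g (φ, .o (.const c))).filter p
  list : ∀ φ n es, ((R.list n (es.rewrite R φ)).nodes φ).flatMap g =
    (g (φ, .o (.list n es))).filter p ++ ((es.rewrite R φ).nodes φ).flatMap g
  bcall : ∃ h : ℕ → ℕ, R.bcall = fun f as => .call (h f) as
  ocall : ∃ h : ℕ → ℕ, R.ocall = fun f as => .call (h f) as
  gen : R.gen = .gen := by rfl
  ite : R.ite = .ite := by rfl
  yield : R.yield = .yield := by rfl
  bret : R.bret = .bret := by rfl
  letOut : R.letOut = .letOut := by rfl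
  seq : R.seq = .seq := by rfl

mutual

theorem BExpr.collect_rewrite {α : Type*} {R : Rules D} {g : List Bool × Node D → List α}
    {p : α → Bool} (hR : R.Filters g p) : ∀ (φ : List Bool) (e : BExpr D),
    ((e.rewrite R φ).nodes φ).flatMap g = ((e.nodes φ).flatMap g).filter p
  | φ, .tt | φ, .ff | φ, .bvar _ | φ, .comp _ _ _ => by
      simp [BExpr.rewrite, BExpr.nodes, hR.other.b]
  | φ, .not e => by
      simp [BExpr.rewrite, BExpr.nodes, hR.other.b, BExpr.collect_rewrite hR φ e]
  | φ, .bin _ e₁ e₂ => by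
      simp [BExpr.rewrite, BExpr.nodes, hR.other.b, BExpr.collect_rewrite hR φ e₁,
        BExpr.collect_rewrite hR φ e₂]
  | φ, .litEq c o => by
      simp [BExpr.rewrite, BExpr.nodes, hR.litEq, OExpr.collect_rewrite hR φ o]
  | φ, .call f as => by
      obtain ⟨h, hh⟩ := hR.bcall
      simp [BExpr.rewrite, BExpr.nodes, hh, hR.other.b, Args.collect_rewrite hR φ as]
  | φ, .gen s => by
      simp [BExpr.rewrite, BExpr.nodes, hR.other.b, Stmt.collect_rewrite hR φ s]

theorem OExpr.collect_rewrite {α : Type*} {R : Rules D} {g : List Bool × Node D → List α}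
    {p : α → Bool} (hR : R.Filters g p) : ∀ (φ : List Bool) (o : OExpr D),
    ((o.rewrite R φ).nodes φ).flatMap g = ((o.nodes φ).flatMap g).filter p
  | φ, .var _ => by simp [OExpr.rewrite, OExpr.nodes, hR.other.o]
  | φ, .const c => by
      simp only [OExpr.rewrite, hR.const, OExpr.nodes, List.flatMap_cons, List.flatMap_nil,
        List.append_nil]
  | φ, .list n es => by
      simp [OExpr.rewrite, OExpr.nodes, hR.list, OExprs.collect_rewrite hR φ es]
  | φ, .call f as => by
      obtain ⟨h, hh⟩ := hR.ocall
      simp [OExpr.rewrite, OExpr.nodes, hh, hR.other.o, Args.collect_rewrite hR φ as]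
  | φ, .gen n s => by
      simp [OExpr.rewrite, OExpr.nodes, hR.gen, hR.other.o,
        Stmt.collect_rewrite hR φ s]

theorem OExprs.collect_rewrite {α : Type*} {R : Rules D} {g : List Bool × Node D → List α}
    {p : α → Bool} (hR : R.Filters g p) : ∀ (φ : List Bool) (es : OExprs D),
    ((es.rewrite R φ).nodes φ).flatMap g = ((es.nodes φ).flatMap g).filter p
  | φ, .nil => rfl
  | φ, .cons e es => by
      simp [OExprs.rewrite, OExprs.nodes, OExpr.collect_rewrite hR φ e,
        OExprs.collect_rewrite hR φ es]

theorem Args.collect_rewrite {α : Type*} {R : Rules D} {g : List Bool × Node D → List α}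
    {p : α → Bool} (hR : R.Filters g p) : ∀ (φ : List Bool) (as : Args D),
    ((as.rewrite R φ).nodes φ).flatMap g = ((as.nodes φ).flatMap g).filter p
  | φ, .nil => rfl
  | φ, .cons e _ as => by
      simp [Args.rewrite, Args.nodes, OExpr.collect_rewrite hR φ e, Args.collect_rewrite hR φ as]

theorem Stmt.collect_rewrite {α : Type*} {R : Rules D} {g : List Bool × Node D → List α}
    {p : α → Bool} (hR : R.Filters g p) : ∀ (φ : List Bool) (s : Stmt D),
    ((s.rewrite R φ).nodes φ).flatMap g = ((s.nodes φ).flatMap g).filter p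
  | φ, .skip | φ, .setTrue _ => by simp [Stmt.rewrite, Stmt.nodes, hR.other.s]
  | φ, .ite e s t => by
      simp [Stmt.rewrite, Stmt.nodes, hR.ite, hR.other.s,
        BExpr.collect_rewrite hR φ e, Stmt.collect_rewrite hR φ s, Stmt.collect_rewrite hR φ t]
  | φ, .yield o => by
      simp [Stmt.rewrite, Stmt.nodes, hR.yield, hR.other.s,
        OExpr.collect_rewrite hR φ o]
  | φ, .ret o => by
      simp [Stmt.rewrite, Stmt.nodes, hR.other.s, OExpr.collect_rewrite hR φ o]
  | φ, .bret e => by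
      simp [Stmt.rewrite, Stmt.nodes, hR.bret, hR.other.s,
        BExpr.collect_rewrite hR φ e]
  | φ, .letOut o s => by
      simp [Stmt.rewrite, Stmt.nodes, hR.letOut, hR.other.s,
        OExpr.collect_rewrite hR φ o, Stmt.collect_rewrite hR (false :: φ) s]
  | φ, .letBool s => by
      simp [Stmt.rewrite, Stmt.nodes, hR.other.s, Stmt.collect_rewrite hR φ s]
  | φ, .loop _ o s => by
      simp [Stmt.rewrite, Stmt.nodes, hR.other.s,
        OExpr.collect_rewrite hR φ o, Stmt.collect_rewrite hR (true :: φ) s]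
  | φ, .seq s t => by
      simp [Stmt.rewrite, Stmt.nodes, hR.seq, hR.other.s,
        Stmt.collect_rewrite hR φ s, Stmt.collect_rewrite hR φ t]

end

/-- The items collected in a list of function definitions. -/
def collectFns {α : Type*} (g : List Bool × Node D → List α) (fs : List (Fn D)) : List α :=
  (fs.flatMap fun f => f.body.nodes []).flatMap g

theorem collectFns_rewrite {α : Type*} {R : Rules D} {g : List Bool × Node D → List α}
    {p : α → Bool} (hR : R.Filters g p) (fs : List (Fn D)) :
    collectFns g (fs.map (Fn.mapBody (Stmt.rewrite R []))) = (collectFns g fs).filter p := by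
  induction fs with
  | nil => rfl
  | cons f fs ih =>
    simp only [collectFns, List.map_cons, List.flatMap_cons, List.flatMap_append,
      List.filter_append] at ih ⊢
    rw [ih]
    simp [Fn.mapBody, Stmt.collect_rewrite hR]

theorem sum_filter_add_le {α : Type*} (w : α → ℕ) (p : α → Bool) {a : α} (ha : p a = false) :
    ∀ {l : List α}, a ∈ l → ((l.filter p).map w).sum + w a ≤ (l.map w).sum
  | b :: l, h => by
      have hle : ((l.filter p).map w).sum ≤ (l.map w).sum :=
        (List.filter_sublist.map w).sum_le_sum fun _ _ => Nat.zero_le _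
      rcases List.mem_cons.1 h with rfl | h
      · simp only [List.filter_cons, ha, List.map_cons, List.sum_cons]
        simp; omega
      · have := sum_filter_add_le w p ha h
        simp only [List.filter_cons, List.map_cons, List.sum_cons]
        split_ifs <;> simp <;> omega

/-- Size of a constant. -/
def CExpr.weight : CExpr D → ℕ
  | .char _ => 1
  | .list _ cs => 1 + weights cs
where
  /-- The sum of the sizes. -/
  weights : List (CExpr D) → ℕ
    | [] => 0
    | c :: cs => c.weight + weights cs

open Classical in
/-- The constant of a literal equality that has to be eliminated. -/
noncomputable def litEqItem : List Bool × Node D → List (CExpr D)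
  | (φ, .b (.litEq c o)) => if IsLabelTest φ c o then [] else [c]
  | _ => []

theorem litEqItem_isLitItem : IsLitItem (litEqItem (D := D)) where
  b _ e h := by cases e <;> first | rfl | exact absurd rfl (h _ _)
  o _ _ _ _ := rfl
  s _ _ := rfl

open Classical in
theorem litEqRules_filters (c : CExpr D) :
    (litEqRules c).Filters litEqItem fun c' => decide (c' ≠ c) where
  other := litEqItem_isLitItem
  litEq φ c' o := by
    have hl : IsLabelTest φ c' (o.rewrite (litEqRules c) φ) ↔ IsLabelTest φ c' o := by
      cases o <;> simp [IsLabelTest, OExpr.rewrite, litEqRules]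
    generalize o.rewrite (litEqRules c) φ = o' at hl ⊢
    simp only [litEqRules]
    split_ifs with h
    · rw [hl] at h
      obtain ⟨rfl, h⟩ := h
      cases c' <;> simp [litEqItem, h, BExpr.nodes, eqArgs, Args.nodes, OExpr.nodes, OExprs.nodes]
    · rw [hl, not_and_not_right] at h
      simp only [BExpr.nodes, List.flatMap_cons, litEqItem]
      by_cases h' : IsLabelTest φ c' o
      · simp [hl, h']
      · have : c' ≠ c := fun hc => h' (h hc)
        simp [hl, h', this]
  const φ c := by simp [litEqRules, OExpr.nodes, litEqItem]
  list φ n es := by simp [litEqRules, OExpr.nodes, litEqItem]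
  bcall := ⟨(· + 1), rfl⟩
  ocall := ⟨(· + 1), rfl⟩

theorem eqStep_collect (φ : List Bool) : ∀ (k : ℕ) (cs : List (CExpr D)),
    ((((eqStep k cs).nodes φ).flatMap litEqItem).map CExpr.weight).sum ≤ CExpr.weight.weights cs
  | _, [] => by simp [eqStep, Stmt.nodes, BExpr.nodes, litEqItem, CExpr.weight.weights]
  | k, c :: cs => by
      have := eqStep_collect φ (k + 1) cs
      simp only [eqStep, Stmt.nodes, BExpr.nodes, OExpr.nodes, List.flatMap_cons,
        List.flatMap_append, List.flatMap_nil, litEqItem, List.map_append, List.sum_append,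
        CExpr.weight.weights, List.nil_append, List.append_nil]
      split_ifs <;> simp <;> omega

theorem letBools_collect {α : Type*} {g : List Bool × Node D → List α}
    (hg : IsLitItem g) (φ : List Bool) (s : Stmt D) : ∀ k,
    ((letBools k s).nodes φ).flatMap g = (s.nodes φ).flatMap g
  | 0 => rfl
  | k + 1 => by
      simp [letBools, Stmt.nodes, hg.s, letBools_collect hg φ s k]

theorem eqFn_collect (c : CExpr D) :
    ((((eqFn c).body.nodes []).flatMap litEqItem).map CExpr.weight).sum < c.weight := by
  cases c with
  | char a =>
    have : IsLabelTest [true] (.char a) (.var 0) := ⟨a, 0, rfl, rfl, rfl⟩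
    simp [eqFn, Stmt.nodes, BExpr.nodes, OExpr.nodes, litEqItem, this, CExpr.weight]
  | list n cs =>
    have := eqStep_collect [true] 0 cs
    simp only [eqFn, letBools_collect litEqItem_isLitItem, CExpr.weight, Stmt.nodes, OExpr.nodes,
      List.flatMap_cons, List.flatMap_append, litEqItem, List.map_append, List.sum_append,
      List.nil_append, List.cons_append]
    have h' : ∀ e : BExpr D, (e = .tt ∨ e = .bvar (cs.length - 1)) →
        (((e.nodes []).flatMap litEqItem).map CExpr.weight).sum = 0 := by
      rintro e (rfl | rfl) <;> simp [BExpr.nodes, litEqItem]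
    rw [h' _ (by split_ifs <;> simp)]
    omega

open Classical in
theorem step_A_wf : WellFounded fun Q P : Prog D => Step .A P Q := by
  refine Subrelation.wf (r := InvImage (· < ·) fun P : Prog D =>
    ((collectFns litEqItem P.funs).map CExpr.weight).sum) ?_ (InvImage.wf _ wellFounded_lt)
  intro Q P h
  cases h with
  | litEq _ c hc =>
    obtain ⟨φ, o, hn, hb⟩ := hc
    have hmem : c ∈ collectFns litEqItem P.funs :=
      List.mem_flatMap.2 ⟨_, hn, by simp [litEqItem, hb]⟩
    have h₁ := sum_filter_add_le CExpr.weight (fun c' => decide (c' ≠ c)) (by simp) hmem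
    have h₂ := eqFn_collect c
    have h₃ := collectFns_rewrite (litEqRules_filters c) P.funs
    simp only [InvImage, elimLitEq]
    have h₄ : ∀ fs, collectFns litEqItem (eqFn c :: fs) =
        (((eqFn c).body.nodes []).flatMap litEqItem) ++ collectFns litEqItem fs := by
      simp [collectFns]
    rw [h₄, h₃, List.map_append, List.sum_append]
    exact lt_of_lt_of_le (Nat.add_lt_add_right h₂ _) ((add_comm _ _).trans_le h₁)

/-- A constant list or a list, which have to be eliminated. -/
def litItem : List Bool × Node D → List (Option (CExpr D))
  | (_, .o (.const (.list n cs))) => [some (.list n cs)]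
  | (_, .o (.list _ _)) => [none]
  | _ => []

/-- Size of an item. -/
def litWeight : Option (CExpr D) → ℕ
  | some c => c.weight
  | none => 1

theorem litItem_isLitItem : IsLitItem (litItem (D := D)) where
  b _ _ _ := rfl
  o _ o h h' := by cases o <;> first | rfl | exact absurd rfl (h _) | exact absurd rfl (h' _ _)
  s _ _ := rfl

open Classical in
theorem litRules_filters (n : ℕ) (cs : List (CExpr D)) :
    (litRules (.list n cs)).Filters litItem fun c' => decide (c' ≠ some (.list n cs)) where
  other := litItem_isLitItem
  litEq φ c' o := by simp [litRules, BExpr.nodes, litItem]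
  const φ c := by
    simp only [litRules]
    split_ifs with h
    · subst h; simp [OExpr.nodes, Args.nodes, litItem]
    · cases c with
      | char a => simp [OExpr.nodes, litItem]
      | list m cs' =>
        have : some (CExpr.list m cs') ≠ some (.list n cs) := fun h' => h (Option.some.inj h')
        simp only [OExpr.nodes, litItem, List.flatMap_cons, List.flatMap_nil, List.append_nil]
        simp [-CExpr.list.injEq, -Option.some.injEq, this]
  list φ n es := by simp [litRules, OExpr.nodes, litItem]
  bcall := ⟨(· + 1), rfl⟩
  ocall := ⟨(· + 1), rfl⟩

theorem yieldExprs_collect (φ : List Bool) : ∀ es : OExprs D,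
    ((yieldExprs es).nodes φ).flatMap litItem = (es.nodes φ).flatMap litItem
  | .nil => by simp [yieldExprs, Stmt.nodes, OExprs.nodes, litItem]
  | .cons e es => by
      simp [yieldExprs, Stmt.nodes, OExprs.nodes, litItem, yieldExprs_collect φ es]

theorem listRules_filters : (listRules (D := D)).Filters litItem Option.isSome where
  other := litItem_isLitItem
  litEq φ c' o := by simp [listRules, BExpr.nodes, litItem]
  const φ c := by cases c <;> simp [listRules, OExpr.nodes, litItem]
  list φ n es := by simp [listRules, OExpr.nodes, litItem, yieldExprs_collect]
  bcall := ⟨id, rfl⟩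
  ocall := ⟨id, rfl⟩

theorem yieldConsts_collect (φ : List Bool) : ∀ cs : List (CExpr D),
    ((((yieldConsts cs).nodes φ).flatMap litItem).map litWeight).sum ≤ CExpr.weight.weights cs
  | [] => by simp [yieldConsts, Stmt.nodes, litItem]
  | c :: cs => by
      have := yieldConsts_collect φ cs
      cases c <;>
      simp [yieldConsts, Stmt.nodes, OExpr.nodes, litItem, litWeight, CExpr.weight.weights] <;>
      omega

open Classical in
theorem step_B_wf : WellFounded fun Q P : Prog D => Step .B P Q := by
  refine Subrelation.wf (r := InvImage (· < ·) fun P : Prog D =>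
    ((collectFns litItem P.funs).map litWeight).sum) ?_ (InvImage.wf _ wellFounded_lt)
  intro Q P h
  cases h with
  | lit _ φ n cs hn =>
    have hmem : some (.list n cs) ∈ collectFns litItem P.funs :=
      List.mem_flatMap.2 ⟨_, hn, by simp [litItem]⟩
    have h₁ := sum_filter_add_le litWeight
      (fun c' => decide (c' ≠ some (.list n cs))) (by simp) hmem
    have h₂ := yieldConsts_collect [] cs
    have h₃ := collectFns_rewrite (litRules_filters n cs) P.funs
    have h₄ : ∀ (f : Fn D) fs, collectFns litItem (f :: fs) =
        ((f.body.nodes []).flatMap litItem) ++ collectFns litItem fs := by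
      simp [collectFns]
    have h₅ : litWeight (some (.list n cs)) = 1 + CExpr.weight.weights cs := by
      simp [litWeight, CExpr.weight]
    simp only [InvImage, elimLit]
    rw [h₄, h₃, List.map_append, List.sum_append]
    have h₆ := Nat.lt_of_le_of_lt h₂ (by omega : _ < litWeight (some (.list n cs)))
    exact lt_of_lt_of_le (Nat.add_lt_add_right h₆ _) ((add_comm _ _).trans_le h₁)
  | list _ φ n es hn =>
    have hmem : none ∈ collectFns litItem P.funs :=
      List.mem_flatMap.2 ⟨_, hn, by simp [litItem]⟩
    have h₁ := sum_filter_add_le litWeight Option.isSome (by simp) hmem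
    have h₃ := collectFns_rewrite (listRules_filters (D := D)) P.funs
    simp only [InvImage, Prog.mapBody]
    rw [h₃]
    simp only [litWeight] at h₁
    omega

theorem step_C_wf : WellFounded fun Q P : Prog D => Step .C P Q := by
  refine Subrelation.wf (r := InvImage (· < ·) fun P : Prog D => P.funs.length) ?_
    (InvImage.wf _ wellFounded_lt)
  intro Q P h
  cases h with
  | call _ j f hf hj =>
    have := lt_of_getElem?_eq_some hf
    simp only [InvImage, inlineFn, List.length_map, List.length_eraseIdx]
    split_ifs; omega

/-! ### Steps A and B preserve types -/

/-- The constant at a subterm, if any, is a nested word of some depth. -/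
def Node.DepthOk : Node D → Prop
  | .b (.litEq c _) => ∃ n, c.HasDepth n
  | .o (.const c) => ∃ n, c.HasDepth n
  | _ => True

mutual

theorem BExpr.HasType.depthOk : ∀ {Γ : Ctx D} {e : BExpr D} {φ : List Bool}, e.HasType Γ →
    ∀ m ∈ e.nodes φ, m.2.DepthOk
  | _, .tt, _, _ | _, .ff, _, _ | _, .bvar _, _, _ | _, .comp _ _ _, _, _ => by
      simp [BExpr.nodes, Node.DepthOk]
  | _, .not e, _, h => List.forall_mem_cons.2 ⟨trivial, BExpr.HasType.depthOk (e := e) h⟩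
  | _, .bin _ _ _, _, h => List.forall_mem_cons.2
      ⟨trivial, List.forall_mem_append.2 ⟨h.1.depthOk, h.2.depthOk⟩⟩
  | _, .litEq _ _, _, ⟨n, hc, ho⟩ => List.forall_mem_cons.2 ⟨⟨n, hc⟩, ho.depthOk⟩
  | _, .call _ _, _, ⟨_, _, h⟩ => List.forall_mem_cons.2 ⟨trivial, h.depthOk⟩
  | Γ, .gen s, _, h => List.forall_mem_cons.2
      ⟨trivial, Stmt.HasType.depthOk (Γ := Γ.hideBools) (s := s) h⟩

theorem OExpr.HasType.depthOk : ∀ {Γ : Ctx D} {o : OExpr D} {n : ℕ} {φ : List Bool},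
    o.HasType Γ n → ∀ m ∈ o.nodes φ, m.2.DepthOk
  | _, .var _, _, _, _ => by simp [OExpr.nodes, Node.DepthOk]
  | _, .const _, n, _, h => by simpa [OExpr.nodes, Node.DepthOk] using ⟨n, h⟩
  | _, .list _ _, _, _, h => List.forall_mem_cons.2 ⟨trivial, h.2.depthOk⟩
  | _, .call _ _, _, _, ⟨_, _, h⟩ => List.forall_mem_cons.2 ⟨trivial, h.depthOk⟩
  | Γ, .gen _ s, _, _, h => List.forall_mem_cons.2
      ⟨trivial, Stmt.HasType.depthOk (Γ := Γ.hideBools) (s := s) h.2⟩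

theorem OExprs.HasType.depthOk : ∀ {Γ : Ctx D} {es : OExprs D} {n : ℕ} {φ : List Bool},
    es.HasType Γ n → ∀ m ∈ es.nodes φ, m.2.DepthOk
  | _, .nil, _, _, _ => by simp [OExprs.nodes]
  | _, .cons _ _, _, _, h => List.forall_mem_append.2 ⟨h.1.depthOk, h.2.depthOk⟩

theorem Args.HasType.depthOk : ∀ {Γ : Ctx D} {as : Args D} {ps : List (ℕ × ℕ)} {φ : List Bool},
    as.HasType Γ ps → ∀ m ∈ as.nodes φ, m.2.DepthOk
  | _, .nil, _, _, _ => by simp [Args.nodes]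
  | _, .cons _ _ _, _, _, ⟨_, _, _, ho, _, has⟩ =>
      List.forall_mem_append.2 ⟨ho.depthOk, has.depthOk⟩

theorem Stmt.HasType.depthOk : ∀ {Γ : Ctx D} {s : Stmt D} {τ : Ty} {φ : List Bool},
    s.HasType Γ τ → ∀ m ∈ s.nodes φ, m.2.DepthOk
  | _, .skip, _, _, _ | _, .setTrue _, _, _, _ => by simp [Stmt.nodes, Node.DepthOk]
  | _, .ite _ _ _, _, _, h => List.forall_mem_cons.2 ⟨trivial, List.forall_mem_append.2
      ⟨List.forall_mem_append.2 ⟨h.1.depthOk, h.2.1.depthOk⟩, h.2.2.depthOk⟩⟩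
  | _, .yield _, _, _, ⟨_, _, h⟩ => List.forall_mem_cons.2 ⟨trivial, h.depthOk⟩
  | _, .ret _, _, _, ⟨_, _, h⟩ => List.forall_mem_cons.2 ⟨trivial, h.depthOk⟩
  | _, .bret _, _, _, h => List.forall_mem_cons.2 ⟨trivial, h.2.depthOk⟩
  | Γ, .letOut _ _, _, _, ⟨n, ho, h⟩ => List.forall_mem_cons.2
      ⟨trivial, List.forall_mem_append.2
        ⟨ho.depthOk, Stmt.HasType.depthOk (Γ := Γ.addList n) h⟩⟩
  | Γ, .letBool s, _, _, h => List.forall_mem_cons.2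
      ⟨trivial, Stmt.HasType.depthOk (Γ := Γ.addBool) (s := s) h⟩
  | Γ, .loop _ o _, _, _, ⟨n, ho, h⟩ => List.forall_mem_cons.2
      ⟨trivial, List.forall_mem_append.2
        ⟨ho.depthOk, Stmt.HasType.depthOk (Γ := Γ.addLoop o n) h⟩⟩
  | _, .seq _ _, _, _, h => List.forall_mem_cons.2
      ⟨trivial, List.forall_mem_append.2 ⟨h.1.depthOk, h.2.depthOk⟩⟩

end

theorem Prog.HasType.depthOk {P : Prog D} {σ : Sig} (hP : P.HasType σ) :
    ∀ m ∈ P.nodes, m.2.DepthOk := by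
  intro m hm
  obtain ⟨f, hf, hm⟩ := List.mem_flatMap.1 hm
  obtain ⟨i, hi⟩ := List.mem_iff_getElem?.1 hf
  exact Stmt.HasType.depthOk (hP.1 i f hi) m hm

/-- The steps other than F and G preserve types. -/
theorem Step.hasType {X : Pass} {P Q : Prog D} {σ : Sig} (h : Step X P Q) (hP : P.HasType σ)
    (hF : X ≠ .F) (hG : X ≠ .G) : Q.HasType σ := by
  cases h with
  | litEq _ c hc =>
      obtain ⟨φ, o, hn, -⟩ := hc
      obtain ⟨n, hc⟩ := hP.depthOk _ hn
      exact hP.cons_fn (eqFn_wellTyped hc []) (litEqRules_natural c) (litEqRules_sound c)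
  | lit _ φ n cs hn =>
      obtain ⟨m, hm, hcs⟩ := hP.depthOk _ hn
      exact hP.cons_fn (g := ⟨[], .out (n + 1), yieldConsts cs⟩) (yieldConsts_hasType hcs)
        (litRules_natural _) (litRules_sound n cs)
  | list => exact hP.mapBody_rewrite listRules_natural listRules_sound
  | call _ j f hf hj => exact inlineFn_hasType hP hf hj
  | boolGen => exact hP.mapBody_rewrite boolGenRules_natural boolGenRules_sound
  | letOut => exact hP.mapBody_rewrite letOutRules_natural letOutRules_sound
  | ret => exact absurd rfl hF
  | forLoop => exact absurd rfl hG
  | letBool => exact hP.mapBody_rewrite letBoolRules_natural letBoolRules_sound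

/-! ### Programs with a single function -/

mutual

theorem BExpr.HasType.no_C : ∀ {Γ : Ctx D} {e : BExpr D} {φ : List Bool}, Γ.funs = [] →
    e.HasType Γ → e.No .C φ
  | _, .tt, _, _, _ | _, .ff, _, _, _ | _, .bvar _, _, _, _ | _, .comp _ _ _, _, _, _ => trivial
  | _, .not e, _, hΓ, h => BExpr.HasType.no_C (e := e) hΓ h
  | _, .bin _ _ _, _, hΓ, h => ⟨h.1.no_C hΓ, h.2.no_C hΓ⟩
  | _, .litEq _ _, _, hΓ, ⟨_, _, ho⟩ => ⟨nofun, ho.no_C hΓ⟩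
  | _, .call _ _, _, hΓ, ⟨_, hf, _⟩ => by simp [hΓ] at hf
  | Γ, .gen s, _, hΓ, h => ⟨nofun, Stmt.HasType.no_C (Γ := Γ.hideBools) (s := s) hΓ h⟩

theorem OExpr.HasType.no_C : ∀ {Γ : Ctx D} {o : OExpr D} {n : ℕ} {φ : List Bool}, Γ.funs = [] →
    o.HasType Γ n → o.No .C φ
  | _, .var _, _, _, _, _ => trivial
  | _, .const _, _, _, _, _ => nofun
  | _, .list _ _, _, _, hΓ, h => ⟨nofun, h.2.no_C hΓ⟩
  | _, .call _ _, _, _, hΓ, ⟨_, hf, _⟩ => by simp [hΓ] at hf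
  | Γ, .gen _ s, _, _, hΓ, h => ⟨nofun, Stmt.HasType.no_C (Γ := Γ.hideBools) (s := s) hΓ h.2⟩

theorem OExprs.HasType.no_C : ∀ {Γ : Ctx D} {es : OExprs D} {n : ℕ} {φ : List Bool},
    Γ.funs = [] → es.HasType Γ n → es.No .C φ
  | _, .nil, _, _, _, _ => trivial
  | _, .cons _ _, _, _, hΓ, h => ⟨h.1.no_C hΓ, h.2.no_C hΓ⟩

theorem Stmt.HasType.no_C : ∀ {Γ : Ctx D} {s : Stmt D} {τ : Ty} {φ : List Bool},
    Γ.funs = [] → s.HasType Γ τ → s.No .C φ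
  | _, .skip, _, _, _, _ | _, .setTrue _, _, _, _, _ => trivial
  | _, .ite _ _ _, _, _, hΓ, h => ⟨nofun, h.1.no_C hΓ, h.2.1.no_C hΓ, h.2.2.no_C hΓ⟩
  | _, .yield o, _, _, hΓ, ⟨_, _, h⟩ => OExpr.HasType.no_C (o := o) hΓ h
  | _, .ret _, _, _, hΓ, ⟨_, _, h⟩ => ⟨nofun, h.no_C hΓ⟩
  | _, .bret e, _, _, hΓ, h => BExpr.HasType.no_C (e := e) hΓ h.2
  | Γ, .letOut _ _, _, _, hΓ, ⟨n, ho, h⟩ =>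
      ⟨⟨nofun, nofun⟩, ho.no_C hΓ, Stmt.HasType.no_C (Γ := Γ.addList n) hΓ h⟩
  | Γ, .letBool s, _, _, hΓ, h => Stmt.HasType.no_C (Γ := Γ.addBool) (s := s) hΓ h
  | Γ, .loop _ o _, _, _, hΓ, ⟨n, ho, h⟩ =>
      ⟨nofun, ho.no_C hΓ, Stmt.HasType.no_C (Γ := Γ.addLoop o n) hΓ h⟩
  | _, .seq _ _, _, _, hΓ, h => ⟨nofun, h.1.no_C hΓ, h.2.no_C hΓ⟩

end

theorem Prog.HasType.eq_single {P : Prog D} {σ : Sig} (hP : P.HasType σ)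
    (hC : Irreducible .C P) :
    ∃ s : Stmt D, P = ⟨[⟨σ.params, σ.ret, s⟩], 0⟩ ∧ s.HasType (bodyCtx [] σ.params) σ.ret := by
  obtain ⟨hP, f, hf, rfl⟩ := hP
  rw [irreducible_C_iff] at hC
  have hlt := lt_of_getElem?_eq_some hf
  have h0 : P.main = 0 := (hC 0 (by omega)).symm
  have hlen : P.funs.length = 1 := by
    by_contra hne
    have := hC 1 (by omega)
    omega
  obtain ⟨F, m⟩ := P
  obtain ⟨g, rfl⟩ := List.length_eq_one_iff.1 hlen
  obtain rfl : m = 0 := h0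
  obtain rfl : g = f := by simpa using hf
  exact ⟨g.body, rfl, hP 0 g rfl⟩

theorem Prog.hasType_single {σ : Sig} {s : Stmt D} :
    (⟨[⟨σ.params, σ.ret, s⟩], 0⟩ : Prog D).HasType σ ↔ s.HasType (bodyCtx [] σ.params) σ.ret := by
  constructor
  · intro h
    exact h.1 0 _ rfl
  · intro h
    refine ⟨?_, _, rfl, rfl⟩
    rintro (_ | i) f hf
    · cases hf
      exact h
    · simp at hf

/-- There are no redexes of the steps with a number smaller than `k`. -/
def Stmt.NoLt (k : ℕ) (φ : List Bool) (s : Stmt D) : Prop := ∀ X : Pass, X.num < k → s.No X φ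

theorem Stmt.HasType.irreducible_iff {σ : Sig} {s : Stmt D} {k : ℕ}
    (hs : s.HasType (bodyCtx [] σ.params) σ.ret) :
    (∀ X : Pass, X.num < k → Irreducible X (⟨[⟨σ.params, σ.ret, s⟩], 0⟩ : Prog D)) ↔
      s.NoLt k [] := by
  refine forall₂_congr fun X _ => ?_
  by_cases hC : X = .C
  · subst hC
    rw [irreducible_C_iff]
    simpa using hs.no_C rfl
  · rw [ForProg.irreducible_iff hC]
    simp [Prog.No]

/-! ### Step F: typing and redexes -/

theorem yieldChar_ren (l p : ℕ → ℕ) (o : OExpr D) :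
    yieldChar (o.ren l p) = (yieldChar o).ren l p id := by
  rcases o with _ | _ | _ | _ | ⟨_ | n, s⟩ <;> rfl

theorem Stmt.guardReturn_ren : ∀ (s : Stmt D) (l p : ℕ → ℕ) (r : ℕ),
    (s.ren l p id).guardReturn r = (s.guardReturn r).ren l p id
  | .skip, _, _, _ | .bret _, _, _, _ | .setTrue _, _, _, _ | .yield _, _, _, _
  | .ret _, _, _, _ => rfl
  | .ite _ s t, l, p, r | .seq s t, l, p, r => by
      simp [Stmt.ren, Stmt.guardReturn, guardReturn_ren s, guardReturn_ren t]
  | .letOut _ s, l, p, r | .loop _ _ s, l, p, r => by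
      simp [Stmt.ren, Stmt.guardReturn, guardReturn_ren s]
  | .letBool s, l, p, r => by
      simp [Stmt.ren, Stmt.guardReturn, guardReturn_ren s, up_id]

theorem Stmt.returnToYield_ren : ∀ (s : Stmt D) (l p : ℕ → ℕ) (r : ℕ),
    (s.ren l p id).returnToYield r = (s.returnToYield r).ren l p id
  | .skip, _, _, _ | .bret _, _, _, _ | .setTrue _, _, _, _ | .yield _, _, _, _ => rfl
  | .ret o, l, p, _ => by
      simp [Stmt.ren, Stmt.returnToYield, yieldChar_ren l p o, BExpr.ren]
  | .ite _ s t, l, p, r | .seq s t, l, p, r => by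
      simp [Stmt.ren, Stmt.returnToYield, returnToYield_ren s, returnToYield_ren t]
  | .letOut _ s, l, p, r | .loop _ _ s, l, p, r => by
      simp [Stmt.ren, Stmt.returnToYield, returnToYield_ren s]
  | .letBool s, l, p, r => by
      simp [Stmt.ren, Stmt.returnToYield, returnToYield_ren s, up_id]

theorem returnRules_natural (F : List Sig) : (returnRules (D := D)).Natural F where
  gen l p n s := by
    cases n <;> simp [returnRules, elimReturn, OExpr.ren, Stmt.ren, up_id,
      Stmt.returnToYield_ren, Stmt.guardReturn_ren]
  yield l p o := yieldChar_ren l p o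

/-- Elimination of the return statements of a statement of type `τ`, with the boolean `r`. -/
def Stmt.elimRet (r : ℕ) : Ty → Stmt D → Stmt D
  | .bool, s => s
  | .out 0, s => s.returnToYield r
  | .out (_ + 1), s => s.guardReturn r

/-- The type of a statement after the elimination of return statements. -/
def Ty.elimRet : Ty → Ty
  | .out 0 => .out 1
  | τ => τ

/-- The statement is well typed and has no redexes of the steps A–F. -/
structure Stmt.Fine (Γ : Ctx D) (φ : List Bool) (τ : Ty) (s : Stmt D) : Prop where
  type : s.HasType Γ τ
  no : s.NoLt 6 φ

theorem BExpr.HasType.fine {Γ : Ctx D} {φ : List Bool} {K : ℕ} (hK : Γ.bools ≤ K) :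
    ∀ {e : BExpr D}, e.HasType Γ → (∀ X : Pass, X.num < 5 → e.No X φ) →
      (e.rewrite returnRules φ).HasType ((Γ.rw returnRules φ []).withBools K) ∧
        ∀ X : Pass, X.num < 6 → (e.rewrite returnRules φ).No X φ
  | .tt, _, _ | .ff, _, _ => ⟨trivial, fun _ _ => trivial⟩
  | .bvar _, h, _ => ⟨lt_of_lt_of_le h hK, fun _ _ => trivial⟩
  | .comp _ _ _, ⟨_, hi, hj⟩, _ =>
      ⟨⟨_, Ctx.getElem?_rw_poss (F := []) hi, Ctx.getElem?_rw_poss (F := []) hj⟩, fun _ _ => trivial⟩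
  | .not e, h, hn => BExpr.HasType.fine (e := e) hK h hn
  | .bin _ _ _, h, hn =>
      have h₁ := BExpr.HasType.fine hK h.1 fun X hX => (hn X hX).1
      have h₂ := BExpr.HasType.fine hK h.2 fun X hX => (hn X hX).2
      ⟨⟨h₁.1, h₂.1⟩, fun X hX => ⟨h₁.2 X hX, h₂.2 X hX⟩⟩
  | .litEq c o, ⟨n, hc, ho⟩, hn => by
      obtain ⟨a, x, rfl, rfl, hx⟩ := (hn .A (by decide)).1 rfl
      exact ⟨⟨n, hc, ho⟩, fun X _ => ⟨fun _ => ⟨a, x, rfl, rfl, hx⟩, trivial⟩⟩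
  | .call _ _, _, hn => absurd rfl (hn .C (by decide)).1
  | .gen _, _, hn => absurd rfl (hn .D (by decide)).1

theorem Stmt.Fine.guardReturn_yieldChar {Γ : Ctx D} {φ : List Bool} {τ : Ty} {o : OExpr D} {r : ℕ}
    (h : (yieldChar o).Fine Γ φ τ) (hr : r < Γ.bools) :
    ((yieldChar o).guardReturn r).Fine Γ φ τ := by
  obtain ⟨h, hn⟩ := h
  rcases o with _ | _ | _ | _ | ⟨_ | n, s⟩
  case gen.zero =>
    obtain ⟨n, h₁, h₂⟩ := h
    exact ⟨⟨n, h₁, hr, trivial, h₂⟩, fun X hX => ⟨(hn X hX).1, (hn X hX).2.1,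
      fun hH => by simp [hH, Pass.num] at hX, trivial, trivial, (hn X hX).2.2⟩⟩
  all_goals
    exact ⟨⟨hr, trivial, h⟩, fun X hX =>
      ⟨fun hH => by simp [hH, Pass.num] at hX, trivial, trivial, hn X hX⟩⟩

theorem Pass.ne_H_of_lt {X : Pass} (h : X.num < 6) : X ≠ .H := by rintro rfl; simp [Pass.num] at h

theorem Pass.ne_G_of_lt {X : Pass} (h : X.num < 6) : X ≠ .G := by rintro rfl; simp [Pass.num] at h

/-- The rewritten list expression is correct, when it is yielded and, unless it is a single character,
by itself. -/
structure OExpr.Fine (Γ : Ctx D) (φ : List Bool) (n : ℕ) (o : OExpr D) : Prop where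
  yield : (yieldChar o).Fine Γ φ (.out (n + 1))
  type : n ≠ 0 → o.HasType Γ n
  no : n ≠ 0 → ∀ X : Pass, X.num < 6 → o.No X φ

theorem OExpr.Fine.of_type {Γ : Ctx D} {φ : List Bool} {n : ℕ} {o : OExpr D} (h : o.HasType Γ n)
    (hn : ∀ X : Pass, X.num < 6 → o.No X φ) : o.Fine Γ φ n := by
  refine ⟨?_, fun _ => h, fun _ => hn⟩
  rcases o with _ | _ | _ | _ | ⟨_ | m, s⟩
  case gen.zero => exact absurd rfl ((hn .F (by decide)).1 rfl)
  all_goals exact ⟨⟨n, rfl, h⟩, hn⟩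

theorem Stmt.Fine.letBool {Γ : Ctx D} {φ : List Bool} {τ : Ty} {s : Stmt D}
    (h : s.Fine Γ.addBool φ τ) : (Stmt.letBool s).Fine Γ φ τ := ⟨h.type, h.no⟩

mutual

theorem OExpr.HasType.fine {Γ : Ctx D} {φ : List Bool} (hF : Γ.funs = []) (hΓ : Γ.WT) (K : ℕ) :
    ∀ {o : OExpr D} {n : ℕ}, o.HasType Γ n → (∀ X : Pass, X.num < 5 → o.No X φ) →
      (o.rewrite returnRules φ).Fine ((Γ.rw returnRules φ []).withBools K) φ n
  | .var _, _, h, _ => .of_type h fun _ _ => trivial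
  | .const c, _, h, hn => .of_type h fun X hX _ => (hn .B (by decide)) rfl
  | .list _ _, _, _, hn => absurd rfl (hn .B (by decide)).1
  | .call _ _, _, _, hn => absurd rfl (hn .C (by decide)).1
  | .gen 0 s, n, h, hn => by
      obtain rfl := h.1
      have := Stmt.HasType.fine (Γ := Γ.hideBools) (s := s) hF hΓ.hideBools h.2
        (fun X hX => (hn X hX).2) (r := 0) (K := 1) (fun _ => by omega) (by simp [Ctx.hideBools])
      exact ⟨⟨⟨0, ⟨rfl, this.type⟩, ⟨0, rfl, rfl⟩⟩, fun X hX =>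
        ⟨fun hG => absurd hG (Pass.ne_G_of_lt hX), ⟨fun _ => by omega, this.no X hX⟩, trivial⟩⟩,
        nofun, nofun⟩
  | .gen (m + 1) s, n, h, hn => by
      obtain rfl := h.1
      have := Stmt.HasType.fine (Γ := Γ.hideBools) (s := s) hF hΓ.hideBools h.2
        (fun X hX => (hn X hX).2) (r := 0) (K := 1) (fun _ => by omega) (by simp [Ctx.hideBools])
      exact .of_type ⟨rfl, this.type⟩ fun X hX => ⟨fun _ => by omega, this.no X hX⟩

theorem Stmt.HasType.fine {Γ : Ctx D} {φ : List Bool} (hF : Γ.funs = []) (hΓ : Γ.WT) :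
    ∀ {s : Stmt D} {τ : Ty}, s.HasType Γ τ → s.NoLt 5 φ → ∀ {r K : ℕ}, (τ ≠ .bool → r < K) → Γ.bools ≤ K →
      ((s.rewrite returnRules φ).elimRet r τ).Fine ((Γ.rw returnRules φ []).withBools K) φ τ.elimRet
  | .skip, τ, _, _, _, _, _, _ => by
      rcases τ with _ | _ | _ <;> exact ⟨trivial, fun _ _ => trivial⟩
  | .setTrue b, τ, h, _, _, _, _, hK => by
      have : b < _ := lt_of_lt_of_le h hK
      rcases τ with _ | _ | _ <;> exact ⟨this, fun _ _ => trivial⟩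
  | .ite e s t, τ, h, hn, r, K, hr, hK => by
      have he := h.1.fine hK fun X hX => (hn X hX).2.1
      have hs := h.2.1.fine hF hΓ (fun X hX => (hn X hX).2.2.1) hr hK
      have ht := h.2.2.fine hF hΓ (fun X hX => (hn X hX).2.2.2) hr hK
      rcases τ with _ | _ | _ <;> exact ⟨⟨he.1, hs.type, ht.type⟩, fun X hX =>
        ⟨fun hH => absurd hH (Pass.ne_H_of_lt hX), he.2 X hX, hs.no X hX, ht.no X hX⟩⟩
  | .yield o, τ, ⟨n, hτ, h⟩, hn, r, K, hr, _ => by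
      subst hτ
      replace hr : r < K := hr nofun
      exact (OExpr.HasType.fine hF hΓ K h hn).yield.guardReturn_yieldChar hr
  | .ret o, τ, ⟨n, hτ, h⟩, hn, r, K, hr, _ => by
      subst hτ
      replace hr : r < K := hr nofun
      have ho := OExpr.HasType.fine hF hΓ K h fun X hX => (hn X hX).2
      rcases n with _ | n
      · exact ⟨⟨hr, trivial, ho.yield.type, hr⟩, fun X hX =>
          ⟨fun hH => absurd hH (Pass.ne_H_of_lt hX), trivial, trivial,
            fun hH => absurd hH (Pass.ne_H_of_lt hX), ho.yield.no X hX, trivial⟩⟩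
      · exact ⟨⟨hr, trivial, ⟨n, ho.type (by omega), n, rfl, rfl⟩, hr⟩, fun X hX =>
          ⟨fun hH => absurd hH (Pass.ne_H_of_lt hX), trivial, trivial,
            fun hH => absurd hH (Pass.ne_H_of_lt hX),
            ⟨fun hG => absurd hG (Pass.ne_G_of_lt hX), ho.no (by omega) X hX, trivial⟩, trivial⟩⟩
  | .bret e, τ, h, hn, _, _, _, hK => by
      obtain rfl := h.1
      have he := h.2.fine (φ := φ) hK hn
      exact ⟨⟨rfl, he.1⟩, he.2⟩
  | .letOut _ _, _, _, hn, _, _, _, _ => absurd rfl (hn .E (by decide)).1.1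
  | .letBool s, τ, h, hn, r, K, hr, hK => by
      have := Stmt.HasType.fine (Γ := Γ.addBool) (s := s) (r := r + 1) (K := K + 1) hF hΓ.addBool h
        hn (fun hτ => by have := hr hτ; omega) (by simpa [Ctx.addBool] using hK)
      rcases τ with _ | _ | _
      · exact ⟨this.type, this.no⟩
      · exact ⟨this.type, this.no⟩
      · exact ⟨this.type, this.no⟩
  | .loop d o s, τ, ⟨n, ho, h⟩, hn, r, K, hr, hK => by
      have ho' := OExpr.HasType.fine hF hΓ K ho fun X hX => (hn X hX).2.1
      have := Stmt.HasType.fine (Γ := Γ.addLoop o n) (s := s) (φ := true :: φ) hF (hΓ.addLoop ho) h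
        (fun X hX => (hn X hX).2.2) hr hK
      rw [Ctx.rw_addLoop (returnRules_natural _) hΓ φ [] ho] at this
      have hno : ∀ X : Pass, X.num < 6 →
          (Stmt.loop d (o.rewrite returnRules φ)
            ((s.rewrite returnRules (true :: φ)).elimRet r τ)).No X φ := fun X hX =>
        ⟨fun hG => absurd hG (Pass.ne_G_of_lt hX), ho'.no (by omega) X hX, this.no X hX⟩
      rcases τ with _ | _ | _ <;> exact ⟨⟨n, ho'.type (by omega), this.type⟩, hno⟩
  | .seq s t, τ, h, hn, r, K, hr, hK => by
      have hs := h.1.fine hF hΓ (fun X hX => (hn X hX).2.1) hr hK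
      have ht := h.2.fine hF hΓ (fun X hX => (hn X hX).2.2) hr hK
      rcases τ with _ | _ | _ <;> exact ⟨⟨hs.type, ht.type⟩, fun X hX =>
        ⟨fun hH => absurd hH (Pass.ne_H_of_lt hX), hs.no X hX, ht.no X hX⟩⟩

end

/-- One application of step F keeps the type and leaves no redexes of the steps A–F. -/
theorem step_F_spec {P Q : Prog D} {σ : Sig} (hP : InScope .F P σ) (h : Step .F P Q) :
    Q.HasType σ ∧ ∀ Y : Pass, Y.num < 6 → Irreducible Y Q := by
  obtain ⟨hP, hI, hσ⟩ := hP
  obtain ⟨s, rfl, hs⟩ := hP.eq_single (hI .C (by decide))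
  have hn := hs.irreducible_iff.1 hI
  cases h
  have := fun K hK => hs.fine rfl (bodyCtx_wt _ _) hn (r := 0) (K := K) hK (by simp [bodyCtx])
  rw [bodyCtx_rw] at this
  obtain ⟨ps, τ⟩ := σ
  suffices ∃ t : Stmt D, elimReturnFn ⟨ps, τ, s⟩ = ⟨ps, τ, t⟩ ∧ t.Fine (bodyCtx [] ps) [] τ by
    obtain ⟨t, ht, hf⟩ := this
    simp only [List.map_cons, List.map_nil, ht]
    exact ⟨Prog.hasType_single (σ := ⟨ps, τ⟩).2 hf.type,
      Stmt.HasType.irreducible_iff (σ := ⟨ps, τ⟩) hf.type |>.2 hf.no⟩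
  rcases τ with _ | _ | n
  · exact ⟨_, rfl, this 0 (absurd rfl)⟩
  · exact absurd rfl hσ
  · exact ⟨_, rfl, (this 1 fun _ => by omega).letBool⟩

/-! ### Expanded programs -/

/-- Tests of expanded programs, with `p` loops over the input word and `b` booleans in scope. -/
def BExpr.Tgt (p b : ℕ) : BExpr D → Prop
  | .tt => True
  | .ff => True
  | .not e => e.Tgt p b
  | .bin _ e₁ e₂ => e₁.Tgt p b ∧ e₂.Tgt p b
  | .bvar x => x < b
  | .comp _ i j => i < p ∧ j < p
  | .litEq c o => ∃ a x, c = .char a ∧ o = .var x ∧ x < p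
  | .call _ _ => False
  | .gen _ => False

mutual

/-- List expressions of depth `n` in expanded programs. -/
def OExpr.Tgt (p n : ℕ) : OExpr D → Prop
  | .var x => n = 0 ∧ x < p ∨ n = 1 ∧ x = p
  | .const c => n = 0 ∧ ∃ a, c = .char a
  | .gen m s => n = m ∧ n ≠ 0 ∧ s.Tgt p 0 m
  | _ => False

/-- Statements of type `Out[n]` in expanded programs: all the loops are over the input word. -/
def Stmt.Tgt (p b n : ℕ) : Stmt D → Prop
  | .skip => True
  | .ite e s t => e.Tgt p b ∧ s.Tgt p b n ∧ t.Tgt p b n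
  | .yield o => ∃ m, n = m + 1 ∧ o.Tgt p m
  | .letBool s => s.Tgt p (b + 1) n
  | .setTrue x => x < b
  | .loop _ o s => o = .var p ∧ s.Tgt (p + 1) b n
  | .seq s t => s.Tgt p b n ∧ t.Tgt p b n
  | _ => False

end

theorem BExpr.Tgt.ren {p p' b b' : ℕ} {l q β : ℕ → ℕ} (hl : ∀ x < p, l x < p')
    (hq : ∀ x < p, q x < p') (hβ : ∀ x < b, β x < b') : ∀ {e : BExpr D}, e.Tgt p b →
      (e.ren l q β).Tgt p' b'
  | .tt, _ | .ff, _ => trivial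
  | .not e, h => BExpr.Tgt.ren (e := e) hl hq hβ h
  | .bin _ _ _, h => ⟨h.1.ren hl hq hβ, h.2.ren hl hq hβ⟩
  | .bvar x, h => hβ x h
  | .comp _ _ _, h => ⟨hq _ h.1, hq _ h.2⟩
  | .litEq _ _, ⟨a, x, hc, ho, hx⟩ => ⟨a, l x, hc, by rw [ho]; rfl, hl x hx⟩

mutual

theorem OExpr.Tgt.ren : ∀ {o : OExpr D} {p p' n : ℕ} {l q : ℕ → ℕ}, (∀ x < p, l x < p') →
    l p = p' → (∀ x < p, q x < p') → o.Tgt p n → (o.ren l q).Tgt p' n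
  | .var x, _, _, _, _, _, hl, hp, _, h => by
      rcases h with ⟨hn, hx⟩ | ⟨hn, rfl⟩
      · exact .inl ⟨hn, hl x hx⟩
      · exact .inr ⟨hn, hp⟩
  | .const _, _, _, _, _, _, _, _, _, h => h
  | .gen _ _, _, _, _, _, _, hl, hp, hq, h =>
      ⟨h.1, h.2.1, h.2.2.ren hl hp hq fun _ h => h⟩

theorem Stmt.Tgt.ren : ∀ {s : Stmt D} {p p' b b' n : ℕ} {l q β : ℕ → ℕ}, (∀ x < p, l x < p') →
    l p = p' → (∀ x < p, q x < p') → (∀ x < b, β x < b') → s.Tgt p b n →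
      (s.ren l q β).Tgt p' b' n
  | .skip, _, _, _, _, _, _, _, _, _, _, _, _, _ => trivial
  | .ite _ _ _, _, _, _, _, _, _, _, _, hl, hp, hq, hβ, h =>
      ⟨h.1.ren hl hq hβ, h.2.1.ren hl hp hq hβ, h.2.2.ren hl hp hq hβ⟩
  | .yield _, _, _, _, _, _, _, _, _, hl, hp, hq, _, ⟨m, hm, h⟩ => ⟨m, hm, h.ren hl hp hq⟩
  | .letBool s, _, _, _, _, _, _, _, _, hl, hp, hq, hβ, h =>
      Stmt.Tgt.ren (s := s) hl hp hq (up_lt hβ) h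
  | .setTrue x, _, _, _, _, _, _, _, _, _, _, _, hβ, h => hβ x h
  | .loop _ _ _, _, _, _, _, _, _, _, _, hl, hp, hq, hβ, h =>
      ⟨by rw [h.1, OExpr.ren, hp], h.2.ren (up_lt hl) (by simp [up, hp]) (up_lt hq) hβ⟩
  | .seq _ _, _, _, _, _, _, _, _, _, hl, hp, hq, hβ, h =>
      ⟨h.1.ren hl hp hq hβ, h.2.ren hl hp hq hβ⟩

end

theorem OExpr.Tgt.shift {o : OExpr D} {p n : ℕ} (h : o.Tgt p n) (k : ℕ) :
    (o.ren (· + k) (· + k)).Tgt (p + k) n :=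
  h.ren (fun _ hx => by simpa using hx) rfl (fun _ hx => by simpa using hx)

theorem Stmt.Tgt.shift {s : Stmt D} {p b n : ℕ} (h : s.Tgt p b n) (k : ℕ) :
    (s.ren (· + k) (· + k) id).Tgt (p + k) b n :=
  h.ren (fun _ hx => by simpa using hx) rfl (fun _ hx => by simpa using hx) fun _ hx => hx

theorem BExpr.Tgt.mono {e : BExpr D} {p b b' : ℕ} (h : e.Tgt p b) (hb : b ≤ b') : e.Tgt p b' := by
  simpa only [BExpr.ren_id] using
    h.ren (l := id) (q := id) (β := id) (fun _ h => h) (fun _ h => h) fun _ hx => hx.trans_le hb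

/-- The position variables of the address are among the `p` innermost ones. -/
def Addr.Lt (p : ℕ) (a : Addr) : Prop := ∀ d i, AStep.loop d i ∈ a → i < p

theorem Addr.Lt.nil (p : ℕ) : Addr.Lt p [] := fun _ _ h => by simp at h

theorem Addr.Lt.append {p : ℕ} {a a' : Addr} (h : a.Lt p) (h' : Addr.Lt p a') :
    Addr.Lt p (a ++ a') := fun d i hi => (List.mem_append.1 hi).elim (h d i) (h' d i)

theorem Addr.Lt.left {p : ℕ} {a : Addr} (h : a.Lt p) : Addr.Lt p (a ++ [.left]) :=
  h.append fun _ _ h => by simp at h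

theorem Addr.Lt.right {p : ℕ} {a : Addr} (h : a.Lt p) : Addr.Lt p (a ++ [.right]) :=
  h.append fun _ _ h => by simp at h

theorem Addr.Lt.shift {p : ℕ} {a : Addr} (h : a.Lt p) (k : ℕ) : (a.shift k).Lt (p + k) := by
  intro d i hi
  obtain ⟨st, hst, he⟩ := List.mem_map.1 hi
  cases st with
  | left => cases he
  | right => cases he
  | loop d' j =>
      have := h d' j hst
      simp only [AStep.loop.injEq] at he
      omega

theorem Addr.Lt.loop {p : ℕ} {a : Addr} (h : a.Lt p) (d : Dir) :
    Addr.Lt (p + 1) (a.shift 1 ++ [.loop d 0]) :=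
  (h.shift 1).append fun _ _ h => by simp at h; omega

theorem Addr.Lt.of_cons {p : ℕ} {st : AStep} {a : Addr} (h : Addr.Lt p (st :: a)) : a.Lt p :=
  fun d i hi => h d i (List.mem_cons_of_mem _ hi)

theorem Addr.Lt.eqTest {p b : ℕ} : ∀ {a a' : Addr}, a.Lt p → a'.Lt p →
    (Addr.eqTest (D := D) a a').Tgt p b
  | [], [], _, _ => trivial
  | .left :: a, .left :: a', h, h' => Addr.Lt.eqTest (a := a) (a' := a') h.of_cons h'.of_cons
  | .right :: a, .right :: a', h, h' => Addr.Lt.eqTest (a := a) (a' := a') h.of_cons h'.of_cons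
  | .loop _ _ :: _, .loop _ _ :: _, h, h' =>
      ⟨⟨h _ _ List.mem_cons_self, h' _ _ List.mem_cons_self⟩, h.of_cons.eqTest h'.of_cons⟩
  | [], _ :: _, _, _ | _ :: _, [], _, _ | .left :: _, .right :: _, _, _
  | .left :: _, .loop _ _ :: _, _, _ | .right :: _, .left :: _, _, _
  | .right :: _, .loop _ _ :: _, _, _ | .loop _ _ :: _, .left :: _, _, _
  | .loop _ _ :: _, .right :: _, _, _ => by simp [Addr.eqTest, BExpr.Tgt]

theorem Addr.Lt.before {p b : ℕ} : ∀ {a a' : Addr}, a.Lt p → a'.Lt p →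
    (Addr.before (D := D) a a').Tgt p b
  | .left :: a, .left :: a', h, h' => Addr.Lt.before (a := a) (a' := a') h.of_cons h'.of_cons
  | .right :: a, .right :: a', h, h' => Addr.Lt.before (a := a) (a' := a') h.of_cons h'.of_cons
  | .loop _ _ :: _, .loop _ _ :: _, h, h' =>
      ⟨⟨h _ _ List.mem_cons_self, h' _ _ List.mem_cons_self⟩,
        ⟨h _ _ List.mem_cons_self, h' _ _ List.mem_cons_self⟩, h.of_cons.before h'.of_cons⟩
  | [], [], _, _ | [], _ :: _, _, _ | _ :: _, [], _, _ | .left :: _, .right :: _, _, _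
  | .left :: _, .loop _ _ :: _, _, _ | .right :: _, .left :: _, _, _
  | .right :: _, .loop _ _ :: _, _, _ | .loop _ _ :: _, .left :: _, _, _
  | .loop _ _ :: _, .right :: _, _, _ => by simp [Addr.before, BExpr.Tgt]

theorem Addr.Lt.comp {p b : ℕ} {a a' : Addr} (h : a.Lt p) (h' : a'.Lt p) :
    ∀ op : CmpOp, (Addr.comp (D := D) op a a').Tgt p b
  | .eq => h.eqTest h'
  | .ne => Addr.Lt.eqTest (D := D) h h'
  | .lt => h.before h'
  | .le => ⟨h.before h', h.eqTest h'⟩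
  | .gt => h'.before h
  | .ge => ⟨h'.before h, h.eqTest h'⟩

/-- The position variables are among the `p` innermost ones. -/
def PVal.Lt (p : ℕ) : PVal → Prop
  | .pos i => i < p
  | .addr a => a.Lt p

theorem PVal.Lt.shift {p : ℕ} : ∀ {v : PVal}, v.Lt p → ∀ k, (v.shift k).Lt (p + k)
  | .pos _, h, k => Nat.add_lt_add_right h k
  | .addr _, h, k => Addr.Lt.shift h k

theorem PVal.Lt.comp {p b : ℕ} (op : CmpOp) : ∀ {v v' : PVal}, v.Lt p → v'.Lt p →
    (PVal.comp (D := D) op v v').Tgt p b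
  | .pos _, .pos _, h, h' => ⟨h, h'⟩
  | .addr _, .addr _, h, h' => Addr.Lt.comp h h' op
  | .pos _, .addr _, _, _ | .addr _, .pos _, _, _ => trivial

theorem Stmt.Tgt.replaceYields {κ : ℕ → ℕ → Addr → OExpr D → Stmt D} {p b n n' : ℕ}
    (hκ : ∀ k m a e, Addr.Lt (p + k) a → e.Tgt (p + k) n → (κ k m a e).Tgt (p + k) (b + m) n') :
    ∀ {s : Stmt D} {k m : ℕ} {a : Addr}, s.Tgt (p + k) m (n + 1) → a.Lt (p + k) →
      (s.replaceYields κ k m a).Tgt (p + k) (b + m) n'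
  | .skip, _, _, _, _, _ => trivial
  | .ite _ _ _, _, _, _, h, ha => ⟨h.1.mono (by omega), h.2.1.replaceYields hκ ha.left,
      h.2.2.replaceYields hκ ha.right⟩
  | .yield e, k, m, a, ⟨j, hj, h⟩, ha => by
      obtain rfl : n = j := by omega
      exact hκ k m a e ha h
  | .letBool s, k, m, a, h, ha => Stmt.Tgt.replaceYields (s := s) (m := m + 1) hκ h ha
  | .setTrue x, _, m, _, h, _ => (show x < m from h).trans_le (by omega)
  | .loop d o s, k, m, a, h, ha =>
      ⟨h.1, Stmt.Tgt.replaceYields (s := s) (k := k + 1) hκ h.2 (ha.loop d)⟩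
  | .seq _ _, _, _, _, h, ha => ⟨h.1.replaceYields hκ ha.left, h.2.replaceYields hκ ha.right⟩

theorem Stmt.Tgt.reverseYields {κ : ℕ → ℕ → Addr → OExpr D → Stmt D} {p b n n' : ℕ}
    (hκ : ∀ k m a e, Addr.Lt (p + k) a → e.Tgt (p + k) n → (κ k m a e).Tgt (p + k) (b + m) n')
    {s₀ : Stmt D} (h₀ : s₀.Tgt p 0 (n + 1)) :
    ∀ {s : Stmt D} {k m : ℕ} {a : Addr}, s.Tgt (p + k) m (n + 1) → a.Lt (p + k) →
      (reverseYields s₀ κ k a s).Tgt (p + k) b n'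
  | .skip, _, _, _, _, _ | .setTrue _, _, _, _, _, _ => trivial
  | .ite _ _ _, _, _, _, h, ha =>
      ⟨Stmt.Tgt.reverseYields hκ h₀ h.2.2 ha.right, Stmt.Tgt.reverseYields hκ h₀ h.2.1 ha.left⟩
  | .yield e, k, m, a, _, ha => by
      refine Stmt.Tgt.replaceYields (p := p + k) (b := b) (k := 0) (m := 0) (n := n) ?_
        (h₀.shift k) (Addr.Lt.nil _)
      intro k' m a' e ha' he
      refine ⟨ha'.eqTest (ha.shift k'), ?_, trivial⟩
      rw [Nat.add_assoc] at ha' he ⊢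
      exact hκ _ _ _ _ ha' he
  | .letBool s, k, m, a, h, ha =>
      Stmt.Tgt.reverseYields (s := s) (m := m + 1) hκ h₀ h ha
  | .loop d o s, k, m, a, h, ha =>
      ⟨h.1, Stmt.Tgt.reverseYields (s := s) (k := k + 1) hκ h₀ h.2 (ha.loop d)⟩
  | .seq _ _, _, _, _, h, ha =>
      ⟨Stmt.Tgt.reverseYields hκ h₀ h.2 ha.right, Stmt.Tgt.reverseYields hκ h₀ h.1 ha.left⟩

/-- The environment maps the variables of `Γ` to expanded terms with `p` loops over the input word and
`b` booleans in scope. -/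
structure GEnv.Rel (Γ : Ctx D) (ρ : GEnv D) (p b : ℕ) : Prop where
  lists : ∀ x n, Γ.lists[x]? = some n → (ρ.lists x).Tgt p n
  poss : ∀ i o, Γ.poss[i]? = some o → (ρ.poss i).Lt p
  bools : ∀ x < Γ.bools, ρ.bools x < b

theorem GEnv.Rel.shift {Γ : Ctx D} {ρ : GEnv D} {p b : ℕ} (h : ρ.Rel Γ p b) (k m : ℕ) :
    (ρ.shift k m).Rel Γ (p + k) (b + m) where
  lists x n hx := (h.lists x n hx).shift k
  poss i o hi := (h.poss i o hi).shift k
  bools x hx := Nat.add_lt_add_right (h.bools x hx) m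

theorem GEnv.Rel.bindLoop {Γ : Ctx D} {ρ : GEnv D} {p b : ℕ} (h : ρ.Rel Γ p b) (o : OExpr D)
    {n : ℕ} {v : OExpr D} {i : PVal} (hv : v.Tgt p n) (hi : i.Lt p) :
    (ρ.bindLoop v i).Rel (Γ.addLoop o n) p b where
  lists
    | 0, m, hx => by cases hx; exact hv
    | x + 1, m, hx => h.lists x m hx
  poss
    | 0, _, _ => hi
    | i + 1, o', ho' => by
        simp only [Ctx.addLoop, List.map_cons, List.getElem?_cons_succ, List.getElem?_map,
          Option.map_eq_some_iff] at ho'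
        obtain ⟨o'', h', -⟩ := ho'
        exact h.poss i o'' h'
  bools := h.bools

theorem GEnv.Rel.bindBool {Γ : Ctx D} {ρ : GEnv D} {p b : ℕ} (h : ρ.Rel Γ p b) :
    ρ.bindBool.Rel Γ.addBool p (b + 1) := ⟨h.lists, h.poss, up_lt h.bools⟩

theorem GEnv.Rel.hideBools {Γ : Ctx D} {ρ : GEnv D} {p b : ℕ} (h : ρ.Rel Γ p b) :
    GEnv.Rel Γ.hideBools { ρ with bools := id } p 0 := ⟨h.lists, h.poss, fun _ h => h⟩

theorem expandLitEq_tgt {a : D} {o : OExpr D} {p b : ℕ} (h : o.Tgt p 0) :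
    (expandLitEq (.char a) o).Tgt p b := by
  rcases o with x | c | _ | _ | _
  · simp only [OExpr.Tgt, true_and, zero_ne_one, false_and, or_false] at h
    exact ⟨a, x, rfl, rfl, h⟩
  · obtain ⟨-, a', rfl⟩ := h
    simp only [expandLitEq]
    split_ifs <;> trivial
  · exact absurd h id
  · exact absurd h id
  · exact absurd rfl h.2.1

theorem BExpr.HasType.expand {Γ : Ctx D} {φ : List Bool} {ρ : GEnv D} {p b : ℕ}
    (hρ : ρ.Rel Γ p b) : ∀ {e : BExpr D}, e.HasType Γ →
      (∀ X : Pass, X.num < 6 → e.No X φ) → (e.expand ρ).Tgt p b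
  | .tt, _, _ | .ff, _, _ => trivial
  | .bvar x, h, _ => hρ.bools x h
  | .comp op i j, ⟨o, hi, hj⟩, _ => (hρ.poss i o hi).comp op (hρ.poss j o hj)
  | .not e, h, hn => BExpr.HasType.expand (e := e) hρ h hn
  | .bin _ _ _, h, hn => ⟨BExpr.HasType.expand hρ h.1 fun X hX => (hn X hX).1,
      BExpr.HasType.expand hρ h.2 fun X hX => (hn X hX).2⟩
  | .litEq c o, ⟨n, hc, ho⟩, hn => by
      obtain ⟨a, x, rfl, rfl, hx⟩ := (hn .A (by decide)).1 rfl
      obtain rfl : n = 0 := hc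
      exact expandLitEq_tgt (hρ.lists x 0 ho)
  | .call _ _, _, hn => absurd rfl (hn .C (by decide)).1
  | .gen _, _, hn => absurd rfl (hn .D (by decide)).1

mutual

theorem OExpr.HasType.expand : ∀ {o : OExpr D} {Γ : Ctx D} {φ : List Bool} {ρ : GEnv D}
    {p b n : ℕ}, ρ.Rel Γ p b → o.HasType Γ n → (∀ X : Pass, X.num < 6 → o.No X φ) →
      (o.expand ρ).Tgt p n
  | .var x, _, _, _, _, _, n, hρ, h, _ => hρ.lists x n h
  | .const c, _, _, _, _, _, n, _, h, hn => by
      obtain ⟨a, rfl⟩ := hn .B (by decide) rfl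
      exact ⟨h, a, rfl⟩
  | .list _ _, _, _, _, _, _, _, _, _, hn => absurd rfl (hn .B (by decide)).1
  | .call _ _, _, _, _, _, _, _, _, _, hn => absurd rfl (hn .C (by decide)).1
  | .gen _ _, _, _, _, _, _, _, hρ, h, hn =>
      ⟨h.1, h.1 ▸ (hn .F (by decide)).1 rfl,
        Stmt.HasType.expand hρ.hideBools h.2 fun X hX => (hn X hX).2⟩

theorem Stmt.HasType.expand : ∀ {s : Stmt D} {Γ : Ctx D} {φ : List Bool} {ρ : GEnv D}
    {p b n : ℕ}, ρ.Rel Γ p b → s.HasType Γ (.out n) → s.NoLt 6 φ → (s.expand ρ).Tgt p b n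
  | .skip, _, _, _, _, _, _, _, _, _ => trivial
  | .ite _ _ _, _, _, _, _, _, _, hρ, h, hn =>
      ⟨h.1.expand hρ fun X hX => (hn X hX).2.1,
        Stmt.HasType.expand hρ h.2.1 fun X hX => (hn X hX).2.2.1,
        Stmt.HasType.expand hρ h.2.2 fun X hX => (hn X hX).2.2.2⟩
  | .yield o, _, _, _, _, _, _, hρ, ⟨m, hm, h⟩, hn =>
      ⟨m, by simpa using hm, OExpr.HasType.expand (o := o) hρ h hn⟩
  | .ret _, _, _, _, _, _, _, _, _, hn => absurd rfl (hn .F (by decide)).1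
  | .bret _, _, _, _, _, _, _, _, h, _ => by simpa using h.1
  | .letOut _ _, _, _, _, _, _, _, _, _, hn => absurd rfl (hn .E (by decide)).1.1
  | .letBool s, _, _, _, _, _, _, hρ, h, hn =>
      Stmt.HasType.expand (s := s) hρ.bindBool h hn
  | .setTrue x, _, _, _, _, _, _, hρ, h, _ => hρ.bools x h
  | .loop d o s, Γ, φ, ρ, p, b, n, hρ, ⟨m, ho, h⟩, hn => by
      have ho' := OExpr.HasType.expand hρ ho fun X hX => (hn X hX).2.1
      have hs : ∀ {ρ : GEnv D} {p b : ℕ}, ρ.Rel (Γ.addLoop o m) p b → (s.expand ρ).Tgt p b n :=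
        fun hρ => Stmt.HasType.expand hρ h fun X hX => (hn X hX).2.2
      simp only [Stmt.expand]
      generalize o.expand ρ = o' at ho' ⊢
      rcases o' with x | _ | _ | _ | ⟨m', t⟩
      · obtain ⟨hm, rfl⟩ : m = 0 ∧ x = p := by simpa [OExpr.Tgt] using ho'
        subst hm
        exact ⟨rfl, hs ((hρ.shift 1 0).bindLoop o (.inl ⟨rfl, by omega⟩) (Nat.succ_pos _))⟩
      · exact absurd ho'.1 (by omega)
      · exact absurd ho' id
      · exact absurd ho' id
      · obtain ⟨rfl, -, ht⟩ := ho'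
        have hκ : ∀ k i a e, Addr.Lt (p + k) a → OExpr.Tgt (p + k) m e →
            (s.expand ((ρ.shift k i).bindLoop e (.addr a))).Tgt (p + k) (b + i) n :=
          fun k i a e ha he => hs ((hρ.shift k i).bindLoop o he ha)
        cases d with
        | fwd => exact Stmt.Tgt.replaceYields (k := 0) (m := 0) hκ ht (Addr.Lt.nil _)
        | bwd => exact Stmt.Tgt.reverseYields (k := 0) (m := 0) hκ ht ht (Addr.Lt.nil _)
  | .seq _ _, _, _, _, _, _, _, hρ, h, hn =>
      ⟨Stmt.HasType.expand hρ h.1 fun X hX => (hn X hX).2.1,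
        Stmt.HasType.expand hρ h.2 fun X hX => (hn X hX).2.2⟩

end

/-! ### Typing of expanded programs -/

/-- The context below `p` loops over the input word. -/
def wordCtx (p b : ℕ) : Ctx D := ⟨[], List.replicate p 0 ++ [1], List.replicate p (.var p), b⟩

theorem wordCtx_addLoop (p b : ℕ) :
    (wordCtx p b : Ctx D).addLoop (.var p) 0 = wordCtx (p + 1) b := by
  simp [wordCtx, Ctx.addLoop, List.replicate_succ, OExpr.ren]

theorem wordCtx_lists (p b x n : ℕ) :
    (wordCtx p b : Ctx D).lists[x]? = some n ↔ n = 0 ∧ x < p ∨ n = 1 ∧ x = p := by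
  rcases lt_trichotomy x p with h | rfl | h
  · simp [wordCtx, List.getElem?_append_left, h, eq_comm]
    omega
  · simp [wordCtx, eq_comm]
  · have : (wordCtx p b : Ctx D).lists[x]? = none :=
      List.getElem?_eq_none (by simp [wordCtx]; omega)
    simp only [this, reduceCtorEq, false_iff]
    omega

theorem wordCtx_poss (p b i : ℕ) (o : OExpr D) :
    (wordCtx p b : Ctx D).poss[i]? = some o ↔ i < p ∧ o = .var p := by
  simp [wordCtx, List.getElem?_replicate, eq_comm]

theorem BExpr.Tgt.hasType {p b : ℕ} : ∀ {e : BExpr D}, e.Tgt p b → e.HasType (wordCtx p b)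
  | .tt, _ | .ff, _ => trivial
  | .not e, h => BExpr.Tgt.hasType (e := e) h
  | .bin _ _ _, h => ⟨h.1.hasType, h.2.hasType⟩
  | .bvar _, h => h
  | .comp _ _ _, h => ⟨.var p, by simp [wordCtx_poss, h.1], by simp [wordCtx_poss, h.2]⟩
  | .litEq _ _, ⟨a, x, hc, ho, hx⟩ => by
      subst hc ho
      exact ⟨0, rfl, (wordCtx_lists _ _ _ _).2 (.inl ⟨rfl, hx⟩)⟩

theorem BExpr.Tgt.no {X : Pass} {p b : ℕ} : ∀ {e : BExpr D}, e.Tgt p b →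
    e.No X (List.replicate p true)
  | .tt, _ | .ff, _ | .bvar _, _ | .comp _ _ _, _ => trivial
  | .not e, h => BExpr.Tgt.no (e := e) h
  | .bin _ _ _, h => ⟨h.1.no, h.2.no⟩
  | .litEq _ _, ⟨a, x, hc, ho, hx⟩ => by
      subst hc ho
      exact ⟨fun _ => ⟨a, x, rfl, rfl, by simp [hx]⟩, trivial⟩

theorem OExpr.Tgt.hasType_no {X : Pass} {p b : ℕ} : ∀ {o : OExpr D}, o.Tgt p 0 →
    o.HasType (wordCtx p b) 0 ∧ o.No X (List.replicate p true)
  | .var _, h => ⟨(wordCtx_lists _ _ _ _).2 h, trivial⟩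
  | .const _, ⟨_, a, hc⟩ => by subst hc; exact ⟨rfl, fun _ => ⟨a, rfl⟩⟩
  | .gen _ _, h => absurd rfl h.2.1

theorem Stmt.Tgt.hasType : ∀ {s : Stmt D} {p b : ℕ}, s.Tgt p b 1 →
    s.HasType (wordCtx p b) (.out 1)
  | .skip, _, _, _ => trivial
  | .ite _ _ _, _, _, h => ⟨h.1.hasType, h.2.1.hasType, h.2.2.hasType⟩
  | .yield _, _, _, ⟨m, hm, h⟩ => by
      obtain rfl : m = 0 := by omega
      exact ⟨0, rfl, (h.hasType_no (X := .A)).1⟩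
  | .letBool s, _, _, h => Stmt.Tgt.hasType (s := s) h
  | .setTrue _, _, _, h => h
  | .loop _ _ s, p, b, ⟨ho, h⟩ => by
      subst ho
      refine ⟨0, (wordCtx_lists _ _ _ _).2 (.inr ⟨rfl, rfl⟩), ?_⟩
      rw [wordCtx_addLoop]
      exact h.hasType
  | .seq _ _, _, _, h => ⟨h.1.hasType, h.2.hasType⟩

theorem Stmt.Tgt.no {X : Pass} (hX : X ≠ .H) : ∀ {s : Stmt D} {p b : ℕ}, s.Tgt p b 1 →
    s.No X (List.replicate p true)
  | .skip, _, _, _ | .setTrue _, _, _, _ => trivial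
  | .ite _ _ _, _, _, h => ⟨fun hH => absurd hH hX, h.1.no, h.2.1.no hX, h.2.2.no hX⟩
  | .yield o, _, b, ⟨m, hm, h⟩ => by
      obtain rfl : m = 0 := by omega
      exact (OExpr.Tgt.hasType_no (b := b) h).2
  | .letBool s, _, _, h => Stmt.Tgt.no (s := s) hX h
  | .loop _ _ s, p, b, ⟨ho, h⟩ => by
      subst ho
      exact ⟨fun _ => ⟨p, rfl⟩, trivial, h.no hX⟩
  | .seq _ _, _, _, h => ⟨fun hH => absurd hH hX, h.1.no hX, h.2.no hX⟩

/-- One application of step G keeps the type and leaves no redexes of the steps A–G. -/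
theorem step_G_spec {P Q : Prog D} {σ : Sig} (hP : InScope .G P σ) (h : Step .G P Q) :
    Q.HasType σ ∧ ∀ Y : Pass, Y.num < 7 → Irreducible Y Q := by
  obtain ⟨hP, hI, rfl⟩ := hP
  obtain ⟨s, rfl, hs⟩ := hP.eq_single (hI .C (by decide))
  have hn := hs.irreducible_iff.1 hI
  cases h
  have ht : (s.expand GEnv.ident).Tgt 0 0 1 := by
    refine Stmt.HasType.expand ⟨?_, ?_, ?_⟩ hs hn
    · exact fun x n hx => (wordCtx_lists (D := D) 0 0 x n).1 hx
    · intro i o hi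
      simp [bodyCtx, wordToWord, paramPoss] at hi
    · exact fun _ h => h
  have ht' : (s.expand GEnv.ident).HasType (bodyCtx [] wordToWord.params) wordToWord.ret :=
    ht.hasType
  exact ⟨Prog.hasType_single.2 ht', ht'.irreducible_iff.2 fun X hX =>
    ht.no (by rintro rfl; simp [Pass.num] at hX)⟩

/-! ### Simple for-programs -/

theorem SBExpr.toHigh_injective : Function.Injective (SBExpr.toHigh (D := D)) := by
  intro e
  induction e with
  | not e ih =>
      intro e' h
      cases e' <;> simp only [SBExpr.toHigh, BExpr.not.injEq, reduceCtorEq] at h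
      rw [ih h]
  | bin op e₁ e₂ ih₁ ih₂ =>
      intro e' h
      cases e' <;> simp only [SBExpr.toHigh, BExpr.bin.injEq, reduceCtorEq] at h
      rw [h.1, ih₁ h.2.1, ih₂ h.2.2]
  | _ =>
      intro e' h
      cases e' <;> simp_all [SBExpr.toHigh]

theorem SStmt.not_isLetBool_toHigh (p : ℕ) : ∀ S : SStmt D, ¬ (S.toHigh p).IsLetBool
  | .skip | .ite _ _ _ | .printChar _ | .printLabel _ | .setTrue _ | .loop _ _ _ | .seq _ _ => by
      simp [SStmt.toHigh, Stmt.IsLetBool]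

theorem Stmt.splitBools_of_not_isLetBool : ∀ {s : Stmt D}, ¬ s.IsLetBool → s.splitBools = (0, s)
  | .letBool s, h => absurd ⟨s, rfl⟩ h
  | .skip, _ | .ite _ _ _, _ | .yield _, _ | .ret _, _ | .bret _, _ | .letOut _ _, _
  | .setTrue _, _ | .loop _ _ _, _ | .seq _ _, _ => rfl

theorem splitBools_letBools {s : Stmt D} (h : ¬ s.IsLetBool) : ∀ k : ℕ,
    (letBools k s).splitBools = (k, s)
  | 0 => Stmt.splitBools_of_not_isLetBool h
  | k + 1 => by simp [letBools, Stmt.splitBools, splitBools_letBools h k]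

theorem letBools_injective {s t : Stmt D} (hs : ¬ s.IsLetBool) (ht : ¬ t.IsLetBool) {k m : ℕ}
    (h : letBools k s = letBools m t) : k = m ∧ s = t := by
  have := congrArg Stmt.splitBools h
  rwa [splitBools_letBools hs, splitBools_letBools ht, Prod.mk.injEq] at this

theorem SStmt.toHigh_injective : ∀ {S S' : SStmt D} {p : ℕ}, S.toHigh p = S'.toHigh p → S = S' := by
  intro S
  induction S with
  | ite e s t ihs iht =>
      intro S' p h
      cases S' <;> simp only [SStmt.toHigh, Stmt.ite.injEq, reduceCtorEq] at h
      rw [SBExpr.toHigh_injective h.1, ihs h.2.1, iht h.2.2]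
  | loop d k s ih =>
      intro S' p h
      cases S' <;> simp only [SStmt.toHigh, Stmt.loop.injEq, reduceCtorEq] at h
      obtain ⟨hk, hs⟩ := letBools_injective (SStmt.not_isLetBool_toHigh _ _)
        (SStmt.not_isLetBool_toHigh _ _) h.2.2
      rw [h.1, hk, ih hs]
  | seq s t ihs iht =>
      intro S' p h
      cases S' <;> simp only [SStmt.toHigh, Stmt.seq.injEq, reduceCtorEq] at h
      rw [ihs h.1, iht h.2]
  | _ =>
      intro S' p h
      cases S' <;> simp_all [SStmt.toHigh]

theorem SProg.toHigh_injective : Function.Injective (SProg.toHigh (D := D)) := by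
  rintro ⟨k, S⟩ ⟨k', S'⟩ h
  simp only [SProg.toHigh, Prog.mk.injEq, List.cons.injEq, Fn.mk.injEq, true_and, and_true] at h
  obtain ⟨rfl, hS⟩ := letBools_injective (SStmt.not_isLetBool_toHigh _ _)
    (SStmt.not_isLetBool_toHigh _ _) h
  rw [SStmt.toHigh_injective hS]

/-! ### Simple for-programs are normalized -/

theorem SBExpr.WF.tgt {p b : ℕ} : ∀ {e : SBExpr D}, e.WF p b → e.toHigh.Tgt p b
  | .tt, _ | .ff, _ => trivial
  | .not e, h => SBExpr.WF.tgt (e := e) h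
  | .bin _ _ _, h => ⟨h.1.tgt, h.2.tgt⟩
  | .bvar _, h => h
  | .comp _ _ _, h => h
  | .labelEq _ _, h => ⟨_, _, rfl, rfl, h⟩

theorem letBools_tgt {p n : ℕ} {s : Stmt D} : ∀ {k b : ℕ}, s.Tgt p (b + k) n →
    (letBools k s).Tgt p b n
  | 0, _, h => h
  | k + 1, b, h => by
      refine letBools_tgt (k := k) (b := b + 1) ?_
      rwa [Nat.add_assoc, Nat.add_comm 1 k]

theorem SStmt.WF.tgt : ∀ {S : SStmt D} {p b : ℕ}, S.WF p b → (S.toHigh p).Tgt p b 1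
  | .skip, _, _, _ => trivial
  | .ite _ _ _, _, _, h => ⟨h.1.tgt, h.2.1.tgt, h.2.2.tgt⟩
  | .printChar a, _, _, _ => ⟨0, rfl, rfl, a, rfl⟩
  | .printLabel _, _, _, h => ⟨0, rfl, .inl ⟨rfl, h⟩⟩
  | .setTrue _, _, _, h => h
  | .loop _ _ S, _, _, h => ⟨rfl, letBools_tgt (SStmt.WF.tgt (S := S) h)⟩
  | .seq _ _, _, _, h => ⟨h.1.tgt, h.2.tgt⟩

theorem SBExpr.no_H {φ : List Bool} : ∀ e : SBExpr D, e.toHigh.No .H φ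
  | .tt | .ff | .bvar _ | .comp _ _ _ => trivial
  | .not e => SBExpr.no_H e
  | .bin _ e₁ e₂ => ⟨e₁.no_H, e₂.no_H⟩
  | .labelEq _ _ => ⟨nofun, trivial⟩

theorem SStmt.no_H : ∀ (S : SStmt D) (p : ℕ) (φ : List Bool), (S.toHigh p).No .H φ
  | .skip, _, _ | .setTrue _, _, _ | .printLabel _, _, _ => trivial
  | .ite e s t, p, φ => ⟨fun _ => ⟨SStmt.not_isLetBool_toHigh _ _, SStmt.not_isLetBool_toHigh _ _⟩,
      e.no_H, s.no_H p φ, t.no_H p φ⟩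
  | .printChar _, _, _ => nofun
  | .loop _ _ s, p, _ => ⟨nofun, trivial, letBools_no.2 (s.no_H (p + 1) _)⟩
  | .seq s t, p, φ => ⟨fun _ => ⟨SStmt.not_isLetBool_toHigh _ _, SStmt.not_isLetBool_toHigh _ _⟩,
      s.no_H p φ, t.no_H p φ⟩

theorem SBExpr.exists_of_hasType {p b : ℕ} {φ : List Bool} : ∀ {e : BExpr D},
    e.HasType (wordCtx p b) → (∀ X, e.No X φ) → ∃ e' : SBExpr D, e'.WF p b ∧ e'.toHigh = e
  | .tt, _, _ => ⟨.tt, trivial, rfl⟩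
  | .ff, _, _ => ⟨.ff, trivial, rfl⟩
  | .not e, h, hn => by
      obtain ⟨e', h', rfl⟩ := SBExpr.exists_of_hasType (e := e) h hn
      exact ⟨.not e', h', rfl⟩
  | .bin op e₁ e₂, h, hn => by
      obtain ⟨e₁', h₁', rfl⟩ := SBExpr.exists_of_hasType h.1 fun X => (hn X).1
      obtain ⟨e₂', h₂', rfl⟩ := SBExpr.exists_of_hasType h.2 fun X => (hn X).2
      exact ⟨.bin op e₁' e₂', ⟨h₁', h₂'⟩, rfl⟩
  | .bvar x, h, _ => ⟨.bvar x, h, rfl⟩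
  | .comp op i j, ⟨o, hi, hj⟩, _ =>
      ⟨.comp op i j, ⟨((wordCtx_poss _ _ _ _).1 hi).1, ((wordCtx_poss _ _ _ _).1 hj).1⟩, rfl⟩
  | .litEq c o, ⟨n, hc, ho⟩, hn => by
      obtain ⟨a, x, rfl, rfl, hx⟩ := (hn .A).1 rfl
      obtain rfl : n = 0 := hc
      have := (wordCtx_lists _ _ _ _).1 ho
      exact ⟨.labelEq x a, by simpa [SBExpr.WF] using this, rfl⟩
  | .call _ _, _, hn => absurd rfl (hn .C).1
  | .gen _, _, hn => absurd rfl (hn .D).1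

theorem eq_zero_of_not_isLetBool {s : Stmt D} : ∀ {k : ℕ}, ¬ (letBools k s).IsLetBool → k = 0
  | 0, _ => rfl
  | _ + 1, h => absurd ⟨_, rfl⟩ h

theorem SStmt.exists_of_hasType : ∀ {s : Stmt D} {p b : ℕ} {φ : List Bool},
    s.HasType (wordCtx p b) (.out 1) → (∀ X, s.No X φ) →
      ∃ (k : ℕ) (S : SStmt D), S.WF p (b + k) ∧ letBools k (S.toHigh p) = s
  | .skip, _, _, _, _, _ => ⟨0, .skip, trivial, rfl⟩
  | .ite e s t, _, _, _, h, hn => by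
      obtain ⟨e', he, rfl⟩ := SBExpr.exists_of_hasType h.1 fun X => (hn X).2.1
      obtain ⟨k, S, hS, rfl⟩ := SStmt.exists_of_hasType h.2.1 fun X => (hn X).2.2.1
      obtain ⟨m, T, hT, rfl⟩ := SStmt.exists_of_hasType h.2.2 fun X => (hn X).2.2.2
      obtain rfl := eq_zero_of_not_isLetBool ((hn .H).1 rfl).1
      obtain rfl := eq_zero_of_not_isLetBool ((hn .H).1 rfl).2
      exact ⟨0, .ite e' S T, ⟨he, hS, hT⟩, rfl⟩
  | .yield (.var x), _, _, _, ⟨n, hn, h⟩, _ => by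
      obtain rfl : n = 0 := by simpa [eq_comm] using hn
      exact ⟨0, .printLabel x, by simpa [SStmt.WF] using (wordCtx_lists _ _ _ _).1 h, rfl⟩
  | .yield (.const c), _, _, _, _, hn => by
      obtain ⟨a, rfl⟩ := hn .B rfl
      exact ⟨0, .printChar a, trivial, rfl⟩
  | .yield (.list _ _), _, _, _, _, hn => absurd rfl (hn .B).1
  | .yield (.call _ _), _, _, _, _, hn => absurd rfl (hn .C).1
  | .yield (.gen m s), _, _, _, ⟨n, hτ, h⟩, hn => by
      obtain rfl : n = 0 := by simpa [eq_comm] using hτ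
      exact absurd h.1.symm ((hn .F).1 rfl)
  | .ret _, _, _, _, _, hn => absurd rfl (hn .F).1
  | .bret _, _, _, _, h, _ => by simpa using h.1
  | .letOut _ _, _, _, _, _, hn => absurd rfl (hn .E).1.1
  | .letBool s, p, b, _, h, hn => by
      obtain ⟨k, S, hS, rfl⟩ := SStmt.exists_of_hasType (s := s) (p := p) (b := b + 1) h hn
      exact ⟨k + 1, S, by rwa [Nat.add_assoc, Nat.add_comm 1 k] at hS, rfl⟩
  | .setTrue x, _, _, _, h, _ => ⟨0, .setTrue x, h, rfl⟩
  | .loop d o s, p, b, _, ⟨n, ho, h⟩, hn => by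
      obtain ⟨x, rfl⟩ := (hn .G).1 rfl
      obtain ⟨rfl, rfl⟩ : n = 0 ∧ x = p := by simpa using (wordCtx_lists _ _ _ _).1 ho
      rw [wordCtx_addLoop] at h
      obtain ⟨k, S, hS, rfl⟩ := SStmt.exists_of_hasType h fun X => (hn X).2.2
      exact ⟨0, .loop d k S, hS, rfl⟩
  | .seq s t, _, _, _, h, hn => by
      obtain ⟨k, S, hS, rfl⟩ := SStmt.exists_of_hasType h.1 fun X => (hn X).2.1
      obtain ⟨m, T, hT, rfl⟩ := SStmt.exists_of_hasType h.2 fun X => (hn X).2.2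
      obtain rfl := eq_zero_of_not_isLetBool ((hn .H).1 rfl).1
      obtain rfl := eq_zero_of_not_isLetBool ((hn .H).1 rfl).2
      exact ⟨0, .seq S T, ⟨hS, hT⟩, rfl⟩

theorem Pass.num_lt (X : Pass) : X.num < 8 := by cases X <;> decide

/-- The normalized programs are the translations of the simple for-programs. -/
theorem hasType_normalized_iff (P : Prog D) :
    P.HasType wordToWord ∧ Normalized P ↔ ∃ S : SProg D, S.WF ∧ S.toHigh = P := by
  constructor
  · rintro ⟨hP, hN⟩
    obtain ⟨s, rfl, hs⟩ := hP.eq_single (hN .C)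
    have hn := (hs.irreducible_iff (k := 8)).1 fun X _ => hN X
    obtain ⟨k, S, hS, rfl⟩ := SStmt.exists_of_hasType (p := 0) (b := 0) hs fun X => hn X X.num_lt
    exact ⟨⟨k, S⟩, by simpa [SProg.WF] using hS, rfl⟩
  · rintro ⟨⟨k, S⟩, hS, rfl⟩
    have ht : (letBools k (S.toHigh 0)).Tgt 0 0 1 :=
      letBools_tgt (SStmt.WF.tgt (by simpa [SProg.WF] using hS))
    have hs : (letBools k (S.toHigh 0)).HasType (bodyCtx [] wordToWord.params) wordToWord.ret :=
      ht.hasType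
    refine ⟨Prog.hasType_single.2 hs, fun X => (hs.irreducible_iff (k := 8)).2 (fun X _ => ?_) X
      X.num_lt⟩
    by_cases hX : X = .H
    · subst hX
      exact letBools_no.2 (S.no_H 0 [])
    · exact ht.no hX

/-! ### Semantics of the translation -/

theorem letBools_eval (F : List (FnVal D)) (L : List (NWord D)) (I : List ℕ) (s : Stmt D) :
    ∀ (k : ℕ) (β : List Bool), (letBools k s).eval F L I β =
      { s.eval F L I (List.replicate k false ++ β) with
        bools := (s.eval F L I (List.replicate k false ++ β)).bools.drop k }
  | 0, β => by simp [letBools]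
  | k + 1, β => by
      have : List.replicate k false ++ false :: β = List.replicate (k + 1) false ++ β := by
        rw [List.replicate_succ', List.append_assoc]
        rfl
      simp [letBools, Stmt.eval, letBools_eval F L I s k, this, List.drop_drop, ← List.drop_one]

/-- The label of a position, as a nested word. -/
def labelAt (w : List D) (i : ℕ) : NWord D := (w[i]?).elim (.list []) .char

theorem zipIdx_map_char (w : List D) :
    (w.map NWord.char).zipIdx = (List.range w.length).map fun i => (labelAt w i, i) := by
  refine List.ext_getElem (by simp) fun i h₁ h₂ => ?_
  simp at h₁
  simp [labelAt, h₁]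

/-- The effect of a statement that prints a word. -/
def printEffect (r : List Bool × List D) : Effect D := ⟨r.1, r.2.map .char, none⟩

theorem runLoop_eq {body : ℕ → NWord D → List Bool → Effect D}
    {body' : ℕ → List Bool → List Bool × List D} {g : ℕ → NWord D} :
    ∀ {l : List ℕ} (_ : ∀ i ∈ l, ∀ β, body i (g i) β = printEffect (body' i β)) (β : List Bool),
      runLoop body (l.map fun i => (g i, i)) β = printEffect (runSLoop body' l β)
  | [], _, _ => rfl
  | i :: l, h, β => by
      have hi := h i List.mem_cons_self β
      have hl := runLoop_eq (l := l) fun j hj => h j (List.mem_cons_of_mem _ hj)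
      simp [runLoop, runSLoop, hi, Effect.andThen, printEffect, hl]

theorem labels_getD (w : List D) {I : List ℕ} {i : ℕ} (hi : i < I.length) :
    (I.map (labelAt w) ++ [NWord.ofWord w]).getD i (.list []) = labelAt w (I.getD i 0) := by
  simp [List.getD_eq_getElem?_getD, List.getElem?_append_left, hi]

theorem SBExpr.eval_toHigh (F : List (FnVal D)) (w : List D) {I : List ℕ} (β : List Bool) {b : ℕ} :
    ∀ {e : SBExpr D}, e.WF I.length b →
      (e.toHigh.eval F (I.map (labelAt w) ++ [NWord.ofWord w]) I β).down = e.eval w I β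
  | .tt, _ | .ff, _ | .bvar _, _ | .comp _ _ _, _ => rfl
  | .not e, h => by
      simp [SBExpr.toHigh, BExpr.eval, SBExpr.eval, SBExpr.eval_toHigh F w β (e := e) h]
  | .bin _ _ _, h => by
      simp [SBExpr.toHigh, BExpr.eval, SBExpr.eval, SBExpr.eval_toHigh F w β h.1,
        SBExpr.eval_toHigh F w β h.2]
  | .labelEq i a, h => by
      refine decide_eq_decide.2 ?_
      rw [show OExpr.eval F (I.map (labelAt w) ++ [NWord.ofWord w]) I (.var i) = _ from
        labels_getD w h, CExpr.value, labelAt]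
      cases w[I.getD i 0]? with
      | none => simp
      | some b => simp [eq_comm (a := a)]

theorem SStmt.eval_toHigh (F : List (FnVal D)) (w : List D) : ∀ {S : SStmt D} {I : List ℕ}
    {β : List Bool} {b : ℕ}, S.WF I.length b → (∀ i ∈ I, i < w.length) →
      (S.toHigh I.length).eval F (I.map (labelAt w) ++ [NWord.ofWord w]) I β =
        printEffect (S.eval w I β)
  | .skip, _, _, _, _, _ | .setTrue _, _, _, _, _, _ | .printChar _, _, _, _, _, _ => rfl
  | .ite _ _ _, I, β, _, h, hI => by
      simp only [SStmt.toHigh, Stmt.eval, SStmt.eval, SBExpr.eval_toHigh F w β h.1,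
        SStmt.eval_toHigh F w h.2.1 hI, SStmt.eval_toHigh F w h.2.2 hI]
      split_ifs <;> rfl
  | .printLabel i, I, β, _, h, hI => by
      have h' : i < I.length := h
      have : I[i] < w.length := hI _ (List.getElem_mem h')
      simp only [SStmt.toHigh, Stmt.eval, SStmt.eval, OExpr.eval]
      rw [labels_getD w h']
      simp [printEffect, labelAt, h', this]
  | .loop d k S, I, β, _, h, hI => by
      have hL : (I.map (labelAt w) ++ [NWord.ofWord w]).getD I.length (.list []) =
          NWord.ofWord w := by simp
      have hE : (NWord.ofWord w).elems.zipIdx =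
          (List.range w.length).map fun i => (labelAt w i, i) := zipIdx_map_char w
      simp only [SStmt.toHigh, Stmt.eval, SStmt.eval, OExpr.eval]
      rw [hL, hE]
      have key : ∀ l : List ℕ, (∀ i ∈ l, i < w.length) → _ := fun l hl =>
        runLoop_eq (l := l) (g := labelAt w)
          (body := fun i x β => (letBools k (S.toHigh (I.length + 1))).eval F
            (x :: (I.map (labelAt w) ++ [NWord.ofWord w])) (i :: I) β)
          (body' := fun i β =>
            let r := S.eval w (i :: I) (List.replicate k false ++ β)
            (r.1.drop k, r.2))
          (fun i hi β => by
            have := SStmt.eval_toHigh F w (S := S) (I := i :: I)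
              (β := List.replicate k false ++ β) h
              (List.forall_mem_cons.2 ⟨hl i hi, hI⟩)
            simp only [List.length_cons, List.map_cons, List.cons_append] at this
            simp [letBools_eval, this, printEffect]) β
      cases d with
      | fwd => exact key (List.range w.length) fun i hi => by simpa using hi
      | bwd =>
          simp only [Dir.order, ← List.map_reverse]
          exact key (List.range w.length).reverse fun i hi => by simpa using hi
  | .seq s t, I, β, _, h, hI => by
      simp only [SStmt.toHigh, Stmt.eval, SStmt.eval, SStmt.eval_toHigh F w h.1 hI]
      simp [Effect.andThen, printEffect, SStmt.eval_toHigh F w h.2 hI]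

theorem SProg.eval_toHigh {S : SProg D} (hS : S.WF) (w : List D) :
    S.toHigh.eval [NWord.ofWord w] [] = Sum.inl (NWord.ofWord (S.eval w)) := by
  have := SStmt.eval_toHigh (I := []) (β := List.replicate S.bools false) [] w hS (by simp)
  simp only [List.length_nil, List.map_nil, List.nil_append] at this
  simp only [Prog.eval, SProg.toHigh, evalFns, callFn, letBools_eval, List.append_nil,
    List.nil_append, List.getElem?_cons_zero, this]
  rfl

/-! ### Running the steps one after the other -/

theorem Irreducible.C_of_length {P Q : Prog D} (h : Irreducible .C P)
    (hf : Q.funs.length = P.funs.length) (hm : Q.main = P.main) : Irreducible .C Q := by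
  rw [irreducible_C_iff] at h ⊢
  rwa [hf, hm]

theorem Irreducible.mapBody {P : Prog D} {g : Stmt D → Stmt D} {Y : Pass}
    (h : Y ≠ .C → P.No Y → (P.mapBody g).No Y) (hY : Irreducible Y P) :
    Irreducible Y (P.mapBody g) := by
  by_cases hC : Y = .C
  · subst hC
    exact hY.C_of_length (by simp [Prog.mapBody]) rfl
  · rw [irreducible_iff hC] at hY ⊢
    exact h hC hY

theorem Pass.num_injective : Function.Injective Pass.num := by
  intro X Y h
  cases X <;> cases Y <;> simp_all [Pass.num]

/-- A step creates no redexes of the previous steps. -/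
theorem Step.irreducible {X Y : Pass} {P Q : Prog D} {σ : Sig} (hP : InScope X P σ)
    (h : Step X P Q) (hYX : Y.num < X.num) (hY : Irreducible Y P) : Irreducible Y Q := by
  have hF : X = .F → Irreducible Y Q := by
    rintro rfl
    exact (step_F_spec hP h).2 Y (hYX.trans (by decide))
  have hG : X = .G → Irreducible Y Q := by
    rintro rfl
    exact (step_G_spec hP h).2 Y (hYX.trans (by decide))
  cases h with
  | litEq => simp [Pass.num] at hYX
  | lit _ φ n cs hn =>
      obtain rfl : Y = .A := Pass.num_injective (by simpa [Pass.num] using hYX)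
      rw [irreducible_A_iff] at hY ⊢
      exact hY.elimLit n cs
  | list _ φ n es hn =>
      obtain rfl : Y = .A := Pass.num_injective (by simpa [Pass.num] using hYX)
      rw [irreducible_A_iff] at hY ⊢
      exact hY.list
  | call _ j f hf hj =>
      have hC : Y ≠ .C := by rintro rfl; simp at hYX
      rw [irreducible_iff hC] at hY ⊢
      exact hY.inlineFn hYX hf
  | boolGen =>
      exact hY.mapBody fun _ h => Prog.No.boolGen (hYX.trans (by decide)) fun _ => h
  | letOut =>
      exact hY.mapBody fun _ h => Prog.No.letOut (hYX.trans (by decide)) fun _ => h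
  | ret => exact hF rfl
  | forLoop => exact hG rfl
  | letBool => exact hY.mapBody fun _ h => Prog.No.letBool fun _ => h

/-- The steps preserve types. -/
theorem Step.hasType_of_inScope {X : Pass} {P Q : Prog D} {σ : Sig} (hP : InScope X P σ)
    (h : Step X P Q) : Q.HasType σ := by
  by_cases hF : X = .F
  · subst hF
    exact (step_F_spec hP h).1
  by_cases hG : X = .G
  · subst hG
    exact (step_G_spec hP h).1
  exact h.hasType hP.1 hF hG

theorem acc_of_irreducible {X : Pass} {P : Prog D} (h : ∀ Q, Step X P Q → Irreducible X Q) :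
    Acc (fun Q' Q => Step X Q Q') P :=
  .intro _ fun Q hQ => .intro _ fun R hR => absurd hR (h Q hQ R)

/-- The steps terminate. -/
theorem InScope.acc {X : Pass} {P : Prog D} {σ : Sig} (hP : InScope X P σ) :
    Acc (fun Q' Q => Step X Q Q') P := by
  cases X with
  | A => exact step_A_wf.apply P
  | B => exact step_B_wf.apply P
  | C => exact step_C_wf.apply P
  | D =>
      refine acc_of_irreducible ?_
      rintro Q ⟨⟩
      exact (irreducible_iff (X := .D) nofun).2 (Prog.No.boolGen (by decide) (absurd rfl))
  | E =>
      refine acc_of_irreducible ?_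
      rintro Q ⟨⟩
      exact (irreducible_iff (X := .E) nofun).2 (Prog.No.letOut (by decide) (absurd rfl))
  | F => exact acc_of_irreducible fun Q hQ => (step_F_spec hP hQ).2 .F (by decide)
  | G => exact acc_of_irreducible fun Q hQ => (step_G_spec hP hQ).2 .G (by decide)
  | H =>
      refine acc_of_irreducible ?_
      rintro Q ⟨⟩
      exact (irreducible_iff (X := .H) nofun).2 (Prog.No.letBool (absurd rfl))

theorem exists_exhaust {X : Pass} {P : Prog D} (h : Acc (fun Q' Q => Step X Q Q') P) :
    ∃ Q, Exhaust X P Q := by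
  induction h with
  | intro P _ ih =>
      by_cases hP : ∃ Q, Step X P Q
      · obtain ⟨Q, hQ⟩ := hP
        obtain ⟨R, hR, hI⟩ := ih Q hQ
        exact ⟨R, .head hQ hR, hI⟩
      · exact ⟨P, .refl, fun Q hQ => hP ⟨Q, hQ⟩⟩

/-- The programs of type `Out[1] → Out[1]` to which the first `k` steps cannot be applied. -/
def Reduced (k : ℕ) (P : Prog D) : Prop :=
  P.HasType wordToWord ∧ ∀ Y : Pass, Y.num < k → Irreducible Y P

theorem Reduced.inScope {X : Pass} {P : Prog D} (h : Reduced X.num P) :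
    InScope X P wordToWord := by
  refine ⟨h.1, ?_⟩
  cases X <;> first | trivial | exact ⟨h.2, rfl⟩ | exact ⟨h.2, nofun⟩

theorem Reduced.exhaust {X : Pass} {P Q : Prog D} (h : Reduced X.num P) (hQ : Exhaust X P Q) :
    Reduced (X.num + 1) Q := by
  obtain ⟨hPQ, hI⟩ := hQ
  have hQ : Reduced X.num Q := by
    clear hI
    induction hPQ with
    | refl => exact h
    | tail _ hs ih =>
        exact ⟨hs.hasType_of_inScope ih.inScope,
          fun Y hY => hs.irreducible ih.inScope hY (ih.2 Y hY)⟩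
  refine ⟨hQ.1, fun Y hY => ?_⟩
  rcases Nat.lt_succ_iff_lt_or_eq.1 hY with hY | hY
  · exact hQ.2 Y hY
  · rwa [Pass.num_injective hY]

/-- The steps can be applied exhaustively, one after the other, and nothing is left to do. -/
theorem Reduced.run : ∀ {Xs : List Pass} {k : ℕ} {P : Prog D}, Reduced k P →
    Xs.map Pass.num = List.range' k Xs.length →
      (∃ Q, Run Xs P Q) ∧ ∀ Q, Run Xs P Q → Reduced (k + Xs.length) Q
  | [], _, P, h, _ => ⟨⟨P, rfl⟩, by rintro Q rfl; exact h⟩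
  | X :: Xs, k, P, h, hk => by
      simp only [List.map_cons, List.length_cons, List.range'_succ, List.cons.injEq] at hk
      obtain ⟨rfl, hk⟩ := hk
      have key := fun {Q : Prog D} (hQ : Exhaust X P Q) => Reduced.run (h.exhaust hQ) hk
      constructor
      · obtain ⟨Q, hQ⟩ := exists_exhaust h.inScope.acc
        obtain ⟨R, hR⟩ := (key hQ).1
        exact ⟨R, Q, hQ, hR⟩
      · rintro R ⟨Q, hQ, hR⟩
        have := (key hQ).2 R hR
        rwa [Nat.add_assoc, Nat.add_comm 1] at this

theorem compiles_spec {P : Prog D} (hP : P.HasType wordToWord) :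
    (∃ Q, Compiles P Q) ∧ ∀ Q, Compiles P Q → Q.HasType wordToWord ∧ Normalized Q := by
  have := Reduced.run (Xs := [.A, .B, .C, .D, .E, .F, .G, .H]) (k := 0)
    ⟨hP, fun _ h => absurd h (Nat.not_lt_zero _)⟩ (by decide)
  exact ⟨this.1, fun Q hQ => ⟨(this.2 Q hQ).1, fun X => (this.2 Q hQ).2 X X.num_lt⟩⟩

end ForProg

open ForProg in
theorem mainTheorem1 {D : Type*} :
    -- each step preserves typing
    (∀ (X : Pass) (P Q : Prog D) (σ : Sig), InScope X P σ → Step X P Q → Q.HasType σ) ∧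
    -- each step terminates
    (∀ (X : Pass) (P : Prog D) (σ : Sig), InScope X P σ → Acc (fun Q' Q => Step X Q Q') P) ∧
    -- on programs of type `Out[1] → Out[1]`, the steps can be run exhaustively one after the other,
    -- and every such run ends with a normalized program of the same type
    (∀ P : Prog D, P.HasType wordToWord →
      (∃ Q, Compiles P Q) ∧ ∀ Q, Compiles P Q → Q.HasType wordToWord ∧ Normalized Q) ∧
    -- the normalized programs of type `Out[1] → Out[1]` are exactly the simple for-programs, up to
    -- the translation `toHigh`, which is injective and preserves the semantics
    (∀ P : Prog D, P.HasType wordToWord ∧ Normalized P ↔ ∃ S : SProg D, S.WF ∧ S.toHigh = P) ∧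
    Function.Injective (SProg.toHigh (D := D)) ∧
    (∀ S : SProg D, S.WF → ∀ w : List D,
      S.toHigh.eval [NWord.ofWord w] [] = Sum.inl (NWord.ofWord (S.eval w))) :=
  ⟨fun _ _ _ _ hP h => h.hasType_of_inScope hP, fun _ _ _ hP => hP.acc, fun _ hP => compiles_spec hP,
    hasType_normalized_iff, SProg.toHigh_injective, fun _ hS w => SProg.eval_toHigh hS w⟩
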